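/- Corollary (multiple access information embedding capacity, recovery of both hosts, independent hosts). **Model.** Let $\mathcal S_1,\mathcal S_2,\mathcal X_1,\mathcal X_2,\mathcal Y$ be finite alphabets, $p(s_1,s_2)$ a joint host distribution, $p(y|x_1,s_1,x_2,s_2)$ a memoryless channel, $d_i:\mathcal S_i\times\mathcal X_i\to[0,\infty)$ distortion functions and $\Delta_1,\Delta_2\in\mathbb R$. The host pairs $(S_{1j},S_{2j})$, $1\le j\le n$, are i.i.d. with law $p(s_1,s_2)$; the messages $W_i$ are uniform on $\{1,\dots,M_i\}$, independent of each other and of the hosts. A code with parameters $(M_1,M_2,n)$ consists of encoders $f_i:\{1,\dots,M_i\}\times\mathcal S_i^n\to\mathcal X_i^n$ ($i=1,2$) and a decoder $g:\mathcal Y^n\to\{1,\dots,M_1\}\times\mathcal S_1^n\times\{1,\dots,M_2\}\times\mathcal S_2^n$. With $X_i^n=f_i(W_i,S_i^n)$ and $Y^n$ the channel output, put $D_i^{(n)}=\mathbb E\,\frac1n\sum_{j=1}^n d_i(S_{ij},X_{ij})$ and $P_e^{(n)}=\mathbb P[g(Y^n)\ne(W_1,S_1^n,W_2,S_2^n)]$.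 A pair $(R_1,R_2)$ with $R_1,R_2\ge0$ is achievable if there is a sequence of codes with parameters $(\lceil2^{nR_1}\rceil,\lceil2^{nR_2}\rceil,n)$ such that $\lim_n D_i^{(n)}$ exists and is at most $\Delta_i$ for $i=1,2$, and $\lim_nP_e^{(n)}=0$. The capacity region $\mathcal C(\Delta_1,\Delta_2)$ is the closure of the set of achievable pairs. **Region.** Let $\mathcal P(\Delta_1,\Delta_2)$ be the set of tuples $(Q,S_1,S_2,X_1,X_2,Y)$, with $Q$ in an arbitrary finite alphabet, whose joint law is $p(q)\,p(s_1,s_2)\,p(x_1|s_1,q)\,p(x_2|s_2,q)\,p(y|x_1,s_1,x_2,s_2)$, with the given host distribution and channel, and which satisfy $\mathbb E\,d_i(S_i,X_i)\le\Delta_i$ for $i=1,2$. With entropies in bits, put for such a tuple $$a_1=I(X_1,S_1;Y|X_2,S_2,Q)-H(S_1|S_2),\qquad a_2=I(X_2,S_2;Y|X_1,S_1,Q)-H(S_2|S_1),$$ $$a_{12}=I(X_1,S_1,X_2,S_2;Y|Q)-H(S_1,S_2).$$ Let $\mathcal R$ be the set of all $(R_1,R_2)\in\mathbb R^2$ such that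 $R_1<a_1$, $R_2<a_2$ and $R_1+R_2<a_{12}$ for some tuple in $\mathcal P(\Delta_1,\Delta_2)$. **Statement.** Suppose that $S_1$ and $S_2$ are independent (so $p(s_1,s_2)=p(s_1)p(s_2)$). Exclude the borderline case, that is, assume: if some tuple in $\mathcal P(\Delta_1,\Delta_2)$ has $a_1,a_2,a_{12}\ge0$, then some tuple in $\mathcal P(\Delta_1,\Delta_2)$ satisfies ($a_1>0$ or $H(S_1)=0$), ($a_2>0$ or $H(S_2)=0$) and ($a_{12}>0$ or $H(S_1,S_2)=0$). Then $$\mathcal C(\Delta_1,\Delta_2)=\overline{\mathcal R}\cap[0,\infty)^2 .$$ (In particular the capacity region is empty when no tuple makes all three bounds nonnegative.) -/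

import Mathlib

noncomputable section

open Filter Topology

namespace InfoEmbedding

/-! ### Entropies (in bits) of random variables on a finite probability space

`p : Ω → ℝ` is a probability mass function on a finite set `Ω`; random variables are functions on `Ω`. -/

section Entropy

variable {Ω A B C : Type*} [Fintype Ω] [Fintype A] [Fintype B] [Fintype C]

open Classical in
/-- The probability that the random variable `f` takes the value `a`. -/
def prob (p : Ω → ℝ) (f : Ω → A) (a : A) : ℝ := ∑ ω with f ω = a, p ω

/-- The expectation of a real random variable. -/
def expect (p : Ω → ℝ) (f : Ω → ℝ) : ℝ := ∑ ω, p ω * f ω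

/-- Shannon entropy `H(f) = - ∑ a, P[f = a] log₂ P[f = a]`. -/
def entropy (p : Ω → ℝ) (f : Ω → A) : ℝ := ∑ a, Real.negMulLog (prob p f a) / Real.log 2

/-- Conditional entropy `H(f | g) = H(f, g) - H(g)`. -/
def condEntropy (p : Ω → ℝ) (f : Ω → A) (g : Ω → B) : ℝ :=
  entropy p (fun ω => (f ω, g ω)) - entropy p g

/-- Conditional mutual information `I(f ; g | h) = H(f | h) - H(f | g, h)`. -/
def condMutualInfo (p : Ω → ℝ) (f : Ω → A) (g : Ω → B) (h : Ω → C) : ℝ :=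
  condEntropy p f h - condEntropy p f (fun ω => (g ω, h ω))

end Entropy

/-! ### The multiple access information embedding model -/

section Model

variable (S₁ S₂ X₁ X₂ Y : Type*) [Fintype S₁] [Fintype S₂] [Fintype X₁] [Fintype X₂] [Fintype Y]

/-- A two-user multiple access information embedding problem with finite alphabets:
the joint law `p(s₁, s₂)` of the hosts, the memoryless channel `p(y | x₁, s₁, x₂, s₂)`, and the
nonnegative distortion functions `d₁`, `d₂`. -/
structure Model where
  host : S₁ × S₂ → ℝ
  host_mem : host ∈ stdSimplex ℝ (S₁ × S₂)
  channel : X₁ → S₁ → X₂ → S₂ → Y → ℝ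
  channel_mem : ∀ x₁ s₁ x₂ s₂, channel x₁ s₁ x₂ s₂ ∈ stdSimplex ℝ Y
  d₁ : S₁ → X₁ → ℝ
  d₁_nonneg : ∀ s x, 0 ≤ d₁ s x
  d₂ : S₂ → X₂ → ℝ
  d₂_nonneg : ∀ s x, 0 ≤ d₂ s x

/-- A code with message sets of sizes `M₁`, `M₂` and block length `n`, whose decoder produces both
messages and both host sequences. -/
structure Code (M₁ M₂ n : ℕ) where
  enc₁ : Fin M₁ → (Fin n → S₁) → (Fin n → X₁)
  enc₂ : Fin M₂ → (Fin n → S₂) → (Fin n → X₂)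
  dec : (Fin n → Y) → Fin M₁ × (Fin n → S₁) × Fin M₂ × (Fin n → S₂)

/-- Messages, host sequences and channel output of one use of a code of block length `n`. -/
structure Outcome (M₁ M₂ n : ℕ) where
  w₁ : Fin M₁
  w₂ : Fin M₂
  s₁ : Fin n → S₁
  s₂ : Fin n → S₂
  y : Fin n → Y

end Model

section Coding

variable {S₁ S₂ X₁ X₂ Y : Type*} [Fintype S₁] [Fintype S₂] [Fintype X₁] [Fintype X₂] [Fintype Y]

/-- An outcome is a tuple of its components. -/
def Outcome.equiv (M₁ M₂ n : ℕ) : Outcome S₁ S₂ Y M₁ M₂ n ≃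
    Fin M₁ × Fin M₂ × (Fin n → S₁) × (Fin n → S₂) × (Fin n → Y) where
  toFun ω := (ω.w₁, ω.w₂, ω.s₁, ω.s₂, ω.y)
  invFun t := ⟨t.1, t.2.1, t.2.2.1, t.2.2.2.1, t.2.2.2.2⟩
  left_inv _ := rfl
  right_inv _ := rfl

instance (M₁ M₂ n : ℕ) : Fintype (Outcome S₁ S₂ Y M₁ M₂ n) := by
  classical exact Fintype.ofEquiv _ (Outcome.equiv M₁ M₂ n).symm

/-- The hosts `S₁` and `S₂` are independent. -/
def Model.IndepHosts (m : Model S₁ S₂ X₁ X₂ Y) : Prop :=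
  ∀ s₁ s₂, m.host (s₁, s₂) = (∑ t₂, m.host (s₁, t₂)) * ∑ t₁, m.host (t₁, s₂)

namespace Code

variable {M₁ M₂ n : ℕ} (m : Model S₁ S₂ X₁ X₂ Y) (c : Code S₁ S₂ X₁ X₂ Y M₁ M₂ n)

/-- The law of `(W₁, W₂, S₁ⁿ, S₂ⁿ, Yⁿ)`: uniform independent messages, independent of the i.i.d. host
pairs, with the embedded signals sent through the memoryless channel. -/
def law (ω : Outcome S₁ S₂ Y M₁ M₂ n) : ℝ :=
  (1 / (M₁ : ℝ)) * (1 / (M₂ : ℝ)) * (∏ j, m.host (ω.s₁ j, ω.s₂ j)) *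
    ∏ j, m.channel (c.enc₁ ω.w₁ ω.s₁ j) (ω.s₁ j) (c.enc₂ ω.w₂ ω.s₂ j) (ω.s₂ j) (ω.y j)

/-- Expected per-letter distortion at the first encoder. -/
def distortion₁ : ℝ :=
  expect (c.law m) fun ω => (1 / (n : ℝ)) * ∑ j, m.d₁ (ω.s₁ j) (c.enc₁ ω.w₁ ω.s₁ j)

/-- Expected per-letter distortion at the second encoder. -/
def distortion₂ : ℝ :=
  expect (c.law m) fun ω => (1 / (n : ℝ)) * ∑ j, m.d₂ (ω.s₂ j) (c.enc₂ ω.w₂ ω.s₂ j)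

open Classical in
/-- The probability that the decoder fails to recover both messages and both host sequences. -/
def errorProb : ℝ :=
  ∑ ω with c.dec ω.y ≠ (ω.w₁, ω.s₁, ω.w₂, ω.s₂), c.law m ω

end Code

/-- The rate pair `R` is achievable with distortions `Δ₁`, `Δ₂` and recovery of both hosts. -/
def Achievable (m : Model S₁ S₂ X₁ X₂ Y) (Δ₁ Δ₂ : ℝ) (R : ℝ × ℝ) : Prop :=
  0 ≤ R.1 ∧ 0 ≤ R.2 ∧
  ∃ c : ∀ n : ℕ, Code S₁ S₂ X₁ X₂ Y
      ⌈(2 : ℝ) ^ ((n : ℝ) * R.1)⌉₊ ⌈(2 : ℝ) ^ ((n : ℝ) * R.2)⌉₊ n,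
    (∃ D₁ ≤ Δ₁, Tendsto (fun n => (c n).distortion₁ m) atTop (𝓝 D₁)) ∧
    (∃ D₂ ≤ Δ₂, Tendsto (fun n => (c n).distortion₂ m) atTop (𝓝 D₂)) ∧
    Tendsto (fun n => (c n).errorProb m) atTop (𝓝 0)

/-- The capacity region: the closure of the set of achievable rate pairs. -/
def capacityRegion (m : Model S₁ S₂ X₁ X₂ Y) (Δ₁ Δ₂ : ℝ) : Set (ℝ × ℝ) :=
  closure {R | Achievable m Δ₁ Δ₂ R}

end Coding

/-! ### Single-letter quantities -/

section SingleLetter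

variable {Q S₁ S₂ X₁ X₂ Y : Type*}

/-- Values of a tuple `(Q, S₁, S₂, X₁, X₂, Y)`. -/
abbrev Letters (Q S₁ S₂ X₁ X₂ Y : Type*) := Q × S₁ × S₂ × X₁ × X₂ × Y

namespace Letters

abbrev q (ω : Letters Q S₁ S₂ X₁ X₂ Y) : Q := ω.1
abbrev s₁ (ω : Letters Q S₁ S₂ X₁ X₂ Y) : S₁ := ω.2.1
abbrev s₂ (ω : Letters Q S₁ S₂ X₁ X₂ Y) : S₂ := ω.2.2.1
abbrev x₁ (ω : Letters Q S₁ S₂ X₁ X₂ Y) : X₁ := ω.2.2.2.1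
abbrev x₂ (ω : Letters Q S₁ S₂ X₁ X₂ Y) : X₂ := ω.2.2.2.2.1
abbrev y (ω : Letters Q S₁ S₂ X₁ X₂ Y) : Y := ω.2.2.2.2.2

end Letters

variable [Fintype Q] [Fintype S₁] [Fintype S₂] [Fintype X₁] [Fintype X₂] [Fintype Y]

/-- The joint law of `(Q, S₁, S₂, X₁, X₂, Y)` has the form
`p(q) p(s₁, s₂) p(x₁ | s₁, q) p(x₂ | s₂, q) p(y | x₁, s₁, x₂, s₂)`, with the given host law and channel,
and `E dᵢ(Sᵢ, Xᵢ) ≤ Δᵢ` for `i = 1, 2`. -/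
def IsAdmissible (m : Model S₁ S₂ X₁ X₂ Y) (Δ₁ Δ₂ : ℝ)
    (p : Letters Q S₁ S₂ X₁ X₂ Y → ℝ) : Prop :=
  (∃ pQ ∈ stdSimplex ℝ Q, ∃ (κ₁ : S₁ → Q → X₁ → ℝ) (κ₂ : S₂ → Q → X₂ → ℝ),
    (∀ s q, κ₁ s q ∈ stdSimplex ℝ X₁) ∧ (∀ s q, κ₂ s q ∈ stdSimplex ℝ X₂) ∧
    ∀ q s₁ s₂ x₁ x₂ y, p (q, s₁, s₂, x₁, x₂, y) =
      pQ q * m.host (s₁, s₂) * κ₁ s₁ q x₁ * κ₂ s₂ q x₂ * m.channel x₁ s₁ x₂ s₂ y) ∧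
  expect p (fun ω => m.d₁ ω.s₁ ω.x₁) ≤ Δ₁ ∧
  expect p (fun ω => m.d₂ ω.s₂ ω.x₂) ≤ Δ₂

/-- `I(X₁, S₁ ; Y | X₂, S₂, Q) - H(S₁ | S₂)`. -/
def bound₁ (p : Letters Q S₁ S₂ X₁ X₂ Y → ℝ) : ℝ :=
  condMutualInfo p (fun ω => (ω.x₁, ω.s₁)) (fun ω => ω.y) (fun ω => (ω.x₂, ω.s₂, ω.q)) -
    condEntropy p (fun ω => ω.s₁) (fun ω => ω.s₂)

/-- `I(X₂, S₂ ; Y | X₁, S₁, Q) - H(S₂ | S₁)`. -/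
def bound₂ (p : Letters Q S₁ S₂ X₁ X₂ Y → ℝ) : ℝ :=
  condMutualInfo p (fun ω => (ω.x₂, ω.s₂)) (fun ω => ω.y) (fun ω => (ω.x₁, ω.s₁, ω.q)) -
    condEntropy p (fun ω => ω.s₂) (fun ω => ω.s₁)

/-- `I(X₁, S₁, X₂, S₂ ; Y | Q) - H(S₁, S₂)`. -/
def bound₁₂ (p : Letters Q S₁ S₂ X₁ X₂ Y → ℝ) : ℝ :=
  condMutualInfo p (fun ω => (ω.x₁, ω.s₁, ω.x₂, ω.s₂)) (fun ω => ω.y) (fun ω => ω.q) -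
    entropy p (fun ω => (ω.s₁, ω.s₂))

end SingleLetter

section Region

variable {S₁ S₂ X₁ X₂ Y : Type*} [Fintype S₁] [Fintype S₂] [Fintype X₁] [Fintype X₂] [Fintype Y]

/-- The pairs `(R₁, R₂)` satisfying the three strict inequalities for some admissible tuple, whose
time-sharing variable `Q` may range over any finite alphabet. -/
def innerSet (m : Model S₁ S₂ X₁ X₂ Y) (Δ₁ Δ₂ : ℝ) : Set (ℝ × ℝ) :=
  {R | ∃ (Q : Type) (_ : Fintype Q) (p : Letters Q S₁ S₂ X₁ X₂ Y → ℝ),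
    IsAdmissible m Δ₁ Δ₂ p ∧ R.1 < bound₁ p ∧ R.2 < bound₂ p ∧ R.1 + R.2 < bound₁₂ p}

/-- If the three bounds can be made nonnegative at the same time, then they can be made positive at the
same time, where positivity is not asked of a bound all of whose hosts are deterministic. -/
def NotBorderline (m : Model S₁ S₂ X₁ X₂ Y) (Δ₁ Δ₂ : ℝ) : Prop :=
  (∃ (Q : Type) (_ : Fintype Q) (p : Letters Q S₁ S₂ X₁ X₂ Y → ℝ),
    IsAdmissible m Δ₁ Δ₂ p ∧ 0 ≤ bound₁ p ∧ 0 ≤ bound₂ p ∧ 0 ≤ bound₁₂ p) →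
  ∃ (Q : Type) (_ : Fintype Q) (p : Letters Q S₁ S₂ X₁ X₂ Y → ℝ),
    IsAdmissible m Δ₁ Δ₂ p ∧
    (entropy m.host Prod.fst = 0 ∨ 0 < bound₁ p) ∧
    (entropy m.host Prod.snd = 0 ∨ 0 < bound₂ p) ∧
    (entropy m.host id = 0 ∨ 0 < bound₁₂ p)

end Region

end InfoEmbedding

end

/-! The hosts are independent, so the pair (message, host block) of each user acts as one message
drawn from a nonuniform source. The two sources are independent, and the problem becomes
transmission of two nonuniform messages over a multiple access channel whose law also depends on the
messages. Since `Real.log M₁` plus the entropy of the host block is what has to be conveyed, the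
entropies of the hosts are subtracted from the mutual informations.

Direct part. Every pair (message, host block) receives a random codeword, drawn letter by letter
from a test channel. The decoder looks for a pair of messages passing three likelihood ratio tests.
A one-shot union bound (`exists_codebooks`) charges `1 / θ` to each kind of false candidate and
otherwise leaves the probability that the true messages fail. That event is a large deviation of an
i.i.d. sum of information densities, controlled by second moments (`ite_not_passesTests_le`,
`Factors.exists_code`). The squared deviations of the distortions are averaged along with the error,
so one code has small error and distortions close to those of the tuple.

Converse. Gibbs' inequality is applied to the law of the code against a reference law made of a
guess computed from the output and a product of single-letter output laws
(`Code.LetterKernels.log_card₁_le` and its companions). This gives Fano's inequality and the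
single-letter bound in one step.

Geometry. Collect the three bounds and the two distortions in a vector of length five. Time sharing
takes convex combinations, so the attainable vectors form the convex hull of a continuous image of a
compact set, which is compact by Carathéodory. Hence both an achievable pair and a point of the
closure of `innerSet` satisfy the bounds weakly for some admissible tuple (`Model.Dominated`).

To return from weak to strict inequalities at nonnegative rates, the tuple is mixed with a small
weight of the one supplied by `NotBorderline` (`Model.Dominated.mem_capacityRegion`). A
deterministic host at rate zero needs no strict inequality, because its message carries no
uncertainty and its tests are void. -/

noncomputable section

open Filter Topology

set_option linter.unusedSectionVars false

namespace InfoEmbedding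

/-! ### Expectations under product weights. -/

section ProductWeights

variable {ι A : Type*} [Fintype ι] [Fintype A]

theorem sum_prod_eq_one [DecidableEq ι] {w : ι → A → ℝ} (hw : ∀ i, ∑ a, w i a = 1) :
    ∑ f : ι → A, ∏ i, w i (f i) = 1 := by
  rw [← Fintype.prod_sum]; simp [hw]

/-- Under a product weight, a coordinate has its own weight as marginal. -/
theorem sum_prod_mul_apply [DecidableEq ι] {w : ι → A → ℝ} (hw : ∀ i, ∑ a, w i a = 1) (j : ι)
    (g : A → ℝ) : ∑ f : ι → A, (∏ i, w i (f i)) * g (f j) = ∑ a, w j a * g a := by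
  have h : ∀ f : ι → A, (∏ i, w i (f i)) * g (f j) =
      ∏ i, w i (f i) * (if i = j then g (f i) else 1) := by
    intro f
    rw [Finset.prod_mul_distrib]
    simp
  simp_rw [h]
  rw [← Fintype.prod_sum (fun i a => w i a * (if i = j then g a else 1)),
    Finset.prod_eq_single j]
  · simp
  · intro i _ hi; simp [hi, hw]
  · simp

/-- Under a product weight, two distinct coordinates are independent. -/
theorem sum_prod_mul_apply₂ [DecidableEq ι] {w : ι → A → ℝ} (hw : ∀ i, ∑ a, w i a = 1) {j k : ι}
    (hjk : j ≠ k) (g : A → A → ℝ) :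
    ∑ f : ι → A, (∏ i, w i (f i)) * g (f j) (f k) = ∑ a, ∑ b, w j a * w k b * g a b := by
  classical
  -- Freezing the value at `k` by an indicator turns the summand into a product over coordinates, so
  -- that sum and product can be exchanged.
  have h1 : ∀ b, ∑ f : ι → A, (∏ i, w i (f i)) * (if f k = b then g (f j) b else 0) =
      ∑ a, w j a * w k b * g a b := by
    intro b
    have h : ∀ f : ι → A, (∏ i, w i (f i)) * (if f k = b then g (f j) b else 0) =
        ∏ i, w i (f i) * (if i = k then (if f i = b then 1 else 0) else 1) *
          (if i = j then g (f i) b else 1) := by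
      intro f
      rw [Finset.prod_mul_distrib, Finset.prod_mul_distrib]
      simp
    simp_rw [h]
    rw [← Fintype.prod_sum (fun i a => w i a * (if i = k then (if a = b then 1 else 0) else 1) *
          (if i = j then g a b else 1)), ← Finset.mul_prod_erase _ _ (Finset.mem_univ j),
          ← Finset.mul_prod_erase _ _ (Finset.mem_erase.2 ⟨hjk.symm, Finset.mem_univ k⟩),
          Finset.prod_eq_one]
    · simp [hjk, hjk.symm, Finset.sum_mul, mul_right_comm]
    · intro i hi
      simp only [Finset.mem_erase, Finset.mem_univ, and_true] at hi
      simp [hi.1, hi.2, hw]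
  rw [Finset.sum_comm, ← Finset.sum_congr rfl fun b _ => h1 b, Finset.sum_comm]
  refine Finset.sum_congr rfl fun f _ => ?_
  rw [← Finset.mul_sum]
  simp

end ProductWeights

/-! ### Second moments, Gibbs' inequality, averaging, and compact convex hulls. -/

section Inequalities

/-- The second moment of a centred i.i.d. sum. -/
theorem sum_prod_mul_sq {L : Type*} [Fintype L] {p : L → ℝ} (hp : ∑ l, p l = 1) {ψ : L → ℝ}
    (hψ : ∑ l, p l * ψ l = 0) (n : ℕ) :
    ∑ t : Fin n → L, (∏ j, p (t j)) * (∑ j, ψ (t j)) ^ 2 = n * ∑ l, p l * ψ l ^ 2 := by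
  have h : ∀ t : Fin n → L, (∏ j, p (t j)) * (∑ j, ψ (t j)) ^ 2 =
      ∑ i, ∑ j, (∏ j, p (t j)) * (ψ (t i) * ψ (t j)) := by
    intro t
    rw [sq, Finset.sum_mul_sum, Finset.mul_sum]
    simp_rw [Finset.mul_sum]
  simp_rw [h]
  rw [Finset.sum_comm]
  have h2 : ∀ i : Fin n, ∑ t : Fin n → L, ∑ j, (∏ j, p (t j)) * (ψ (t i) * ψ (t j)) =
      ∑ l, p l * ψ l ^ 2 := by
    intro i
    rw [Finset.sum_comm, Finset.sum_eq_single i]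
    · rw [sum_prod_mul_apply (fun _ => hp) i (fun a => ψ a * ψ a)]
      simp [sq]
    · intro j _ hj
      rw [sum_prod_mul_apply₂ (fun _ => hp) hj.symm (fun a b => ψ a * ψ b)]
      have : ∀ a b, p a * p b * (ψ a * ψ b) = (p a * ψ a) * (p b * ψ b) := by intros; ring
      simp_rw [this, ← Finset.mul_sum, hψ]
      simp
    · simp
  simp [h2]

/-- Gibbs' inequality, for a weight of total mass at most one as second argument. -/
theorem sum_mul_log_sub_log_nonneg {Ω : Type*} [Fintype Ω] {p q : Ω → ℝ} (hp : ∀ ω, 0 ≤ p ω)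
    (hp1 : ∑ ω, p ω = 1) (hq : ∀ ω, 0 ≤ q ω) (hq1 : ∑ ω, q ω ≤ 1)
    (hpq : ∀ ω, 0 < p ω → 0 < q ω) : 0 ≤ ∑ ω, p ω * (Real.log (p ω) - Real.log (q ω)) := by
  have h : ∀ ω, p ω - q ω ≤ p ω * (Real.log (p ω) - Real.log (q ω)) := by
    intro ω
    rcases (hp ω).eq_or_lt with h | h
    · simp [← h, hq ω]
    · have hq' := hpq ω h
      have := Real.log_le_sub_one_of_pos (div_pos hq' h)
      rw [Real.log_div hq'.ne' h.ne'] at this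
      have h2 := mul_le_mul_of_nonneg_left this h.le
      have h3 : p ω * (q ω / p ω - 1) = q ω - p ω := by field_simp
      nlinarith
  calc (0:ℝ) ≤ ∑ ω, (p ω - q ω) := by rw [Finset.sum_sub_distrib]; linarith
    _ ≤ _ := Finset.sum_le_sum fun ω _ => h ω

/-- Jensen's inequality for the square; the gap is the variance. It lets the deviation of an
expected distortion be bounded by a mean square deviation, which can be averaged over random codes.
-/
theorem sq_sum_mul_sub_le {Ω : Type*} [Fintype Ω] {p : Ω → ℝ} (hp : ∀ ω, 0 ≤ p ω)
    (hp1 : ∑ ω, p ω = 1) (h : Ω → ℝ) (c : ℝ) :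
    (∑ ω, p ω * h ω - c) ^ 2 ≤ ∑ ω, p ω * (h ω - c) ^ 2 := by
  set μ := ∑ ω, p ω * h ω with hμ
  have h0 : 0 ≤ ∑ ω, p ω * (h ω - μ) ^ 2 :=
    Finset.sum_nonneg fun ω _ => mul_nonneg (hp ω) (sq_nonneg _)
  have h1 : ∑ ω, p ω * (h ω - c) ^ 2 = ∑ ω, p ω * (h ω - μ) ^ 2 + (μ - c) ^ 2 := by
    have : ∀ ω, p ω * (h ω - c) ^ 2 = p ω * (h ω - μ) ^ 2 + 2 * (μ - c) * (p ω * h ω)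
      - (2 * (μ - c) * μ) * p ω + (μ - c) ^ 2 * p ω := by intro ω; ring
    simp_rw [this, Finset.sum_add_distrib, Finset.sum_sub_distrib, Finset.sum_add_distrib,
      ← Finset.mul_sum, hp1, ← hμ]
    ring
  linarith

/-- A weighted average is at least one of the averaged values. -/
theorem exists_le_of_sum_mul_le {Ω : Type*} [Fintype Ω] {p : Ω → ℝ} (hp : ∀ ω, 0 ≤ p ω)
    (hp1 : ∑ ω, p ω = 1) {h : Ω → ℝ} {c : ℝ} (hc : ∑ ω, p ω * h ω ≤ c) : ∃ ω, h ω ≤ c := by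
  by_contra! hcon
  have h1 : ∑ ω, p ω * c ≤ ∑ ω, p ω * h ω :=
    Finset.sum_le_sum fun ω _ => mul_le_mul_of_nonneg_left (hcon ω).le (hp ω)
  rw [← Finset.sum_mul, hp1, one_mul] at h1
  have h2 : ∀ ω ∈ Finset.univ, p ω * (h ω - c) = 0 := by
    rw [← Finset.sum_eq_zero_iff_of_nonneg
      (fun ω _ => mul_nonneg (hp ω) (sub_nonneg.2 (hcon ω).le))]
    simp_rw [mul_sub, Finset.sum_sub_distrib, ← Finset.sum_mul, hp1]
    linarith
  have h3 : ∀ ω, p ω = 0 := fun ω =>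
    (mul_eq_zero.1 (h2 ω (Finset.mem_univ _))).resolve_right (sub_pos.2 (hcon ω)).ne'
  simp [h3] at hp1

/-- Carathéodory: affinely independent points in dimension `d` number at most `d + 1`, so the hull
is the continuous image of a compact set of weights and points. -/
theorem isCompact_convexHull_of_isCompact {d : ℕ} {s : Set (Fin d → ℝ)} (hs : IsCompact s) :
    IsCompact (convexHull ℝ s) := by
  rcases s.eq_empty_or_nonempty with rfl | ⟨x₀, hx₀⟩
  · simp
  have hK : IsCompact (stdSimplex ℝ (Fin (d + 1)) ×ˢ
      Set.pi Set.univ (fun _ : Fin (d + 1) => s)) :=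
    (isCompact_stdSimplex ℝ _).prod (isCompact_univ_pi fun _ => hs)
  have hF : Continuous fun a : (Fin (d + 1) → ℝ) × (Fin (d + 1) → (Fin d → ℝ)) =>
      ∑ i, a.1 i • a.2 i := by fun_prop
  convert hK.image hF using 1
  ext x
  constructor
  · intro hx
    obtain ⟨ι, _, z, w, hz, hai, hw, hw1, rfl⟩ := eq_pos_convex_span_of_mem_convexHull hx
    have hcard : Fintype.card ι ≤ d + 1 := by
      have := hai.card_le_finrank_succ
      have h2 := Submodule.finrank_le (vectorSpan ℝ (Set.range z))
      simp at h2
      omega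
    obtain ⟨e⟩ : Nonempty (ι ↪ Fin (d + 1)) :=
      Function.Embedding.nonempty_of_card_le (by simpa using hcard)
    have hinj := e.injective
    -- Fewer than `d + 1` points are padded with copies of `x₀` of weight zero.
    refine ⟨(Function.extend e w 0, Function.extend e z fun _ => x₀), ⟨⟨?_, ?_⟩, ?_⟩, ?_⟩
    · intro i
      by_cases h : ∃ j, e j = i
      · obtain ⟨j, rfl⟩ := h; simp [hinj.extend_apply, (hw j).le]
      · simp [Function.extend_apply' _ _ _ h]
    · rw [← hw1]
      symm
      refine Finset.sum_of_injOn e hinj.injOn (by simp) ?_ ?_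
      · intro i _ hi
        dsimp only
        rw [Function.extend_apply']
        · rfl
        · simpa using hi
      · intro i _; simp [hinj.extend_apply]
    · intro i _
      by_cases h : ∃ j, e j = i
      · obtain ⟨j, rfl⟩ := h; simpa [hinj.extend_apply] using hz ⟨j, rfl⟩
      · simpa [Function.extend_apply' _ _ _ h] using hx₀
    · symm
      refine Finset.sum_of_injOn e hinj.injOn (by simp) ?_ ?_
      · intro i _ hi
        dsimp only
        rw [Function.extend_apply']
        · simp
        · simpa using hi
      · intro i _; simp [hinj.extend_apply]
  · rintro ⟨⟨w, z⟩, ⟨hw, hz⟩, rfl⟩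
    exact mem_convexHull_of_exists_fintype w z hw.1 hw.2 (fun i => hz i trivial) rfl

end Inequalities

/-! ### Random codebooks and false candidates for one user. -/

section RandomCoding

variable {U A B : Type*} [Fintype U] [Fintype A] [Fintype B]

/-- This is why void tests are harmless: an almost sure message can be a false candidate only for a
true message of probability zero. -/
theorem eq_zero_of_apply_eq_one {P : U → ℝ} (hP : P ∈ stdSimplex ℝ U) {u v : U} (hv : P v = 1)
    (huv : v ≠ u) : P u = 0 := by
  classical
  have h1 : P u + P v ≤ ∑ w, P w := by
    rw [← Finset.sum_pair huv.symm]
    exact Finset.sum_le_sum_of_subset_of_nonneg (Finset.subset_univ _) fun w _ _ => hP.1 w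
  rw [hP.2] at h1
  linarith [hP.1 u]

/-- The probability of a codebook whose codewords are drawn independently, that of `u` from `k u`. -/
def bookProb (k : U → A → ℝ) (f : U → A) : ℝ := ∏ u, k u (f u)

open Classical in
theorem bookProb_mem {k : U → A → ℝ} (hk : ∀ u, k u ∈ stdSimplex ℝ A) :
    bookProb k ∈ stdSimplex ℝ (U → A) :=
  ⟨fun _ => Finset.prod_nonneg fun u _ => (hk u).1 _, sum_prod_eq_one fun u => (hk u).2⟩

open Classical in
theorem sum_bookProb_mul {k : U → A → ℝ} (hk : ∀ u, k u ∈ stdSimplex ℝ A) (H : U → A → ℝ) :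
    ∑ f, bookProb k f * ∑ u, H u (f u) = ∑ u, ∑ a, k u a * H u a := by
  simp_rw [Finset.mul_sum]
  rw [Finset.sum_comm]
  exact Finset.sum_congr rfl fun u _ => sum_prod_mul_apply (fun u => (hk u).2) u (H u)

open Classical in
/-- Codewords of distinct indices are independent. -/
theorem sum_bookProb_mul_le {k : U → A → ℝ} (hk : ∀ u, k u ∈ stdSimplex ℝ A)
    {H : U → A → U → A → ℝ} (hH : ∀ u a v b, 0 ≤ H u a v b) :
    ∑ f, bookProb k f * ∑ u, ∑ v, (if v ≠ u then H u (f u) v (f v) else 0) ≤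
      ∑ u, ∑ a, k u a * ∑ v, ∑ b, k v b * H u a v b := by
  have h : ∀ u v, ∑ f : U → A, bookProb k f * (if v ≠ u then H u (f u) v (f v) else 0) ≤
      ∑ a, k u a * ∑ b, k v b * H u a v b := by
    intro u v
    by_cases huv : v = u
    · simp only [huv, ne_eq, not_true_eq_false, if_false, mul_zero, Finset.sum_const_zero]
      exact Finset.sum_nonneg fun a _ => mul_nonneg ((hk _).1 _) <|
        Finset.sum_nonneg fun b _ => mul_nonneg ((hk _).1 _) (hH _ _ _ _)
    · simp only [ne_eq, huv, not_false_eq_true, if_true]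
      refine (sum_prod_mul_apply₂ (fun u => (hk u).2) (Ne.symm huv) (fun a b => H u a v b)).le.trans ?_
      simp_rw [Finset.mul_sum, mul_assoc]
      rfl
  calc _ = ∑ u, ∑ v, ∑ f : U → A, bookProb k f * (if v ≠ u then H u (f u) v (f v) else 0) := by
        simp_rw [Finset.mul_sum]
        rw [Finset.sum_comm]
        exact Finset.sum_congr rfl fun u _ => Finset.sum_comm
    _ ≤ ∑ u, ∑ v, ∑ a, k u a * ∑ b, k v b * H u a v b :=
        Finset.sum_le_sum fun u _ => Finset.sum_le_sum fun v _ => h u v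
    _ = _ := by
        refine Finset.sum_congr rfl fun u _ => ?_
        rw [Finset.sum_comm]
        simp_rw [Finset.mul_sum]

open Classical in
/-- Markov's inequality for the number of false candidates passing a likelihood ratio test. -/
theorem sum_threshold_le {Z : Type*} [Fintype Z] {b c : Z → ℝ} {W : Z → B → ℝ} {V : B → ℝ} {θ : ℝ}
    (hθ : 0 < θ) (hb : ∀ z, 0 ≤ b z) (hc : ∀ z, 0 ≤ c z) (hbc : ∑ z, b z * c z = 1)
    (hW : ∀ z, W z ∈ stdSimplex ℝ B) :
    ∑ y, V y * ∑ z, b z * (if θ * V y < c z * W z y then 1 else 0) ≤ 1 / θ := by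
  -- On the event that the test is passed, `V y` is below `c z * W z y / θ`, and the weights `b z *
  -- c z * W z y` have total mass one.
  have h : ∀ y z, V y * (b z * (if θ * V y < c z * W z y then 1 else 0)) ≤
      (b z * c z) * W z y / θ := by
    intro y z
    split_ifs with h
    · rw [le_div_iff₀ hθ]
      nlinarith [mul_le_mul_of_nonneg_left h.le (hb z)]
    · simp only [mul_zero]
      exact div_nonneg (mul_nonneg (mul_nonneg (hb z) (hc z)) ((hW z).1 y)) hθ.le
  calc _ = ∑ y, ∑ z, V y * (b z * (if θ * V y < c z * W z y then 1 else 0)) := by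
        simp_rw [Finset.mul_sum]
    _ ≤ ∑ y, ∑ z, (b z * c z) * W z y / θ :=
        Finset.sum_le_sum fun y _ => Finset.sum_le_sum fun z _ => h y z
    _ = 1 / θ := by
        rw [Finset.sum_comm]
        simp_rw [← Finset.sum_div, ← Finset.mul_sum, (hW _).2, mul_one, hbc]

open Classical in
/-- The expected number of false candidates for one random codebook. -/
theorem sum_bookProb_mul_false_le {P : U → ℝ} (hP : P ∈ stdSimplex ℝ U) {k : U → A → ℝ}
    (hk : ∀ u, k u ∈ stdSimplex ℝ A) {W : U → A → B → ℝ} (hW : ∀ u a, W u a ∈ stdSimplex ℝ B)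
    {V : B → ℝ} (hV : ∀ y, V y = ∑ u, ∑ a, P u * k u a * W u a y) {θ : ℝ} (hθ : 0 < θ) :
    ∑ f, bookProb k f * ∑ u, ∑ v, (if v ≠ u then P u * ∑ y, W u (f u) y *
      (if P v = 1 ∨ θ * V y < P v * W v (f v) y then 1 else 0) else 0)
      ≤ 1 / θ := by
  have h1 : ∀ f : U → A, ∀ u v, (if v ≠ u then P u * ∑ y, W u (f u) y *
      (if P v = 1 ∨ θ * V y < P v * W v (f v) y then 1 else 0) else 0) =
      if v ≠ u then P u * ∑ y, W u (f u) y *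
        (if θ * V y < P v * W v (f v) y then 1 else 0) else 0 := by
    intro f u v
    by_cases huv : v ≠ u
    · rw [if_pos huv, if_pos huv]
      by_cases hv : P v = 1
      · rw [eq_zero_of_apply_eq_one hP hv huv]; simp
      · simp [hv]
    · simp [huv]
  simp_rw [h1]
  refine (sum_bookProb_mul_le hk (H := fun u a v b => P u * ∑ y, W u a y *
        (if θ * V y < P v * W v b y then 1 else 0)) ?_).trans ?_
  · intro u a v b
    refine mul_nonneg (hP.1 _) (Finset.sum_nonneg fun y _ => mul_nonneg ((hW _ _).1 _) ?_)
    split_ifs <;> norm_num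
  have h2 := sum_threshold_le (Z := U × A) (b := fun z => k z.1 z.2) (c := fun z => P z.1)
    (W := fun z => W z.1 z.2) (V := V) hθ (fun z => (hk _).1 _) (fun z => hP.1 _)
    (by rw [Fintype.sum_prod_type]; simp_rw [← Finset.sum_mul, (hk _).2, one_mul, hP.2])
    (fun z => hW _ _)
  refine le_trans (le_of_eq ?_) h2
  -- A competing codeword is independent of the transmitted one, so it faces an output with the
  -- unconditional law `V`.
  have h3 : ∀ X : B → ℝ, ∑ y, V y * X y = ∑ u, ∑ a, ∑ y, P u * k u a * W u a y * X y := by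
    intro X
    simp_rw [hV, Finset.sum_mul]
    rw [Finset.sum_comm]
    exact Finset.sum_congr rfl fun u _ => Finset.sum_comm
  rw [h3]
  refine Finset.sum_congr rfl fun u _ => Finset.sum_congr rfl fun a _ => ?_
  simp_rw [Fintype.sum_prod_type, Finset.mul_sum]
  refine Eq.trans ?_ Finset.sum_comm
  refine Finset.sum_congr rfl fun v _ => ?_
  refine Eq.trans ?_ Finset.sum_comm
  refine Finset.sum_congr rfl fun b _ => Finset.sum_congr rfl fun y _ => ?_
  ring

end RandomCoding

/-! ### False candidates at both users. -/

section TwoUsers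

variable {U₁ U₂ A₁ A₂ B : Type*} [Fintype U₁] [Fintype U₂] [Fintype A₁] [Fintype A₂] [Fintype B]
  {P₁ : U₁ → ℝ} {P₂ : U₂ → ℝ} {k₁ : U₁ → A₁ → ℝ} {k₂ : U₂ → A₂ → ℝ}
  {W : U₁ → A₁ → U₂ → A₂ → B → ℝ}

open Classical in
theorem sum_bookProb_mul_bookProb (hk₁ : ∀ u, k₁ u ∈ stdSimplex ℝ A₁)
    (hk₂ : ∀ u, k₂ u ∈ stdSimplex ℝ A₂) (Φ : U₁ → A₁ → U₂ → A₂ → ℝ) :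
    ∑ f₁, bookProb k₁ f₁ * ∑ f₂, bookProb k₂ f₂ * ∑ u₁, ∑ u₂, Φ u₁ (f₁ u₁) u₂ (f₂ u₂) =
      ∑ u₁, ∑ a₁, k₁ u₁ a₁ * ∑ u₂, ∑ a₂, k₂ u₂ a₂ * Φ u₁ a₁ u₂ a₂ := by
  rw [← sum_bookProb_mul hk₁ fun u₁ a₁ => ∑ u₂, ∑ a₂, k₂ u₂ a₂ * Φ u₁ a₁ u₂ a₂]
  refine Finset.sum_congr rfl fun f₁ _ => ?_
  congr 1
  simp_rw [← sum_bookProb_mul hk₂ (Φ _ _)]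
  rw [Finset.sum_comm]
  exact Finset.sum_congr rfl fun f₂ _ => by rw [Finset.mul_sum]

open Classical in
/-- The expected number of false candidates at both users for two random codebooks. -/
theorem sum_bookProb_mul_false_le₂ (hP₁ : P₁ ∈ stdSimplex ℝ U₁) (hP₂ : P₂ ∈ stdSimplex ℝ U₂)
    (hk₁ : ∀ u, k₁ u ∈ stdSimplex ℝ A₁) (hk₂ : ∀ u, k₂ u ∈ stdSimplex ℝ A₂)
    (hW : ∀ u₁ a₁ u₂ a₂, W u₁ a₁ u₂ a₂ ∈ stdSimplex ℝ B) {V : B → ℝ}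
    (hV : ∀ y, V y = ∑ u₁, ∑ a₁, ∑ u₂, ∑ a₂,
      P₁ u₁ * k₁ u₁ a₁ * (P₂ u₂ * k₂ u₂ a₂) * W u₁ a₁ u₂ a₂ y) {θ : ℝ} (hθ : 0 < θ) :
    ∑ f₁, bookProb k₁ f₁ * ∑ f₂, bookProb k₂ f₂ * ∑ u₁, ∑ v₁, (if v₁ ≠ u₁ then
      ∑ u₂, ∑ v₂, (if v₂ ≠ u₂ then P₁ u₁ * P₂ u₂ * ∑ y, W u₁ (f₁ u₁) u₂ (f₂ u₂) y *
        (if P₁ v₁ = 1 ∨ P₂ v₂ = 1 ∨ θ * V y < P₁ v₁ * P₂ v₂ * W v₁ (f₁ v₁) v₂ (f₂ v₂) y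
          then 1 else 0) else 0) else 0) ≤ 1 / θ := by
  set H : U₁ → A₁ → U₁ → A₁ → U₂ → A₂ → U₂ → A₂ → ℝ := fun u₁ a₁ v₁ b₁ u₂ a₂ v₂ b₂ =>
    P₁ u₁ * P₂ u₂ * ∑ y, W u₁ a₁ u₂ a₂ y *
        (if θ * V y < P₁ v₁ * P₂ v₂ * W v₁ b₁ v₂ b₂ y then 1 else 0) with hHdef
  have hH : ∀ u₁ a₁ v₁ b₁ u₂ a₂ v₂ b₂, 0 ≤ H u₁ a₁ v₁ b₁ u₂ a₂ v₂ b₂ := by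
    intros
    refine mul_nonneg (mul_nonneg (hP₁.1 _) (hP₂.1 _)) (Finset.sum_nonneg fun y _ =>
      mul_nonneg ((hW _ _ _ _).1 _) ?_)
    split_ifs <;> norm_num
  have h1 : ∀ (f₁ : U₁ → A₁) (f₂ : U₂ → A₂) (u₁ v₁ : U₁), (if v₁ ≠ u₁ then
      ∑ u₂, ∑ v₂, (if v₂ ≠ u₂ then P₁ u₁ * P₂ u₂ * ∑ y, W u₁ (f₁ u₁) u₂ (f₂ u₂) y *
        (if P₁ v₁ = 1 ∨ P₂ v₂ = 1 ∨ θ * V y < P₁ v₁ * P₂ v₂ * W v₁ (f₁ v₁) v₂ (f₂ v₂) y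
          then 1 else 0) else 0) else 0) =
      if v₁ ≠ u₁ then ∑ u₂, ∑ v₂, (if v₂ ≠ u₂ then
        H u₁ (f₁ u₁) v₁ (f₁ v₁) u₂ (f₂ u₂) v₂ (f₂ v₂) else 0) else 0 := by
    intro f₁ f₂ u₁ v₁
    by_cases h₁ : v₁ ≠ u₁
    · rw [if_pos h₁, if_pos h₁]
      refine Finset.sum_congr rfl fun u₂ _ => Finset.sum_congr rfl fun v₂ _ => ?_
      by_cases h₂ : v₂ ≠ u₂
      · rw [if_pos h₂, if_pos h₂]
        by_cases hv₁ : P₁ v₁ = 1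
        · simp [hHdef, eq_zero_of_apply_eq_one hP₁ hv₁ h₁]
        by_cases hv₂ : P₂ v₂ = 1
        · simp [hHdef, eq_zero_of_apply_eq_one hP₂ hv₂ h₂]
        simp [hHdef, hv₁, hv₂]
      · simp [h₂]
    · simp [h₁]
  simp_rw [h1]
  -- The average over the second codebook is moved inside, so that the independence of distinct
  -- codewords can be used for the first user and then, with his codewords frozen, for the second.
  have h2 : ∀ f₁ : U₁ → A₁, ∑ f₂, bookProb k₂ f₂ * ∑ u₁, ∑ v₁, (if v₁ ≠ u₁ then
      ∑ u₂, ∑ v₂, (if v₂ ≠ u₂ then H u₁ (f₁ u₁) v₁ (f₁ v₁) u₂ (f₂ u₂) v₂ (f₂ v₂) else 0) else 0) =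
      ∑ u₁, ∑ v₁, (if v₁ ≠ u₁ then ∑ f₂, bookProb k₂ f₂ *
      ∑ u₂, ∑ v₂, (if v₂ ≠ u₂ then H u₁ (f₁ u₁) v₁ (f₁ v₁) u₂ (f₂ u₂) v₂ (f₂ v₂) else 0) else 0) := by
    intro f₁
    simp_rw [Finset.mul_sum]
    rw [Finset.sum_comm]
    refine Finset.sum_congr rfl fun u₁ _ => ?_
    rw [Finset.sum_comm]
    refine Finset.sum_congr rfl fun v₁ _ => ?_
    by_cases h : v₁ ≠ u₁
    · simp [h, Finset.mul_sum]
    · simp [h]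
  simp_rw [h2]
  refine (sum_bookProb_mul_le hk₁ (H := fun u₁ a₁ v₁ b₁ => ∑ f₂, bookProb k₂ f₂ *
      ∑ u₂, ∑ v₂, (if v₂ ≠ u₂ then H u₁ a₁ v₁ b₁ u₂ (f₂ u₂) v₂ (f₂ v₂) else 0)) ?_).trans ?_
  · intro u₁ a₁ v₁ b₁
    refine Finset.sum_nonneg fun f₂ _ => mul_nonneg ((bookProb_mem hk₂).1 _) <|
      Finset.sum_nonneg fun _ _ => Finset.sum_nonneg fun _ _ => ?_
    split_ifs
    exacts [hH _ _ _ _ _ _ _ _, le_rfl]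
  have h3 : ∀ u₁ a₁ v₁ b₁, ∑ f₂, bookProb k₂ f₂ *
      ∑ u₂, ∑ v₂, (if v₂ ≠ u₂ then H u₁ a₁ v₁ b₁ u₂ (f₂ u₂) v₂ (f₂ v₂) else 0) ≤
      ∑ u₂, ∑ a₂, k₂ u₂ a₂ * ∑ v₂, ∑ b₂, k₂ v₂ b₂ * H u₁ a₁ v₁ b₁ u₂ a₂ v₂ b₂ := fun u₁ a₁ v₁ b₁ =>
    sum_bookProb_mul_le hk₂ (H := H u₁ a₁ v₁ b₁) (hH u₁ a₁ v₁ b₁)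
  calc _ ≤ ∑ u₁, ∑ a₁, k₁ u₁ a₁ * ∑ v₁, ∑ b₁, k₁ v₁ b₁ *
        ∑ u₂, ∑ a₂, k₂ u₂ a₂ * ∑ v₂, ∑ b₂, k₂ v₂ b₂ * H u₁ a₁ v₁ b₁ u₂ a₂ v₂ b₂ := by
        refine Finset.sum_le_sum fun u₁ _ => Finset.sum_le_sum fun a₁ _ =>
          mul_le_mul_of_nonneg_left (Finset.sum_le_sum fun v₁ _ => Finset.sum_le_sum fun b₁ _ =>
            mul_le_mul_of_nonneg_left (h3 _ _ _ _) ((hk₁ _).1 _)) ((hk₁ _).1 _)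
    _ = ∑ y, V y * ∑ z : (U₁ × A₁) × (U₂ × A₂), k₁ z.1.1 z.1.2 * k₂ z.2.1 z.2.2 *
        (if θ * V y < P₁ z.1.1 * P₂ z.2.1 * W z.1.1 z.1.2 z.2.1 z.2.2 y then 1 else 0) := by
        have h4 : ∀ X : B → ℝ, ∑ y, V y * X y = ∑ u₁, ∑ a₁, ∑ u₂, ∑ a₂, ∑ y,
            P₁ u₁ * k₁ u₁ a₁ * (P₂ u₂ * k₂ u₂ a₂) * W u₁ a₁ u₂ a₂ y * X y := by
          intro X
          simp_rw [hV, Finset.sum_mul]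
          rw [Finset.sum_comm]
          refine Finset.sum_congr rfl fun u _ => ?_
          rw [Finset.sum_comm]
          refine Finset.sum_congr rfl fun u _ => ?_
          rw [Finset.sum_comm]
          exact Finset.sum_congr rfl fun u _ => Finset.sum_comm
        rw [h4]
        refine Finset.sum_congr rfl fun u₁ _ => Finset.sum_congr rfl fun a₁ _ => ?_
        simp_rw [Fintype.sum_prod_type, hHdef, Finset.mul_sum]
        have h5 : ∀ F : U₁ → A₁ → U₂ → A₂ → U₂ → A₂ → B → ℝ,
            ∑ v₁, ∑ b₁, ∑ u₂, ∑ a₂, ∑ v₂, ∑ b₂, ∑ y, F v₁ b₁ u₂ a₂ v₂ b₂ y =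
            ∑ u₂, ∑ a₂, ∑ y, ∑ v₁, ∑ b₁, ∑ v₂, ∑ b₂, F v₁ b₁ u₂ a₂ v₂ b₂ y := by
          intro F
          have e1 : ∑ v₁, ∑ b₁, ∑ u₂, ∑ a₂, ∑ v₂, ∑ b₂, ∑ y, F v₁ b₁ u₂ a₂ v₂ b₂ y =
            ∑ z : U₁ × A₁, ∑ x : U₂ × A₂, ∑ w : U₂ × A₂, ∑ y, F z.1 z.2 x.1 x.2 w.1 w.2 y := by
            simp_rw [Fintype.sum_prod_type]
          have e2 : ∑ u₂, ∑ a₂, ∑ y, ∑ v₁, ∑ b₁, ∑ v₂, ∑ b₂, F v₁ b₁ u₂ a₂ v₂ b₂ y =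
            ∑ x : U₂ × A₂, ∑ y, ∑ z : U₁ × A₁, ∑ w : U₂ × A₂, F z.1 z.2 x.1 x.2 w.1 w.2 y := by
            simp_rw [Fintype.sum_prod_type]
          rw [e1, e2, Finset.sum_comm]
          refine Finset.sum_congr rfl fun x _ => ?_
          rw [Finset.sum_comm' (t' := Finset.univ) (s' := fun _ => Finset.univ) (by simp)]
          rw [Finset.sum_comm]
          refine Eq.trans ?_ Finset.sum_comm
          exact Finset.sum_congr rfl fun x _ => Finset.sum_comm
        rw [h5]
        refine Finset.sum_congr rfl fun u₂ _ => Finset.sum_congr rfl fun a₂ _ =>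
          Finset.sum_congr rfl fun y _ => Finset.sum_congr rfl fun v₁ _ =>
          Finset.sum_congr rfl fun b₁ _ => Finset.sum_congr rfl fun v₂ _ =>
          Finset.sum_congr rfl fun b₂ _ => ?_
        ring
    _ ≤ 1 / θ := by
        refine sum_threshold_le (Z := (U₁ × A₁) × (U₂ × A₂))
          (b := fun z => k₁ z.1.1 z.1.2 * k₂ z.2.1 z.2.2) (c := fun z => P₁ z.1.1 * P₂ z.2.1)
          (W := fun z => W z.1.1 z.1.2 z.2.1 z.2.2) hθ
          (fun z => mul_nonneg ((hk₁ _).1 _) ((hk₂ _).1 _))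
          (fun z => mul_nonneg (hP₁.1 _) (hP₂.1 _)) ?_ (fun z => hW _ _ _ _)
        have e : ∀ z : (U₁ × A₁) × (U₂ × A₂), k₁ z.1.1 z.1.2 * k₂ z.2.1 z.2.2 *
            (P₁ z.1.1 * P₂ z.2.1) = (k₁ z.1.1 z.1.2 * P₁ z.1.1) * (k₂ z.2.1 z.2.2 * P₂ z.2.1) := by
          intro z; ring
        simp_rw [e, Fintype.sum_prod_type, ← Finset.mul_sum, ← Finset.sum_mul, (hk₂ _).2, one_mul,
          hP₂.2, mul_one, (hk₁ _).2, one_mul, hP₁.2]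

end TwoUsers

/-! ### One-shot coding with a threshold decoder. -/

section OneShot

variable {U₁ U₂ A₁ A₂ B : Type*} [Fintype U₁] [Fintype U₂] [Fintype A₁] [Fintype A₂] [Fintype B]
  {P₁ : U₁ → ℝ} {P₂ : U₂ → ℝ} {k₁ : U₁ → A₁ → ℝ} {k₂ : U₂ → A₂ → ℝ}
  {W : U₁ → A₁ → U₂ → A₂ → B → ℝ}

/-- The likelihood ratio tests of the threshold decoder. A test is void when the message it
concerns is deterministic. -/
def PassesTests (P₁ : U₁ → ℝ) (P₂ : U₂ → ℝ) (W : U₁ → A₁ → U₂ → A₂ → B → ℝ)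
    (V₁ : U₂ → A₂ → B → ℝ) (V₂ : U₁ → A₁ → B → ℝ) (V : B → ℝ) (θ : ℝ)
    (u₁ : U₁) (a₁ : A₁) (u₂ : U₂) (a₂ : A₂) (y : B) : Prop :=
  (P₁ u₁ = 1 ∨ θ * V₁ u₂ a₂ y < P₁ u₁ * W u₁ a₁ u₂ a₂ y) ∧
  (P₂ u₂ = 1 ∨ θ * V₂ u₁ a₁ y < P₂ u₂ * W u₁ a₁ u₂ a₂ y) ∧
  (P₁ u₁ = 1 ∨ P₂ u₂ = 1 ∨ θ * V y < P₁ u₁ * P₂ u₂ * W u₁ a₁ u₂ a₂ y)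

open Classical in
/-- One-shot random coding for two users with independent sources: some pair of codebooks
with a threshold decoder has error probability, plus expected cost, bounded by the probability that
the tests fail on the true messages, plus the average cost, plus `3 / θ`. -/
theorem exists_codebooks (hP₁ : P₁ ∈ stdSimplex ℝ U₁) (hP₂ : P₂ ∈ stdSimplex ℝ U₂)
    (hk₁ : ∀ u, k₁ u ∈ stdSimplex ℝ A₁) (hk₂ : ∀ u, k₂ u ∈ stdSimplex ℝ A₂)
    (hW : ∀ u₁ a₁ u₂ a₂, W u₁ a₁ u₂ a₂ ∈ stdSimplex ℝ B)
    {V₁ : U₂ → A₂ → B → ℝ} (hV₁ : ∀ u₂ a₂ y, V₁ u₂ a₂ y = ∑ u₁, ∑ a₁,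
      P₁ u₁ * k₁ u₁ a₁ * W u₁ a₁ u₂ a₂ y)
    {V₂ : U₁ → A₁ → B → ℝ} (hV₂ : ∀ u₁ a₁ y, V₂ u₁ a₁ y = ∑ u₂, ∑ a₂,
      P₂ u₂ * k₂ u₂ a₂ * W u₁ a₁ u₂ a₂ y)
    {V : B → ℝ} (hV : ∀ y, V y = ∑ u₁, ∑ a₁, ∑ u₂, ∑ a₂,
      P₁ u₁ * k₁ u₁ a₁ * (P₂ u₂ * k₂ u₂ a₂) * W u₁ a₁ u₂ a₂ y)
    {θ : ℝ} (hθ : 0 < θ) (G : U₁ → A₁ → U₂ → A₂ → ℝ) :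
    ∃ (f₁ : U₁ → A₁) (f₂ : U₂ → A₂) (dec : B → U₁ × U₂),
      ∑ u₁, ∑ u₂, P₁ u₁ * P₂ u₂ * ∑ y, W u₁ (f₁ u₁) u₂ (f₂ u₂) y *
        ((if dec y ≠ (u₁, u₂) then 1 else 0) + G u₁ (f₁ u₁) u₂ (f₂ u₂)) ≤
      (∑ u₁, ∑ a₁, k₁ u₁ a₁ * ∑ u₂, ∑ a₂, k₂ u₂ a₂ * (P₁ u₁ * P₂ u₂ * ∑ y, W u₁ a₁ u₂ a₂ y *
        ((if ¬ PassesTests P₁ P₂ W V₁ V₂ V θ u₁ a₁ u₂ a₂ y then 1 else 0) + G u₁ a₁ u₂ a₂))) +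
      3 / θ := by
  obtain ⟨e₁⟩ : Nonempty U₁ := by
    by_contra h; rw [not_nonempty_iff] at h; simpa using hP₁.2
  obtain ⟨e₂⟩ : Nonempty U₂ := by
    by_contra h; rw [not_nonempty_iff] at h; simpa using hP₂.2
  set T := PassesTests P₁ P₂ W V₁ V₂ V θ with hT
  -- Any passing pair may be chosen. The default `(e₁, e₂)` matters only when no pair passes; then
  -- the true pair fails too, and this is counted separately.
  set dec : (U₁ → A₁) → (U₂ → A₂) → B → U₁ × U₂ := fun f₁ f₂ y =>
    if h : ∃ u : U₁ × U₂, T u.1 (f₁ u.1) u.2 (f₂ u.2) y then h.choose else (e₁, e₂) with hdec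
  set I₁ : (U₁ → A₁) → U₁ → U₂ → A₂ → B → ℝ := fun f₁ v₁ u₂ a₂ y =>
    if P₁ v₁ = 1 ∨ θ * V₁ u₂ a₂ y < P₁ v₁ * W v₁ (f₁ v₁) u₂ a₂ y then 1 else 0 with hI₁
  set I₂ : (U₂ → A₂) → U₁ → A₁ → U₂ → B → ℝ := fun f₂ u₁ a₁ v₂ y =>
    if P₂ v₂ = 1 ∨ θ * V₂ u₁ a₁ y < P₂ v₂ * W u₁ a₁ v₂ (f₂ v₂) y then 1 else 0 with hI₂
  set I : (U₁ → A₁) → (U₂ → A₂) → U₁ → U₂ → B → ℝ := fun f₁ f₂ v₁ v₂ y =>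
    if P₁ v₁ = 1 ∨ P₂ v₂ = 1 ∨ θ * V y < P₁ v₁ * P₂ v₂ * W v₁ (f₁ v₁) v₂ (f₂ v₂) y
      then 1 else 0 with hI
  have I₁_nonneg : ∀ f₁ v₁ u₂ a₂ y, 0 ≤ I₁ f₁ v₁ u₂ a₂ y := by
    intros; simp only [hI₁]; split_ifs <;> norm_num
  have I₂_nonneg : ∀ f₂ u₁ a₁ v₂ y, 0 ≤ I₂ f₂ u₁ a₁ v₂ y := by
    intros; simp only [hI₂]; split_ifs <;> norm_num
  have I_nonneg : ∀ f₁ f₂ v₁ v₂ y, 0 ≤ I f₁ f₂ v₁ v₂ y := by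
    intros; simp only [hI]; split_ifs <;> norm_num
  have ite_nonneg' : ∀ (p : Prop) [Decidable p] (x : ℝ), 0 ≤ x → 0 ≤ if p then x else 0 := by
    intro p _ x hx; split_ifs; exacts [hx, le_rfl]
  -- the union bound for fixed codebooks
  have key : ∀ f₁ f₂ u₁ u₂ y, (if dec f₁ f₂ y ≠ (u₁, u₂) then (1 : ℝ) else 0) ≤
      (if ¬ T u₁ (f₁ u₁) u₂ (f₂ u₂) y then 1 else 0) +
      (∑ v₁, if v₁ ≠ u₁ then I₁ f₁ v₁ u₂ (f₂ u₂) y else 0) +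
      (∑ v₂, if v₂ ≠ u₂ then I₂ f₂ u₁ (f₁ u₁) v₂ y else 0) +
      (∑ v₁, if v₁ ≠ u₁ then ∑ v₂, if v₂ ≠ u₂ then I f₁ f₂ v₁ v₂ y else 0 else 0) := by
    intro f₁ f₂ u₁ u₂ y
    have n1 : 0 ≤ ∑ v₁, if v₁ ≠ u₁ then I₁ f₁ v₁ u₂ (f₂ u₂) y else 0 :=
      Finset.sum_nonneg fun _ _ => ite_nonneg' _ _ (I₁_nonneg _ _ _ _ _)
    have n2 : 0 ≤ ∑ v₂, if v₂ ≠ u₂ then I₂ f₂ u₁ (f₁ u₁) v₂ y else 0 :=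
      Finset.sum_nonneg fun _ _ => ite_nonneg' _ _ (I₂_nonneg _ _ _ _ _)
    have n3' : ∀ v₁, 0 ≤ ∑ v₂, if v₂ ≠ u₂ then I f₁ f₂ v₁ v₂ y else 0 := fun v₁ =>
      Finset.sum_nonneg fun _ _ => ite_nonneg' _ _ (I_nonneg _ _ _ _ _)
    have n3 : 0 ≤ ∑ v₁, if v₁ ≠ u₁ then ∑ v₂, if v₂ ≠ u₂ then I f₁ f₂ v₁ v₂ y else 0 else 0 :=
      Finset.sum_nonneg fun _ _ => ite_nonneg' _ _ (n3' _)
    by_cases ht : T u₁ (f₁ u₁) u₂ (f₂ u₂) y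
    · have hex : ∃ u : U₁ × U₂, T u.1 (f₁ u.1) u.2 (f₂ u.2) y := ⟨(u₁, u₂), ht⟩
      have hd : dec f₁ f₂ y = hex.choose := by simp only [hdec]; rw [dif_pos hex]
      have hs := hex.choose_spec
      rw [← hd] at hs
      rcases hv : dec f₁ f₂ y with ⟨v₁, v₂⟩
      rw [hv] at hs
      obtain ⟨t1, t2, t3⟩ := hs
      dsimp only at t1 t2 t3
      -- The wrong components of the decoded pair determine which of the three tests has admitted a
      -- false candidate.
      by_cases hne : (v₁, v₂) ≠ (u₁, u₂)
      · rw [if_pos hne, if_neg (not_not.2 ht), zero_add]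
        by_cases h1 : v₁ = u₁
        · subst h1
          have h2 : v₂ ≠ u₂ := fun h => hne (by rw [h])
          have : (1 : ℝ) ≤ ∑ v₂, if v₂ ≠ u₂ then I₂ f₂ v₁ (f₁ v₁) v₂ y else 0 := by
            refine le_trans ?_ (Finset.single_le_sum (f := fun v₂ =>
              if v₂ ≠ u₂ then I₂ f₂ v₁ (f₁ v₁) v₂ y else 0)
              (fun _ _ => ite_nonneg' _ _ (I₂_nonneg _ _ _ _ _)) (Finset.mem_univ v₂))
            simp only [hI₂]
            rw [if_pos h2, if_pos t2]
          linarith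
        · by_cases h2 : v₂ = u₂
          · subst h2
            have : (1 : ℝ) ≤ ∑ v₁, if v₁ ≠ u₁ then I₁ f₁ v₁ v₂ (f₂ v₂) y else 0 := by
              refine le_trans ?_ (Finset.single_le_sum (f := fun v₁ =>
                if v₁ ≠ u₁ then I₁ f₁ v₁ v₂ (f₂ v₂) y else 0)
                (fun _ _ => ite_nonneg' _ _ (I₁_nonneg _ _ _ _ _)) (Finset.mem_univ v₁))
              simp only [hI₁]
              rw [if_pos h1, if_pos t1]
            linarith
          · have : (1 : ℝ) ≤ ∑ v₁, if v₁ ≠ u₁ then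
                ∑ v₂, if v₂ ≠ u₂ then I f₁ f₂ v₁ v₂ y else 0 else 0 := by
              refine le_trans ?_ (Finset.single_le_sum (f := fun v₁ => if v₁ ≠ u₁ then
                ∑ v₂, if v₂ ≠ u₂ then I f₁ f₂ v₁ v₂ y else 0 else 0)
                (fun _ _ => ite_nonneg' _ _ (n3' _)) (Finset.mem_univ v₁))
              rw [if_pos h1]
              refine le_trans ?_ (Finset.single_le_sum (f := fun v₂ =>
                if v₂ ≠ u₂ then I f₁ f₂ v₁ v₂ y else 0)
                (fun _ _ => ite_nonneg' _ _ (I_nonneg _ _ _ _ _)) (Finset.mem_univ v₂))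
              simp only [hI]
              rw [if_pos h2, if_pos t3]
            linarith
      · rw [if_neg hne, if_neg (not_not.2 ht)]
        linarith
    · rw [if_pos ht]
      have : (if dec f₁ f₂ y ≠ (u₁, u₂) then (1 : ℝ) else 0) ≤ 1 := by split_ifs <;> norm_num
      linarith
  -- The contributions of the union bound: `Ka` for failure of the true pair together with the cost,
  -- `Kb` and `Kc` for one wrong message, `Kd` for two.
  set Ka := fun (f₁ : U₁ → A₁) (f₂ : U₂ → A₂) => ∑ u₁, ∑ u₂, P₁ u₁ * P₂ u₂ *
    ∑ y, W u₁ (f₁ u₁) u₂ (f₂ u₂) y *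
      ((if ¬ T u₁ (f₁ u₁) u₂ (f₂ u₂) y then 1 else 0) + G u₁ (f₁ u₁) u₂ (f₂ u₂)) with hKa
  set Kb := fun (f₁ : U₁ → A₁) (u₂ : U₂) (a₂ : A₂) => ∑ u₁, ∑ v₁, (if v₁ ≠ u₁ then
    P₁ u₁ * ∑ y, W u₁ (f₁ u₁) u₂ a₂ y * I₁ f₁ v₁ u₂ a₂ y else 0) with hKb
  set Kc := fun (f₂ : U₂ → A₂) (u₁ : U₁) (a₁ : A₁) => ∑ u₂, ∑ v₂, (if v₂ ≠ u₂ then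
    P₂ u₂ * ∑ y, W u₁ a₁ u₂ (f₂ u₂) y * I₂ f₂ u₁ a₁ v₂ y else 0) with hKc
  set Kd := fun (f₁ : U₁ → A₁) (f₂ : U₂ → A₂) => ∑ u₁, ∑ v₁, (if v₁ ≠ u₁ then
    ∑ u₂, ∑ v₂, (if v₂ ≠ u₂ then P₁ u₁ * P₂ u₂ * ∑ y, W u₁ (f₁ u₁) u₂ (f₂ u₂) y *
      I f₁ f₂ v₁ v₂ y else 0) else 0) with hKd
  set J := fun (f₁ : U₁ → A₁) (f₂ : U₂ → A₂) => ∑ u₁, ∑ u₂, P₁ u₁ * P₂ u₂ *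
    ∑ y, W u₁ (f₁ u₁) u₂ (f₂ u₂) y *
      ((if dec f₁ f₂ y ≠ (u₁, u₂) then 1 else 0) + G u₁ (f₁ u₁) u₂ (f₂ u₂)) with hJ
  have hJle : ∀ f₁ f₂, J f₁ f₂ ≤ Ka f₁ f₂ + ∑ u₂, P₂ u₂ * Kb f₁ u₂ (f₂ u₂) +
      ∑ u₁, P₁ u₁ * Kc f₂ u₁ (f₁ u₁) + Kd f₁ f₂ := by
    intro f₁ f₂
    have pull : ∀ (c : Prop) [Decidable c] (r : ℝ) (w g : B → ℝ),
        (if c then r * ∑ y, w y * g y else 0) = r * ∑ y, w y * (if c then g y else 0) := by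
      intro c _ r w g; split_ifs <;> simp
    have eb : ∑ u₂, P₂ u₂ * Kb f₁ u₂ (f₂ u₂) = ∑ u₁, ∑ u₂, P₁ u₁ * P₂ u₂ *
        ∑ y, W u₁ (f₁ u₁) u₂ (f₂ u₂) y *
          ∑ v₁, if v₁ ≠ u₁ then I₁ f₁ v₁ u₂ (f₂ u₂) y else 0 := by
      simp_rw [hKb, pull, Finset.mul_sum]
      rw [Finset.sum_comm]
      refine Finset.sum_congr rfl fun u₁ _ => Finset.sum_congr rfl fun u₂ _ => ?_
      rw [Finset.sum_comm]
      refine Finset.sum_congr rfl fun y _ => Finset.sum_congr rfl fun v₁ _ => ?_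
      ring
    have ec : ∑ u₁, P₁ u₁ * Kc f₂ u₁ (f₁ u₁) = ∑ u₁, ∑ u₂, P₁ u₁ * P₂ u₂ *
        ∑ y, W u₁ (f₁ u₁) u₂ (f₂ u₂) y *
          ∑ v₂, if v₂ ≠ u₂ then I₂ f₂ u₁ (f₁ u₁) v₂ y else 0 := by
      simp_rw [hKc, pull, Finset.mul_sum]
      refine Finset.sum_congr rfl fun u₁ _ => Finset.sum_congr rfl fun u₂ _ => ?_
      rw [Finset.sum_comm]
      refine Finset.sum_congr rfl fun y _ => Finset.sum_congr rfl fun v₁ _ => ?_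
      ring
    have ed : Kd f₁ f₂ = ∑ u₁, ∑ u₂, P₁ u₁ * P₂ u₂ * ∑ y, W u₁ (f₁ u₁) u₂ (f₂ u₂) y *
        ∑ v₁, if v₁ ≠ u₁ then ∑ v₂, if v₂ ≠ u₂ then I f₁ f₂ v₁ v₂ y else 0 else 0 := by
      have pull' : ∀ (c : Prop) [Decidable c] (g : U₂ → U₂ → ℝ),
          (if c then ∑ u, ∑ v, g u v else 0) = ∑ u, ∑ v, if c then g u v else 0 := by
        intro c _ g; split_ifs <;> simp
      have pull'' : ∀ (c : Prop) [Decidable c] (g : U₂ → ℝ),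
          (if c then ∑ v, g v else 0) = ∑ v, if c then g v else 0 := by
        intro c _ g; split_ifs <;> simp
      simp_rw [hKd, pull, pull', pull, pull'', Finset.mul_sum]
      refine Finset.sum_congr rfl fun u₁ _ => ?_
      rw [Finset.sum_comm]
      refine Finset.sum_congr rfl fun u₂ _ => ?_
      refine Eq.trans ?_ Finset.sum_comm
      refine Finset.sum_congr rfl fun v₁ _ => ?_
      rw [Finset.sum_comm]
    rw [eb, ec, ed, hJ, hKa]
    simp_rw [← Finset.sum_add_distrib, ← mul_add, ← Finset.sum_add_distrib, ← mul_add]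
    refine Finset.sum_le_sum fun u₁ _ => Finset.sum_le_sum fun u₂ _ => mul_le_mul_of_nonneg_left
      (Finset.sum_le_sum fun y _ => mul_le_mul_of_nonneg_left ?_ ((hW _ _ _ _).1 _))
      (mul_nonneg (hP₁.1 _) (hP₂.1 _))
    linarith [key f₁ f₂ u₁ u₂ y]
  have avg_a : ∑ f₁, bookProb k₁ f₁ * ∑ f₂, bookProb k₂ f₂ * Ka f₁ f₂ =
      (∑ u₁, ∑ a₁, k₁ u₁ a₁ * ∑ u₂, ∑ a₂, k₂ u₂ a₂ * (P₁ u₁ * P₂ u₂ * ∑ y, W u₁ a₁ u₂ a₂ y *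
        ((if ¬ T u₁ a₁ u₂ a₂ y then 1 else 0) + G u₁ a₁ u₂ a₂))) :=
    sum_bookProb_mul_bookProb hk₁ hk₂ fun u₁ a₁ u₂ a₂ => P₁ u₁ * P₂ u₂ * ∑ y, W u₁ a₁ u₂ a₂ y *
        ((if ¬ T u₁ a₁ u₂ a₂ y then 1 else 0) + G u₁ a₁ u₂ a₂)
  have hb₁ := bookProb_mem hk₁
  have hb₂ := bookProb_mem hk₂
  have avg_b : ∑ f₁, bookProb k₁ f₁ * ∑ f₂, bookProb k₂ f₂ * ∑ u₂, P₂ u₂ * Kb f₁ u₂ (f₂ u₂) ≤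
      1 / θ := by
    -- With the message and codeword of the second user fixed, this is the one-user problem for the
    -- channel seen by the first.
    have hb : ∀ u₂ a₂, ∑ f₁, bookProb k₁ f₁ * Kb f₁ u₂ a₂ ≤ 1 / θ := fun u₂ a₂ =>
      sum_bookProb_mul_false_le hP₁ hk₁ (W := fun u₁ a₁ => W u₁ a₁ u₂ a₂) (fun u₁ a₁ => hW _ _ _ _)
        (hV₁ u₂ a₂) hθ
    calc _ = ∑ f₂, bookProb k₂ f₂ * ∑ u₂, P₂ u₂ * ∑ f₁, bookProb k₁ f₁ * Kb f₁ u₂ (f₂ u₂) := by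
          simp_rw [Finset.mul_sum]
          rw [Finset.sum_comm]
          refine Finset.sum_congr rfl fun f₂ _ => ?_
          rw [Finset.sum_comm]
          refine Finset.sum_congr rfl fun u₂ _ => Finset.sum_congr rfl fun f₁ _ => ?_
          ring
      _ ≤ ∑ f₂, bookProb k₂ f₂ * ∑ u₂, P₂ u₂ * (1 / θ) :=
          Finset.sum_le_sum fun f₂ _ => mul_le_mul_of_nonneg_left (Finset.sum_le_sum fun u₂ _ =>
            mul_le_mul_of_nonneg_left (hb _ _) (hP₂.1 _)) (hb₂.1 _)
      _ = 1 / θ := by rw [← Finset.sum_mul, ← Finset.sum_mul, hb₂.2, hP₂.2]; ring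
  have avg_c : ∑ f₁, bookProb k₁ f₁ * ∑ f₂, bookProb k₂ f₂ * ∑ u₁, P₁ u₁ * Kc f₂ u₁ (f₁ u₁) ≤
      1 / θ := by
    have hb : ∀ u₁ a₁, ∑ f₂, bookProb k₂ f₂ * Kc f₂ u₁ a₁ ≤ 1 / θ := fun u₁ a₁ =>
      sum_bookProb_mul_false_le hP₂ hk₂ (W := fun u₂ a₂ => W u₁ a₁ u₂ a₂) (fun u₂ a₂ => hW _ _ _ _)
        (hV₂ u₁ a₁) hθ
    calc _ = ∑ f₁, bookProb k₁ f₁ * ∑ u₁, P₁ u₁ * ∑ f₂, bookProb k₂ f₂ * Kc f₂ u₁ (f₁ u₁) := by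
          simp_rw [Finset.mul_sum]
          refine Finset.sum_congr rfl fun f₁ _ => ?_
          rw [Finset.sum_comm]
          refine Finset.sum_congr rfl fun u₂ _ => Finset.sum_congr rfl fun f₂ _ => ?_
          ring
      _ ≤ ∑ f₁, bookProb k₁ f₁ * ∑ u₁, P₁ u₁ * (1 / θ) :=
          Finset.sum_le_sum fun f₂ _ => mul_le_mul_of_nonneg_left (Finset.sum_le_sum fun u₂ _ =>
            mul_le_mul_of_nonneg_left (hb _ _) (hP₁.1 _)) (hb₁.1 _)
      _ = 1 / θ := by rw [← Finset.sum_mul, ← Finset.sum_mul, hb₁.2, hP₁.2]; ring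
  have avg_d : ∑ f₁, bookProb k₁ f₁ * ∑ f₂, bookProb k₂ f₂ * Kd f₁ f₂ ≤ 1 / θ :=
    sum_bookProb_mul_false_le₂ hP₁ hP₂ hk₁ hk₂ hW hV hθ
  have avg : ∑ f : (U₁ → A₁) × (U₂ → A₂), (bookProb k₁ f.1 * bookProb k₂ f.2) * J f.1 f.2 ≤
      (∑ u₁, ∑ a₁, k₁ u₁ a₁ * ∑ u₂, ∑ a₂, k₂ u₂ a₂ * (P₁ u₁ * P₂ u₂ * ∑ y, W u₁ a₁ u₂ a₂ y *
        ((if ¬ T u₁ a₁ u₂ a₂ y then 1 else 0) + G u₁ a₁ u₂ a₂))) + 3 / θ := by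
    calc _ ≤ ∑ f : (U₁ → A₁) × (U₂ → A₂), (bookProb k₁ f.1 * bookProb k₂ f.2) *
          (Ka f.1 f.2 + ∑ u₂, P₂ u₂ * Kb f.1 u₂ (f.2 u₂) +
            ∑ u₁, P₁ u₁ * Kc f.2 u₁ (f.1 u₁) + Kd f.1 f.2) :=
          Finset.sum_le_sum fun f _ => mul_le_mul_of_nonneg_left (hJle _ _)
            (mul_nonneg (hb₁.1 _) (hb₂.1 _))
      _ = ∑ f₁, bookProb k₁ f₁ * ∑ f₂, bookProb k₂ f₂ * Ka f₁ f₂ +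
          ∑ f₁, bookProb k₁ f₁ * ∑ f₂, bookProb k₂ f₂ * ∑ u₂, P₂ u₂ * Kb f₁ u₂ (f₂ u₂) +
          ∑ f₁, bookProb k₁ f₁ * ∑ f₂, bookProb k₂ f₂ * ∑ u₁, P₁ u₁ * Kc f₂ u₁ (f₁ u₁) +
          ∑ f₁, bookProb k₁ f₁ * ∑ f₂, bookProb k₂ f₂ * Kd f₁ f₂ := by
          simp_rw [Fintype.sum_prod_type, mul_assoc, ← Finset.mul_sum, mul_add,
            Finset.sum_add_distrib, mul_add, Finset.sum_add_distrib]
      _ ≤ _ := by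
          rw [avg_a]
          have : (3:ℝ) / θ = 1 / θ + 1 / θ + 1 / θ := by ring
          linarith
  obtain ⟨f, hf⟩ := exists_le_of_sum_mul_le (p := fun f : (U₁ → A₁) × (U₂ → A₂) =>
    bookProb k₁ f.1 * bookProb k₂ f.2) (fun f => mul_nonneg (hb₁.1 _) (hb₂.1 _))
    (by simp_rw [Fintype.sum_prod_type, ← Finset.mul_sum, hb₂.2, mul_one, hb₁.2]) avg
  exact ⟨f.1, f.2, dec f.1 f.2, hf⟩

end OneShot

/-! ### Entropy as an expectation. -/

section EntropyFormula

variable {Ω A : Type*} [Fintype Ω] [Fintype A]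

/-- Grouping by fibres writes entropy as the mean of self-information over the common space `Ω`.
Identities between entropies of different variables can then be checked pointwise. -/
theorem entropy_eq_sum (p : Ω → ℝ) (f : Ω → A) :
    entropy p f = -(∑ ω, p ω * Real.log (prob p f (f ω))) / Real.log 2 := by
  classical
  rw [entropy, ← Finset.sum_div, ← Finset.sum_fiberwise Finset.univ f]
  congr 1
  rw [← Finset.sum_neg_distrib]
  refine Finset.sum_congr rfl fun a _ => ?_
  have : ∀ ω ∈ Finset.univ.filter (fun ω => f ω = a), p ω * Real.log (prob p f (f ω)) =
      p ω * Real.log (prob p f a) := by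
    intro ω hω
    rw [(Finset.mem_filter.1 hω).2]
  rw [Finset.sum_congr rfl this, ← Finset.sum_mul, Real.negMulLog, neg_mul]
  congr 3

/-- A fibre of a random variable may be parametrized. -/
theorem prob_eq_sum {T : Type*} [Fintype T] (p : Ω → ℝ) {f : Ω → A} {a : A} (r : T → Ω) (l : Ω → T)
    (hlr : ∀ t, l (r t) = t) (hr : ∀ t, f (r t) = a) (hrl : ∀ ω, f ω = a → r (l ω) = ω) :
    prob p f a = ∑ t, p (r t) := by
  classical
  rw [prob]
  refine Finset.sum_nbij' l r ?_ ?_ ?_ ?_ ?_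
  · simp
  · intro t _; simp [hr]
  · intro ω hω; exact hrl ω (by simpa using hω)
  · intro t _; exact hlr t
  · intro ω hω; rw [hrl ω (by simpa using hω)]

end EntropyFormula

/-! ### Information densities and their supports. -/

section Densities

variable {S₁ S₂ X₁ X₂ Y : Type*} [Fintype S₁] [Fintype S₂] [Fintype X₁] [Fintype X₂] [Fintype Y]

namespace Model

variable (m : Model S₁ S₂ X₁ X₂ Y)

/-- The law of the first host. -/
def host₁ (s : S₁) : ℝ := ∑ t, m.host (s, t)

/-- The law of the second host. -/
def host₂ (s : S₂) : ℝ := ∑ t, m.host (t, s)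

theorem host₁_mem : m.host₁ ∈ stdSimplex ℝ S₁ :=
  ⟨fun _ => Finset.sum_nonneg fun _ _ => m.host_mem.1 _, by
    rw [← m.host_mem.2, Fintype.sum_prod_type]; rfl⟩

theorem host₂_mem : m.host₂ ∈ stdSimplex ℝ S₂ :=
  ⟨fun _ => Finset.sum_nonneg fun _ _ => m.host_mem.1 _, by
    rw [← m.host_mem.2, Fintype.sum_prod_type_right]; rfl⟩

/-- The law of `Y` given `(X₂, S₂)`. -/
def out₁ (κ₁ : S₁ → X₁ → ℝ) (s₂ : S₂) (x₂ : X₂) (y : Y) : ℝ :=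
  ∑ s₁, ∑ x₁, m.host₁ s₁ * κ₁ s₁ x₁ * m.channel x₁ s₁ x₂ s₂ y

/-- The law of `Y` given `(X₁, S₁)`. -/
def out₂ (κ₂ : S₂ → X₂ → ℝ) (s₁ : S₁) (x₁ : X₁) (y : Y) : ℝ :=
  ∑ s₂, ∑ x₂, m.host₂ s₂ * κ₂ s₂ x₂ * m.channel x₁ s₁ x₂ s₂ y

/-- The law of `Y`. -/
def out₁₂ (κ₁ : S₁ → X₁ → ℝ) (κ₂ : S₂ → X₂ → ℝ) (y : Y) : ℝ :=
  ∑ s₁, ∑ x₁, ∑ s₂, ∑ x₂,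
    m.host₁ s₁ * κ₁ s₁ x₁ * (m.host₂ s₂ * κ₂ s₂ x₂) * m.channel x₁ s₁ x₂ s₂ y

/-- The information density of the first user, reduced by the self-information of its host. -/
def density₁ (κ₁ : S₁ → X₁ → ℝ) (s₁ : S₁) (x₁ : X₁) (s₂ : S₂) (x₂ : X₂) (y : Y) : ℝ :=
  Real.log (m.host₁ s₁) + Real.log (m.channel x₁ s₁ x₂ s₂ y) - Real.log (m.out₁ κ₁ s₂ x₂ y)

/-- The information density of the second user, reduced by the self-information of its host. -/
def density₂ (κ₂ : S₂ → X₂ → ℝ) (s₁ : S₁) (x₁ : X₁) (s₂ : S₂) (x₂ : X₂) (y : Y) : ℝ :=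
  Real.log (m.host₂ s₂) + Real.log (m.channel x₁ s₁ x₂ s₂ y) - Real.log (m.out₂ κ₂ s₁ x₁ y)

/-- The joint information density, reduced by the self-information of both hosts. -/
def density₁₂ (κ₁ : S₁ → X₁ → ℝ) (κ₂ : S₂ → X₂ → ℝ)
    (s₁ : S₁) (x₁ : X₁) (s₂ : S₂) (x₂ : X₂) (y : Y) : ℝ :=
  Real.log (m.host₁ s₁) + Real.log (m.host₂ s₂) + Real.log (m.channel x₁ s₁ x₂ s₂ y) -
    Real.log (m.out₁₂ κ₁ κ₂ y)

/-- The expectation of a function of `(S₁, X₁, S₂, X₂, Y)` for independent hosts. -/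
def letterExpect (κ₁ : S₁ → X₁ → ℝ) (κ₂ : S₂ → X₂ → ℝ)
    (g : S₁ → X₁ → S₂ → X₂ → Y → ℝ) : ℝ :=
  ∑ s₁, ∑ x₁, ∑ s₂, ∑ x₂, ∑ y,
    m.host₁ s₁ * κ₁ s₁ x₁ * (m.host₂ s₂ * κ₂ s₂ x₂) * m.channel x₁ s₁ x₂ s₂ y * g s₁ x₁ s₂ x₂ y

variable {m} {κ₁ : S₁ → X₁ → ℝ} {κ₂ : S₂ → X₂ → ℝ}

theorem out₁_nonneg (hκ₁ : ∀ s, κ₁ s ∈ stdSimplex ℝ X₁) (s₂ : S₂) (x₂ : X₂) (y : Y) :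
    0 ≤ m.out₁ κ₁ s₂ x₂ y :=
  Finset.sum_nonneg fun _ _ => Finset.sum_nonneg fun _ _ =>
    mul_nonneg (mul_nonneg (m.host₁_mem.1 _) ((hκ₁ _).1 _)) ((m.channel_mem _ _ _ _).1 _)

theorem out₁_pos (hκ₁ : ∀ s, κ₁ s ∈ stdSimplex ℝ X₁) {s₁ : S₁} {x₁ : X₁} {s₂ : S₂} {x₂ : X₂} {y : Y}
    (h : m.host₁ s₁ * κ₁ s₁ x₁ * m.channel x₁ s₁ x₂ s₂ y ≠ 0) : 0 < m.out₁ κ₁ s₂ x₂ y := by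
  have hn : ∀ s x, 0 ≤ m.host₁ s * κ₁ s x * m.channel x s x₂ s₂ y := fun _ _ =>
    mul_nonneg (mul_nonneg (m.host₁_mem.1 _) ((hκ₁ _).1 _)) ((m.channel_mem _ _ _ _).1 _)
  exact Finset.sum_pos' (fun _ _ => Finset.sum_nonneg fun _ _ => hn _ _) ⟨s₁, Finset.mem_univ _,
    Finset.sum_pos' (fun _ _ => hn _ _) ⟨x₁, Finset.mem_univ _, (hn _ _).lt_of_ne' h⟩⟩

theorem out₂_nonneg (hκ₂ : ∀ s, κ₂ s ∈ stdSimplex ℝ X₂) (s₁ : S₁) (x₁ : X₁) (y : Y) :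
    0 ≤ m.out₂ κ₂ s₁ x₁ y :=
  Finset.sum_nonneg fun _ _ => Finset.sum_nonneg fun _ _ =>
    mul_nonneg (mul_nonneg (m.host₂_mem.1 _) ((hκ₂ _).1 _)) ((m.channel_mem _ _ _ _).1 _)

theorem out₂_pos (hκ₂ : ∀ s, κ₂ s ∈ stdSimplex ℝ X₂) {s₁ : S₁} {x₁ : X₁} {s₂ : S₂} {x₂ : X₂} {y : Y}
    (h : m.host₂ s₂ * κ₂ s₂ x₂ * m.channel x₁ s₁ x₂ s₂ y ≠ 0) : 0 < m.out₂ κ₂ s₁ x₁ y := by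
  have hn : ∀ s x, 0 ≤ m.host₂ s * κ₂ s x * m.channel x₁ s₁ x s y := fun _ _ =>
    mul_nonneg (mul_nonneg (m.host₂_mem.1 _) ((hκ₂ _).1 _)) ((m.channel_mem _ _ _ _).1 _)
  exact Finset.sum_pos' (fun _ _ => Finset.sum_nonneg fun _ _ => hn _ _) ⟨s₂, Finset.mem_univ _,
    Finset.sum_pos' (fun _ _ => hn _ _) ⟨x₂, Finset.mem_univ _, (hn _ _).lt_of_ne' h⟩⟩

theorem letter_nonneg (hκ₁ : ∀ s, κ₁ s ∈ stdSimplex ℝ X₁) (hκ₂ : ∀ s, κ₂ s ∈ stdSimplex ℝ X₂)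
    (s₁ : S₁) (x₁ : X₁) (s₂ : S₂) (x₂ : X₂) (y : Y) :
    0 ≤ m.host₁ s₁ * κ₁ s₁ x₁ * (m.host₂ s₂ * κ₂ s₂ x₂) * m.channel x₁ s₁ x₂ s₂ y :=
  mul_nonneg (mul_nonneg (mul_nonneg (m.host₁_mem.1 _) ((hκ₁ _).1 _))
    (mul_nonneg (m.host₂_mem.1 _) ((hκ₂ _).1 _))) ((m.channel_mem _ _ _ _).1 _)

theorem out₁₂_nonneg (hκ₁ : ∀ s, κ₁ s ∈ stdSimplex ℝ X₁) (hκ₂ : ∀ s, κ₂ s ∈ stdSimplex ℝ X₂)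
    (y : Y) : 0 ≤ m.out₁₂ κ₁ κ₂ y :=
  Finset.sum_nonneg fun _ _ => Finset.sum_nonneg fun _ _ => Finset.sum_nonneg fun _ _ =>
    Finset.sum_nonneg fun _ _ => letter_nonneg hκ₁ hκ₂ _ _ _ _ _

theorem out₁₂_pos (hκ₁ : ∀ s, κ₁ s ∈ stdSimplex ℝ X₁) (hκ₂ : ∀ s, κ₂ s ∈ stdSimplex ℝ X₂)
    {s₁ : S₁} {x₁ : X₁} {s₂ : S₂} {x₂ : X₂} {y : Y}
    (h : m.host₁ s₁ * κ₁ s₁ x₁ * (m.host₂ s₂ * κ₂ s₂ x₂) * m.channel x₁ s₁ x₂ s₂ y ≠ 0) :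
    0 < m.out₁₂ κ₁ κ₂ y := by
  have hn := fun s₁ x₁ s₂ x₂ => letter_nonneg (m := m) hκ₁ hκ₂ s₁ x₁ s₂ x₂ y
  exact Finset.sum_pos' (fun _ _ => Finset.sum_nonneg fun _ _ => Finset.sum_nonneg fun _ _ =>
    Finset.sum_nonneg fun _ _ => hn _ _ _ _) ⟨s₁, Finset.mem_univ _,
    Finset.sum_pos' (fun _ _ => Finset.sum_nonneg fun _ _ => Finset.sum_nonneg fun _ _ =>
      hn _ _ _ _) ⟨x₁, Finset.mem_univ _, Finset.sum_pos' (fun _ _ =>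
      Finset.sum_nonneg fun _ _ => hn _ _ _ _) ⟨s₂, Finset.mem_univ _,
      Finset.sum_pos' (fun _ _ => hn _ _ _ _) ⟨x₂, Finset.mem_univ _, (hn _ _ _ _).lt_of_ne' h⟩⟩⟩⟩

end Model

/-! ### Marginals of a factored law, and the three bounds as means of densities. -/

section Formula

variable {Q : Type*} [Fintype Q] {m : Model S₁ S₂ X₁ X₂ Y} {p : Letters Q S₁ S₂ X₁ X₂ Y → ℝ}
  {pQ : Q → ℝ} {κ₁ : S₁ → Q → X₁ → ℝ} {κ₂ : S₂ → Q → X₂ → ℝ}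

/-- The joint law `p` is built from `pQ`, the hosts, the kernels `κ₁`, `κ₂` and the channel. -/
structure Factors (m : Model S₁ S₂ X₁ X₂ Y) (pQ : Q → ℝ) (κ₁ : S₁ → Q → X₁ → ℝ)
    (κ₂ : S₂ → Q → X₂ → ℝ) (p : Letters Q S₁ S₂ X₁ X₂ Y → ℝ) : Prop where
  pQ_mem : pQ ∈ stdSimplex ℝ Q
  κ₁_mem : ∀ s q, κ₁ s q ∈ stdSimplex ℝ X₁
  κ₂_mem : ∀ s q, κ₂ s q ∈ stdSimplex ℝ X₂
  eq_mul : ∀ q s₁ s₂ x₁ x₂ y, p (q, s₁, s₂, x₁, x₂, y) =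
      pQ q * (m.host₁ s₁ * m.host₂ s₂) * κ₁ s₁ q x₁ * κ₂ s₂ q x₂ * m.channel x₁ s₁ x₂ s₂ y

namespace Factors

theorem sum_mul (h : Factors m pQ κ₁ κ₂ p) (g : Letters Q S₁ S₂ X₁ X₂ Y → ℝ) :
    ∑ ω, p ω * g ω = ∑ q, pQ q * m.letterExpect (fun s => κ₁ s q) (fun s => κ₂ s q)
      fun s₁ x₁ s₂ x₂ y => g (q, s₁, s₂, x₁, x₂, y) := by
  simp_rw [Fintype.sum_prod_type, h.eq_mul, Model.letterExpect, Finset.mul_sum]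
  refine Finset.sum_congr rfl fun q _ => Finset.sum_congr rfl fun s₁ _ => ?_
  rw [Finset.sum_comm]
  refine Finset.sum_congr rfl fun x₁ _ => Finset.sum_congr rfl fun s₂ _ =>
    Finset.sum_congr rfl fun x₂ _ => Finset.sum_congr rfl fun y _ => ?_
  ring

theorem prob_s₂ (h : Factors m pQ κ₁ κ₂ p) (s₂ : S₂) : prob p (fun ω => ω.s₂) s₂ = m.host₂ s₂ := by
  rw [prob_eq_sum p (T := Q × S₁ × X₁ × X₂ × Y) (fun t => (t.1, t.2.1, s₂, t.2.2))
    (fun ω => (ω.1, ω.2.1, ω.2.2.2)) (by simp) (by simp) (by aesop)]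
  simp_rw [Fintype.sum_prod_type, h.eq_mul, ← Finset.mul_sum, (m.channel_mem _ _ _ _).2, mul_one,
    ← Finset.mul_sum, (h.κ₂_mem _ _).2, mul_one, ← Finset.mul_sum, (h.κ₁_mem _ _).2, mul_one,
    ← Finset.mul_sum, ← Finset.sum_mul, m.host₁_mem.2, h.pQ_mem.2, one_mul]

theorem prob_s₁ (h : Factors m pQ κ₁ κ₂ p) (s₁ : S₁) : prob p (fun ω => ω.s₁) s₁ = m.host₁ s₁ := by
  rw [prob_eq_sum p (T := Q × S₂ × X₁ × X₂ × Y) (fun t => (t.1, s₁, t.2))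
    (fun ω => (ω.1, ω.2.2)) (by simp) (by simp) (by aesop)]
  simp_rw [Fintype.sum_prod_type, h.eq_mul, ← Finset.mul_sum, (m.channel_mem _ _ _ _).2, mul_one,
    ← Finset.mul_sum, (h.κ₂_mem _ _).2, mul_one, ← Finset.mul_sum, (h.κ₁_mem _ _).2, mul_one,
    ← Finset.mul_sum, m.host₂_mem.2, mul_one, ← Finset.sum_mul, h.pQ_mem.2, one_mul]

theorem prob_s₁_s₂ (h : Factors m pQ κ₁ κ₂ p) (s₁ : S₁) (s₂ : S₂) :
    prob p (fun ω => (ω.s₁, ω.s₂)) (s₁, s₂) = m.host₁ s₁ * m.host₂ s₂ := by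
  rw [prob_eq_sum p (T := Q × X₁ × X₂ × Y) (fun t => (t.1, s₁, s₂, t.2))
    (fun ω => (ω.1, ω.2.2.2)) (by simp) (by simp) (by aesop)]
  simp_rw [Fintype.sum_prod_type, h.eq_mul, ← Finset.mul_sum, (m.channel_mem _ _ _ _).2, mul_one,
    ← Finset.mul_sum, (h.κ₂_mem _ _).2, mul_one, ← Finset.mul_sum, (h.κ₁_mem _ _).2, mul_one,
    ← Finset.sum_mul, h.pQ_mem.2, one_mul]

theorem prob_s₂_s₁ (h : Factors m pQ κ₁ κ₂ p) (s₁ : S₁) (s₂ : S₂) :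
    prob p (fun ω => (ω.s₂, ω.s₁)) (s₂, s₁) = m.host₁ s₁ * m.host₂ s₂ := by
  rw [prob_eq_sum p (T := Q × X₁ × X₂ × Y) (fun t => (t.1, s₁, s₂, t.2))
    (fun ω => (ω.1, ω.2.2.2)) (by simp) (by simp) (by aesop)]
  simp_rw [Fintype.sum_prod_type, h.eq_mul, ← Finset.mul_sum, (m.channel_mem _ _ _ _).2, mul_one,
    ← Finset.mul_sum, (h.κ₂_mem _ _).2, mul_one, ← Finset.mul_sum, (h.κ₁_mem _ _).2, mul_one,
    ← Finset.sum_mul, h.pQ_mem.2, one_mul]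

theorem prob_q (h : Factors m pQ κ₁ κ₂ p) (q : Q) : prob p (fun ω => ω.q) q = pQ q := by
  rw [prob_eq_sum p (T := S₁ × S₂ × X₁ × X₂ × Y) (fun t => (q, t))
    (fun ω => ω.2) (by simp) (by simp) (by aesop)]
  simp_rw [Fintype.sum_prod_type, h.eq_mul, ← Finset.mul_sum, (m.channel_mem _ _ _ _).2, mul_one,
    ← Finset.mul_sum, (h.κ₂_mem _ _).2, mul_one, ← Finset.mul_sum, (h.κ₁_mem _ _).2, mul_one,
    ← Finset.mul_sum, m.host₂_mem.2, mul_one, m.host₁_mem.2, mul_one]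

theorem prob_user₂ (h : Factors m pQ κ₁ κ₂ p) (q : Q) (s₂ : S₂) (x₂ : X₂) :
    prob p (fun ω => (ω.x₂, ω.s₂, ω.q)) (x₂, s₂, q) = pQ q * m.host₂ s₂ * κ₂ s₂ q x₂ := by
  rw [prob_eq_sum p (T := S₁ × X₁ × Y) (fun t => (q, t.1, s₂, t.2.1, x₂, t.2.2))
    (fun ω => (ω.s₁, ω.x₁, ω.y)) (by simp) (by simp) (by aesop)]
  simp_rw [Fintype.sum_prod_type, h.eq_mul, ← Finset.mul_sum, (m.channel_mem _ _ _ _).2, mul_one,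
    ← Finset.sum_mul, ← Finset.mul_sum, (h.κ₁_mem _ _).2, mul_one, ← Finset.mul_sum,
    ← Finset.sum_mul, m.host₁_mem.2, one_mul]

theorem prob_user₁ (h : Factors m pQ κ₁ κ₂ p) (q : Q) (s₁ : S₁) (x₁ : X₁) :
    prob p (fun ω => (ω.x₁, ω.s₁, ω.q)) (x₁, s₁, q) = pQ q * m.host₁ s₁ * κ₁ s₁ q x₁ := by
  rw [prob_eq_sum p (T := S₂ × X₂ × Y) (fun t => (q, s₁, t.1, x₁, t.2.1, t.2.2))
    (fun ω => (ω.s₂, ω.x₂, ω.y)) (by simp) (by simp) (by aesop)]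
  simp_rw [Fintype.sum_prod_type, h.eq_mul, ← Finset.mul_sum, (m.channel_mem _ _ _ _).2, mul_one,
    ← Finset.mul_sum, (h.κ₂_mem _ _).2, mul_one, ← Finset.sum_mul, ← Finset.mul_sum,
    m.host₂_mem.2, mul_one]

theorem prob_out₁ (h : Factors m pQ κ₁ κ₂ p) (q : Q) (s₂ : S₂) (x₂ : X₂) (y : Y) :
    prob p (fun ω => (ω.y, ω.x₂, ω.s₂, ω.q)) (y, x₂, s₂, q) =
      pQ q * m.host₂ s₂ * κ₂ s₂ q x₂ * m.out₁ (fun s => κ₁ s q) s₂ x₂ y := by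
  rw [prob_eq_sum p (T := S₁ × X₁) (fun t => (q, t.1, s₂, t.2, x₂, y))
    (fun ω => (ω.s₁, ω.x₁)) (by simp) (by simp) (by aesop), Model.out₁]
  simp_rw [Fintype.sum_prod_type, h.eq_mul, Finset.mul_sum]
  refine Finset.sum_congr rfl fun _ _ => Finset.sum_congr rfl fun _ _ => ?_
  ring

theorem prob_out₂ (h : Factors m pQ κ₁ κ₂ p) (q : Q) (s₁ : S₁) (x₁ : X₁) (y : Y) :
    prob p (fun ω => (ω.y, ω.x₁, ω.s₁, ω.q)) (y, x₁, s₁, q) =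
      pQ q * m.host₁ s₁ * κ₁ s₁ q x₁ * m.out₂ (fun s => κ₂ s q) s₁ x₁ y := by
  rw [prob_eq_sum p (T := S₂ × X₂) (fun t => (q, s₁, t.1, x₁, t.2, y))
    (fun ω => (ω.s₂, ω.x₂)) (by simp) (by simp) (by aesop), Model.out₂]
  simp_rw [Fintype.sum_prod_type, h.eq_mul, Finset.mul_sum]
  refine Finset.sum_congr rfl fun _ _ => Finset.sum_congr rfl fun _ _ => ?_
  ring

theorem prob_out₁₂ (h : Factors m pQ κ₁ κ₂ p) (q : Q) (y : Y) :
    prob p (fun ω => (ω.y, ω.q)) (y, q) =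
      pQ q * m.out₁₂ (fun s => κ₁ s q) (fun s => κ₂ s q) y := by
  rw [prob_eq_sum p (T := S₁ × X₁ × S₂ × X₂) (fun t => (q, t.1, t.2.2.1, t.2.1, t.2.2.2, y))
    (fun ω => (ω.s₁, ω.x₁, ω.s₂, ω.x₂)) (by simp) (by simp) (by aesop), Model.out₁₂]
  simp_rw [Fintype.sum_prod_type, h.eq_mul, Finset.mul_sum]
  refine Finset.sum_congr rfl fun _ _ => Finset.sum_congr rfl fun _ _ =>
    Finset.sum_congr rfl fun _ _ => Finset.sum_congr rfl fun _ _ => ?_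
  ring

/-- All random variables other than `Y`, in any order. -/
theorem prob_inputs {A : Type*} [Fintype A] (h : Factors m pQ κ₁ κ₂ p)
    {f : Letters Q S₁ S₂ X₁ X₂ Y → A}
    (hf : ∀ ω ω', f ω = f ω' ↔
      ω.q = ω'.q ∧ ω.s₁ = ω'.s₁ ∧ ω.s₂ = ω'.s₂ ∧ ω.x₁ = ω'.x₁ ∧ ω.x₂ = ω'.x₂)
    (q : Q) (s₁ : S₁) (s₂ : S₂) (x₁ : X₁) (x₂ : X₂) (y : Y) :
    prob p f (f (q, s₁, s₂, x₁, x₂, y)) =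
      pQ q * (m.host₁ s₁ * m.host₂ s₂) * κ₁ s₁ q x₁ * κ₂ s₂ q x₂ := by
  rw [prob_eq_sum p (fun y => (q, s₁, s₂, x₁, x₂, y)) (fun ω => ω.y) (by simp) (by simp [hf])
    (by simp only [hf]; rintro ⟨a, b, c, d, e, f⟩; aesop)]
  simp_rw [h.eq_mul, ← Finset.mul_sum, (m.channel_mem _ _ _ _).2, mul_one]

/-- All random variables, in any order. -/
theorem prob_all {A : Type*} [Fintype A] {f : Letters Q S₁ S₂ X₁ X₂ Y → A}
    (hf : Function.Injective f) (ω : Letters Q S₁ S₂ X₁ X₂ Y) : prob p f (f ω) = p ω := by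
  rw [prob_eq_sum p (T := Unit) (fun _ => ω) (fun _ => ()) (by simp) (by simp)
    (fun ω' h => (hf h).symm)]
  simp

/-- Every probability in the five entropies is a product of known factors. On the support of `p` the
logarithms split, and those of `pQ`, the kernels and `host₂` cancel, leaving `density₁`. By
independence `H(S₁ | S₂)` contributes only the logarithm of `host₁`. -/
theorem bound₁_eq (h : Factors m pQ κ₁ κ₂ p) :
    bound₁ p = ∑ q, pQ q * (m.letterExpect (fun s => κ₁ s q) (fun s => κ₂ s q)
      (m.density₁ fun s => κ₁ s q) / Real.log 2) := by
  simp_rw [← mul_div_assoc, ← Finset.sum_div]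
  rw [← h.sum_mul fun ω => m.density₁ (fun s => κ₁ s ω.q) ω.s₁ ω.x₁ ω.s₂ ω.x₂ ω.y]
  simp_rw [bound₁, condMutualInfo, condEntropy, entropy_eq_sum, ← sub_div,
    ← Finset.sum_neg_distrib, ← Finset.sum_sub_distrib]
  congr 1
  refine Finset.sum_congr rfl fun ω _ => ?_
  obtain ⟨q, s₁, s₂, x₁, x₂, y⟩ := ω
  rw [h.prob_inputs (f := fun ω : Letters Q S₁ S₂ X₁ X₂ Y => ((ω.x₁, ω.s₁), (ω.x₂, ω.s₂, ω.q)))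
      (by simp; tauto), h.prob_user₂, prob_all (f := fun ω : Letters Q S₁ S₂ X₁ X₂ Y =>
      ((ω.x₁, ω.s₁), (ω.y, (ω.x₂, ω.s₂, ω.q)))) (by rintro ⟨_, _, _, _, _, _⟩ ⟨_, _, _, _, _, _⟩; simp; tauto), h.prob_out₁,
      h.prob_s₁_s₂, h.prob_s₂]
  -- Off the support the weight vanishes, so logarithms of zero do no harm.
  by_cases h0 : p (q, s₁, s₂, x₁, x₂, y) = 0
  · simp [h0]
  rw [Model.density₁]
  have h1 := h.eq_mul q s₁ s₂ x₁ x₂ y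
  rw [h1] at h0
  simp only [mul_ne_zero_iff] at h0
  obtain ⟨⟨⟨⟨a, b, c⟩, d⟩, e⟩, f⟩ := h0
  have g := (Model.out₁_pos (m := m) (κ₁ := fun s => κ₁ s q) (fun s => h.κ₁_mem s q)
    (mul_ne_zero (mul_ne_zero b d) f)).ne'
  rw [h1]
  repeat rw [Real.log_mul (by simp [*]) (by simp [*])]
  ring

theorem bound₂_eq (h : Factors m pQ κ₁ κ₂ p) :
    bound₂ p = ∑ q, pQ q * (m.letterExpect (fun s => κ₁ s q) (fun s => κ₂ s q)
      (m.density₂ fun s => κ₂ s q) / Real.log 2) := by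
  simp_rw [← mul_div_assoc, ← Finset.sum_div]
  rw [← h.sum_mul fun ω => m.density₂ (fun s => κ₂ s ω.q) ω.s₁ ω.x₁ ω.s₂ ω.x₂ ω.y]
  simp_rw [bound₂, condMutualInfo, condEntropy, entropy_eq_sum, ← sub_div,
    ← Finset.sum_neg_distrib, ← Finset.sum_sub_distrib]
  congr 1
  refine Finset.sum_congr rfl fun ω _ => ?_
  obtain ⟨q, s₁, s₂, x₁, x₂, y⟩ := ω
  rw [h.prob_inputs (f := fun ω : Letters Q S₁ S₂ X₁ X₂ Y => ((ω.x₂, ω.s₂), (ω.x₁, ω.s₁, ω.q)))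
      (by simp; tauto), h.prob_user₁, prob_all (f := fun ω : Letters Q S₁ S₂ X₁ X₂ Y =>
      ((ω.x₂, ω.s₂), (ω.y, (ω.x₁, ω.s₁, ω.q)))) (by rintro ⟨_, _, _, _, _, _⟩ ⟨_, _, _, _, _, _⟩; simp; tauto), h.prob_out₂,
      h.prob_s₂_s₁, h.prob_s₁]
  by_cases h0 : p (q, s₁, s₂, x₁, x₂, y) = 0
  · simp [h0]
  rw [Model.density₂]
  have h1 := h.eq_mul q s₁ s₂ x₁ x₂ y
  rw [h1] at h0
  simp only [mul_ne_zero_iff] at h0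
  obtain ⟨⟨⟨⟨a, b, c⟩, d⟩, e⟩, f⟩ := h0
  have g := (Model.out₂_pos (m := m) (κ₂ := fun s => κ₂ s q) (fun s => h.κ₂_mem s q)
    (mul_ne_zero (mul_ne_zero c e) f)).ne'
  rw [h1]
  repeat rw [Real.log_mul (by simp [*]) (by simp [*])]
  ring

theorem bound₁₂_eq (h : Factors m pQ κ₁ κ₂ p) :
    bound₁₂ p = ∑ q, pQ q * (m.letterExpect (fun s => κ₁ s q) (fun s => κ₂ s q)
      (m.density₁₂ (fun s => κ₁ s q) fun s => κ₂ s q) / Real.log 2) := by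
  simp_rw [← mul_div_assoc, ← Finset.sum_div]
  rw [← h.sum_mul fun ω => m.density₁₂ (fun s => κ₁ s ω.q) (fun s => κ₂ s ω.q) ω.s₁ ω.x₁ ω.s₂ ω.x₂ ω.y]
  simp_rw [bound₁₂, condMutualInfo, condEntropy, entropy_eq_sum, ← sub_div,
    ← Finset.sum_neg_distrib, ← Finset.sum_sub_distrib]
  congr 1
  refine Finset.sum_congr rfl fun ω _ => ?_
  obtain ⟨q, s₁, s₂, x₁, x₂, y⟩ := ω
  rw [h.prob_inputs (f := fun ω : Letters Q S₁ S₂ X₁ X₂ Y => ((ω.x₁, ω.s₁, ω.x₂, ω.s₂), ω.q))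
      (by simp; tauto), h.prob_q, prob_all (f := fun ω : Letters Q S₁ S₂ X₁ X₂ Y =>
      ((ω.x₁, ω.s₁, ω.x₂, ω.s₂), (ω.y, ω.q))) (by rintro ⟨_, _, _, _, _, _⟩ ⟨_, _, _, _, _, _⟩; simp; tauto), h.prob_out₁₂,
      h.prob_s₁_s₂]
  by_cases h0 : p (q, s₁, s₂, x₁, x₂, y) = 0
  · simp [h0]
  rw [Model.density₁₂]
  have h1 := h.eq_mul q s₁ s₂ x₁ x₂ y
  rw [h1] at h0
  simp only [mul_ne_zero_iff] at h0
  obtain ⟨⟨⟨⟨a, b, c⟩, d⟩, e⟩, f⟩ := h0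
  have g := (Model.out₁₂_pos (m := m) (κ₁ := fun s => κ₁ s q) (κ₂ := fun s => κ₂ s q)
    (fun s => h.κ₁_mem s q) (fun s => h.κ₂_mem s q)
    (mul_ne_zero (mul_ne_zero (mul_ne_zero b d) (mul_ne_zero c e)) f)).ne'
  rw [h1]
  repeat rw [Real.log_mul (by simp [*]) (by simp [*])]
  ring

end Factors

end Formula

end Densities

/-! ### The compact convex set of bounds and distortions. -/

section RateRegion

variable {S₁ S₂ X₁ X₂ Y : Type*} [Fintype S₁] [Fintype S₂] [Fintype X₁] [Fintype X₂] [Fintype Y]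

/-- The three bounds and the two distortions of a tuple without time-sharing variable. -/
def Model.rateVec (m : Model S₁ S₂ X₁ X₂ Y) (κ : (S₁ → X₁ → ℝ) × (S₂ → X₂ → ℝ)) : Fin 5 → ℝ :=
  ![m.letterExpect κ.1 κ.2 (m.density₁ κ.1) / Real.log 2,
    m.letterExpect κ.1 κ.2 (m.density₂ κ.2) / Real.log 2,
    m.letterExpect κ.1 κ.2 (m.density₁₂ κ.1 κ.2) / Real.log 2,
    m.letterExpect κ.1 κ.2 fun s₁ x₁ _ _ _ => m.d₁ s₁ x₁,
    m.letterExpect κ.1 κ.2 fun _ _ s₂ x₂ _ => m.d₂ s₂ x₂]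

/-- The logarithm of an output probability depends on the kernels and is discontinuous at zero.
Summing over the inputs that give this output restores the factor that turns it into
`Real.negMulLog`, which is continuous; the remaining logarithms do not depend on the kernels. -/
theorem Model.letterExpect_density₁ (m : Model S₁ S₂ X₁ X₂ Y) (κ₁ : S₁ → X₁ → ℝ)
    (κ₂ : S₂ → X₂ → ℝ) : m.letterExpect κ₁ κ₂ (m.density₁ κ₁) =
      m.letterExpect κ₁ κ₂ (fun s₁ x₁ s₂ x₂ y =>
        Real.log (m.host₁ s₁) + Real.log (m.channel x₁ s₁ x₂ s₂ y)) +
      ∑ s₂, ∑ x₂, ∑ y, m.host₂ s₂ * κ₂ s₂ x₂ * Real.negMulLog (m.out₁ κ₁ s₂ x₂ y) := by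
  have h : ∑ s₂, ∑ x₂, ∑ y, m.host₂ s₂ * κ₂ s₂ x₂ * Real.negMulLog (m.out₁ κ₁ s₂ x₂ y) =
      m.letterExpect κ₁ κ₂ fun s₁ x₁ s₂ x₂ y => -Real.log (m.out₁ κ₁ s₂ x₂ y) := by
    have h1 : ∀ s₂ x₂ y, m.host₂ s₂ * κ₂ s₂ x₂ * Real.negMulLog (m.out₁ κ₁ s₂ x₂ y) =
        ∑ z : S₁ × X₁, m.host₁ z.1 * κ₁ z.1 z.2 * (m.host₂ s₂ * κ₂ s₂ x₂) *
          m.channel z.2 z.1 x₂ s₂ y * -Real.log (m.out₁ κ₁ s₂ x₂ y) := by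
      intro s₂ x₂ y
      rw [Real.negMulLog, ← Finset.sum_mul, neg_mul_comm, ← mul_assoc]
      congr 1
      rw [Model.out₁, Fintype.sum_prod_type, Finset.mul_sum]
      simp_rw [Finset.mul_sum]
      refine Finset.sum_congr rfl fun _ _ => Finset.sum_congr rfl fun _ _ => ?_
      ring
    have h2 : ∀ F : S₁ → X₁ → S₂ → X₂ → Y → ℝ, ∑ s₂, ∑ x₂, ∑ y, ∑ z : S₁ × X₁, F z.1 z.2 s₂ x₂ y =
        ∑ s₁, ∑ x₁, ∑ s₂, ∑ x₂, ∑ y, F s₁ x₁ s₂ x₂ y := by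
      intro F
      calc _ = ∑ w : S₂ × X₂ × Y, ∑ z : S₁ × X₁, F z.1 z.2 w.1 w.2.1 w.2.2 := by
            simp_rw [Fintype.sum_prod_type]
        _ = ∑ z : S₁ × X₁, ∑ w : S₂ × X₂ × Y, F z.1 z.2 w.1 w.2.1 w.2.2 := Finset.sum_comm
        _ = _ := by simp_rw [Fintype.sum_prod_type]
    simp_rw [h1, Model.letterExpect]
    exact h2 fun s₁ x₁ s₂ x₂ y => m.host₁ s₁ * κ₁ s₁ x₁ * (m.host₂ s₂ * κ₂ s₂ x₂) *
      m.channel x₁ s₁ x₂ s₂ y * -Real.log (m.out₁ κ₁ s₂ x₂ y)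
  rw [h, Model.letterExpect, Model.letterExpect, Model.letterExpect]
  simp_rw [← Finset.sum_add_distrib, Model.density₁, ← mul_add, sub_eq_add_neg]

theorem Model.letterExpect_density₂ (m : Model S₁ S₂ X₁ X₂ Y) (κ₁ : S₁ → X₁ → ℝ)
    (κ₂ : S₂ → X₂ → ℝ) : m.letterExpect κ₁ κ₂ (m.density₂ κ₂) =
      m.letterExpect κ₁ κ₂ (fun s₁ x₁ s₂ x₂ y =>
        Real.log (m.host₂ s₂) + Real.log (m.channel x₁ s₁ x₂ s₂ y)) +
      ∑ s₁, ∑ x₁, ∑ y, m.host₁ s₁ * κ₁ s₁ x₁ * Real.negMulLog (m.out₂ κ₂ s₁ x₁ y) := by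
  have h : ∑ s₁, ∑ x₁, ∑ y, m.host₁ s₁ * κ₁ s₁ x₁ * Real.negMulLog (m.out₂ κ₂ s₁ x₁ y) =
      m.letterExpect κ₁ κ₂ fun s₁ x₁ s₂ x₂ y => -Real.log (m.out₂ κ₂ s₁ x₁ y) := by
    rw [Model.letterExpect]
    refine Finset.sum_congr rfl fun s₁ _ => Finset.sum_congr rfl fun x₁ _ => ?_
    have h2 : ∀ F : S₂ → X₂ → Y → ℝ, ∑ s₂, ∑ x₂, ∑ y, F s₂ x₂ y =
        ∑ y, ∑ z : S₂ × X₂, F z.1 z.2 y := by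
      intro F
      calc _ = ∑ z : S₂ × X₂, ∑ y, F z.1 z.2 y := by simp_rw [Fintype.sum_prod_type]
        _ = _ := Finset.sum_comm
    rw [h2]
    refine Finset.sum_congr rfl fun y _ => ?_
    rw [Real.negMulLog, ← Finset.sum_mul, neg_mul_comm, ← mul_assoc]
    congr 1
    rw [Model.out₂, Fintype.sum_prod_type, Finset.mul_sum]
    simp_rw [Finset.mul_sum]
    refine Finset.sum_congr rfl fun _ _ => Finset.sum_congr rfl fun _ _ => ?_
    ring
  rw [h, Model.letterExpect, Model.letterExpect, Model.letterExpect]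
  simp_rw [← Finset.sum_add_distrib, Model.density₂, ← mul_add, sub_eq_add_neg]

theorem Model.letterExpect_density₁₂ (m : Model S₁ S₂ X₁ X₂ Y) (κ₁ : S₁ → X₁ → ℝ)
    (κ₂ : S₂ → X₂ → ℝ) : m.letterExpect κ₁ κ₂ (m.density₁₂ κ₁ κ₂) =
      m.letterExpect κ₁ κ₂ (fun s₁ x₁ s₂ x₂ y =>
        Real.log (m.host₁ s₁) + Real.log (m.host₂ s₂) + Real.log (m.channel x₁ s₁ x₂ s₂ y)) +
      ∑ y, Real.negMulLog (m.out₁₂ κ₁ κ₂ y) := by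
  have h : ∑ y, Real.negMulLog (m.out₁₂ κ₁ κ₂ y) =
      m.letterExpect κ₁ κ₂ fun s₁ x₁ s₂ x₂ y => -Real.log (m.out₁₂ κ₁ κ₂ y) := by
    rw [Model.letterExpect]
    have h2 : ∀ F : S₁ → X₁ → S₂ → X₂ → Y → ℝ, ∑ s₁, ∑ x₁, ∑ s₂, ∑ x₂, ∑ y, F s₁ x₁ s₂ x₂ y =
        ∑ y, ∑ z : S₁ × X₁ × S₂ × X₂, F z.1 z.2.1 z.2.2.1 z.2.2.2 y := by
      intro F
      calc _ = ∑ z : S₁ × X₁ × S₂ × X₂, ∑ y, F z.1 z.2.1 z.2.2.1 z.2.2.2 y := by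
            simp_rw [Fintype.sum_prod_type]
        _ = _ := Finset.sum_comm
    rw [h2]
    refine Finset.sum_congr rfl fun y _ => ?_
    rw [Real.negMulLog, ← Finset.sum_mul, neg_mul_comm]
    congr 1
    rw [Model.out₁₂]
    simp_rw [Fintype.sum_prod_type]
  rw [h, Model.letterExpect, Model.letterExpect, Model.letterExpect]
  simp_rw [← Finset.sum_add_distrib, Model.density₁₂, ← mul_add, sub_eq_add_neg]

theorem Model.continuous_letterExpect (m : Model S₁ S₂ X₁ X₂ Y) (g : S₁ → X₁ → S₂ → X₂ → Y → ℝ) :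
    Continuous fun κ : (S₁ → X₁ → ℝ) × (S₂ → X₂ → ℝ) => m.letterExpect κ.1 κ.2 g := by
  unfold Model.letterExpect
  fun_prop

theorem Model.continuous_rateVec (m : Model S₁ S₂ X₁ X₂ Y) : Continuous m.rateVec := by
  have h := m.continuous_letterExpect
  refine continuous_pi fun i => ?_
  fin_cases i
  · simp only [Model.rateVec, Model.letterExpect_density₁]
    refine ((h _).add ?_).div_const _
    unfold Model.out₁
    fun_prop
  · simp only [Model.rateVec, Model.letterExpect_density₂]
    refine ((h _).add ?_).div_const _
    unfold Model.out₂
    fun_prop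
  · simp only [Model.rateVec, Model.letterExpect_density₁₂]
    refine ((h _).add ?_).div_const _
    unfold Model.out₁₂
    fun_prop
  · exact h _
  · exact h _

/-- Pairs of test channels. -/
def kernelSet (S₁ S₂ X₁ X₂ : Type*) [Fintype S₁] [Fintype S₂] [Fintype X₁] [Fintype X₂] :
    Set ((S₁ → X₁ → ℝ) × (S₂ → X₂ → ℝ)) :=
  (Set.pi Set.univ fun _ => stdSimplex ℝ X₁) ×ˢ (Set.pi Set.univ fun _ => stdSimplex ℝ X₂)

theorem isCompact_kernelSet : IsCompact (kernelSet S₁ S₂ X₁ X₂) :=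
  (isCompact_univ_pi fun _ => isCompact_stdSimplex ℝ _).prod
    (isCompact_univ_pi fun _ => isCompact_stdSimplex ℝ _)

/-- The values of the bounds and distortions of all tuples. -/
def Model.rateRegion (m : Model S₁ S₂ X₁ X₂ Y) : Set (Fin 5 → ℝ) :=
  convexHull ℝ (m.rateVec '' kernelSet S₁ S₂ X₁ X₂)

/-- This does the work of a cardinality bound on `Q`: limits of tuples with growing time-sharing
alphabets are again given by a tuple. -/
theorem Model.isCompact_rateRegion (m : Model S₁ S₂ X₁ X₂ Y) : IsCompact m.rateRegion :=
  isCompact_convexHull_of_isCompact (isCompact_kernelSet.image m.continuous_rateVec)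

/-- The bounds and distortions of a joint law. -/
def Model.tupleVec {Q : Type*} [Fintype Q] (m : Model S₁ S₂ X₁ X₂ Y)
    (p : Letters Q S₁ S₂ X₁ X₂ Y → ℝ) : Fin 5 → ℝ :=
  ![bound₁ p, bound₂ p, bound₁₂ p, expect p fun ω => m.d₁ ω.s₁ ω.x₁,
    expect p fun ω => m.d₂ ω.s₂ ω.x₂]

/-- All five quantities are conditional on `Q` or, like the host entropies, unaffected by it. They
are therefore averages over `q`, and time sharing amounts to convex combination. -/
theorem Factors.tupleVec_eq {Q : Type*} [Fintype Q] {m : Model S₁ S₂ X₁ X₂ Y}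
    {p : Letters Q S₁ S₂ X₁ X₂ Y → ℝ} {pQ : Q → ℝ} {κ₁ : S₁ → Q → X₁ → ℝ} {κ₂ : S₂ → Q → X₂ → ℝ}
    (h : Factors m pQ κ₁ κ₂ p) : ∑ q, pQ q • m.rateVec (fun s => κ₁ s q, fun s => κ₂ s q) =
      m.tupleVec p := by
  ext i
  simp only [Finset.sum_apply, Pi.smul_apply, smul_eq_mul]
  fin_cases i
  · exact h.bound₁_eq.symm
  · exact h.bound₂_eq.symm
  · exact h.bound₁₂_eq.symm
  · exact (h.sum_mul fun ω => m.d₁ ω.s₁ ω.x₁).symm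
  · exact (h.sum_mul fun ω => m.d₂ ω.s₂ ω.x₂).symm

theorem Factors.tupleVec_mem {Q : Type*} [Fintype Q] {m : Model S₁ S₂ X₁ X₂ Y}
    {p : Letters Q S₁ S₂ X₁ X₂ Y → ℝ} {pQ : Q → ℝ} {κ₁ : S₁ → Q → X₁ → ℝ} {κ₂ : S₂ → Q → X₂ → ℝ}
    (h : Factors m pQ κ₁ κ₂ p) : m.tupleVec p ∈ m.rateRegion :=
  mem_convexHull_of_exists_fintype pQ (fun q => m.rateVec (fun s => κ₁ s q, fun s => κ₂ s q))
    h.pQ_mem.1 h.pQ_mem.2 (fun q => Set.mem_image_of_mem _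
      ⟨fun s _ => h.κ₁_mem s q, fun s _ => h.κ₂_mem s q⟩) h.tupleVec_eq

theorem Model.host_eq_mul {m : Model S₁ S₂ X₁ X₂ Y} (hS : m.IndepHosts) (s₁ : S₁) (s₂ : S₂) :
    m.host (s₁, s₂) = m.host₁ s₁ * m.host₂ s₂ := hS s₁ s₂

theorem IsAdmissible.exists_factors {Q : Type*} [Fintype Q] {m : Model S₁ S₂ X₁ X₂ Y}
    (hS : m.IndepHosts) {Δ₁ Δ₂ : ℝ} {p : Letters Q S₁ S₂ X₁ X₂ Y → ℝ}
    (hp : IsAdmissible m Δ₁ Δ₂ p) : ∃ pQ κ₁ κ₂, Factors m pQ κ₁ κ₂ p := by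
  obtain ⟨⟨pQ, hQ, κ₁, κ₂, h₁, h₂, h⟩, -, -⟩ := hp
  exact ⟨pQ, κ₁, κ₂, hQ, h₁, h₂, fun q s₁ s₂ x₁ x₂ y => by rw [h, m.host_eq_mul hS]⟩

/-- Every point of the rate region comes from a tuple. -/
theorem Model.exists_tuple {m : Model S₁ S₂ X₁ X₂ Y} {v : Fin 5 → ℝ} (hv : v ∈ m.rateRegion) :
    ∃ (Q : Type) (_ : Fintype Q) (p : Letters Q S₁ S₂ X₁ X₂ Y → ℝ) (pQ : Q → ℝ)
      (κ₁ : S₁ → Q → X₁ → ℝ) (κ₂ : S₂ → Q → X₂ → ℝ), Factors m pQ κ₁ κ₂ p ∧ m.tupleVec p = v := by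
  obtain ⟨Q, _, w, z, hw, hw1, hz, rfl⟩ := mem_convexHull_iff_exists_fintype.1 hv
  choose κ hκ hκz using hz
  -- The index set of the convex combination serves as time-sharing alphabet and its weights as the
  -- law of `Q`.
  have h : Factors m w (fun s q => (κ q).1 s) (fun s q => (κ q).2 s)
      (fun ω : Letters Q S₁ S₂ X₁ X₂ Y => w ω.q * (m.host₁ ω.s₁ * m.host₂ ω.s₂) *
        (κ ω.q).1 ω.s₁ ω.x₁ * (κ ω.q).2 ω.s₂ ω.x₂ * m.channel ω.x₁ ω.s₁ ω.x₂ ω.s₂ ω.y) :=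
    ⟨⟨hw, hw1⟩, fun s q => (hκ q).1 s trivial, fun s q => (hκ q).2 s trivial,
      fun _ _ _ _ _ _ => rfl⟩
  refine ⟨Q, inferInstance, _, _, _, _, h, ?_⟩
  rw [← h.tupleVec_eq]
  exact Finset.sum_congr rfl fun q _ => by rw [← hκz q]

theorem Factors.isAdmissible {Q : Type*} [Fintype Q] {m : Model S₁ S₂ X₁ X₂ Y}
    (hS : m.IndepHosts) {p : Letters Q S₁ S₂ X₁ X₂ Y → ℝ} {pQ : Q → ℝ} {κ₁ : S₁ → Q → X₁ → ℝ}
    {κ₂ : S₂ → Q → X₂ → ℝ} (h : Factors m pQ κ₁ κ₂ p) {Δ₁ Δ₂ : ℝ} (h₁ : m.tupleVec p 3 ≤ Δ₁)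
    (h₂ : m.tupleVec p 4 ≤ Δ₂) : IsAdmissible m Δ₁ Δ₂ p :=
  ⟨⟨pQ, h.pQ_mem, κ₁, κ₂, h.κ₁_mem, h.κ₂_mem, fun q s₁ s₂ x₁ x₂ y => by
    rw [h.eq_mul, m.host_eq_mul hS]⟩, h₁, h₂⟩

end RateRegion

/-! ### Memoryless extensions of sources and kernels. -/

section Blocks

variable {S X : Type*} [Fintype S] [Fintype X] {M n : ℕ}

/-- The law of a uniform message together with an i.i.d. host sequence. -/
def blockSource (p : S → ℝ) (u : Fin M × (Fin n → S)) : ℝ := 1 / (M : ℝ) * ∏ j, p (u.2 j)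

/-- The memoryless extension of a kernel. -/
def blockKernel (κ : Fin n → S → X → ℝ) (u : Fin M × (Fin n → S)) (x : Fin n → X) : ℝ :=
  ∏ j, κ j (u.2 j) (x j)

theorem prod_mem_stdSimplex {w : Fin n → X → ℝ} (hw : ∀ j, w j ∈ stdSimplex ℝ X) :
    (fun x : Fin n → X => ∏ j, w j (x j)) ∈ stdSimplex ℝ (Fin n → X) :=
  ⟨fun _ => Finset.prod_nonneg fun j _ => (hw j).1 _, sum_prod_eq_one fun j => (hw j).2⟩

theorem sum_blockSource_mul (hM : 0 < M) (p : S → ℝ) (g : (Fin n → S) → ℝ) :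
    ∑ u : Fin M × (Fin n → S), blockSource p u * g u.2 = ∑ s, (∏ j, p (s j)) * g s := by
  have : (M : ℝ) ≠ 0 := by positivity
  simp_rw [Fintype.sum_prod_type, blockSource]
  simp only [mul_assoc, Finset.sum_const, Finset.card_univ, Fintype.card_fin, nsmul_eq_mul,
    ← Finset.mul_sum]
  field_simp

theorem blockSource_mem (hM : 0 < M) {p : S → ℝ} (hp : p ∈ stdSimplex ℝ S) :
    (blockSource p : Fin M × (Fin n → S) → ℝ) ∈ stdSimplex ℝ (Fin M × (Fin n → S)) := by
  refine ⟨fun u => mul_nonneg (by positivity) (Finset.prod_nonneg fun j _ => hp.1 _), ?_⟩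
  have := sum_blockSource_mul (n := n) hM p fun _ => 1
  simp only [mul_one] at this
  rw [this]
  exact sum_prod_eq_one fun _ => hp.2

theorem blockKernel_mem {κ : Fin n → S → X → ℝ} (hκ : ∀ j s, κ j s ∈ stdSimplex ℝ X)
    (u : Fin M × (Fin n → S)) : blockKernel κ u ∈ stdSimplex ℝ (Fin n → X) :=
  prod_mem_stdSimplex fun j => hκ j (u.2 j)

end Blocks

/-! ### Block laws, and the law of a code. -/

section BlockChannel

variable {S₁ S₂ X₁ X₂ Y : Type*} [Fintype S₁] [Fintype S₂] [Fintype X₁] [Fintype X₂] [Fintype Y]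
  {M₁ M₂ n : ℕ} (m : Model S₁ S₂ X₁ X₂ Y)

/-- The memoryless extension of the channel. -/
def Model.blockChannel (u₁ : Fin M₁ × (Fin n → S₁)) (x₁ : Fin n → X₁) (u₂ : Fin M₂ × (Fin n → S₂))
    (x₂ : Fin n → X₂) (y : Fin n → Y) : ℝ := ∏ j, m.channel (x₁ j) (u₁.2 j) (x₂ j) (u₂.2 j) (y j)

theorem Model.blockChannel_mem (u₁ : Fin M₁ × (Fin n → S₁)) (x₁ : Fin n → X₁)
    (u₂ : Fin M₂ × (Fin n → S₂)) (x₂ : Fin n → X₂) :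
    m.blockChannel u₁ x₁ u₂ x₂ ∈ stdSimplex ℝ (Fin n → Y) :=
  prod_mem_stdSimplex fun _ => m.channel_mem _ _ _ _

/-- The message does not influence the distribution of the random codeword, so it averages out and
the block output law factors over letters. This identifies the reference measure required by
`exists_codebooks`. -/
theorem Model.prod_out₁ (hM : 0 < M₁) (κ : Fin n → S₁ → X₁ → ℝ) (u₂ : Fin M₂ × (Fin n → S₂))
    (x₂ : Fin n → X₂) (y : Fin n → Y) : ∏ j, m.out₁ (κ j) (u₂.2 j) (x₂ j) (y j) =
      ∑ u₁ : Fin M₁ × (Fin n → S₁), ∑ x₁, blockSource m.host₁ u₁ * blockKernel κ u₁ x₁ *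
        m.blockChannel u₁ x₁ u₂ x₂ y := by
  have := sum_blockSource_mul hM m.host₁ fun s => ∑ x₁ : Fin n → X₁, (∏ j, κ j (s j) (x₁ j)) *
    ∏ j, m.channel (x₁ j) (s j) (x₂ j) (u₂.2 j) (y j)
  simp_rw [mul_assoc, ← Finset.mul_sum]
  refine Eq.trans ?_ this.symm
  simp_rw [Model.out₁, Fintype.prod_sum, Finset.prod_mul_distrib, Finset.mul_sum, mul_assoc]

theorem Model.prod_out₂ (hM : 0 < M₂) (κ : Fin n → S₂ → X₂ → ℝ) (u₁ : Fin M₁ × (Fin n → S₁))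
    (x₁ : Fin n → X₁) (y : Fin n → Y) : ∏ j, m.out₂ (κ j) (u₁.2 j) (x₁ j) (y j) =
      ∑ u₂ : Fin M₂ × (Fin n → S₂), ∑ x₂, blockSource m.host₂ u₂ * blockKernel κ u₂ x₂ *
        m.blockChannel u₁ x₁ u₂ x₂ y := by
  have := sum_blockSource_mul hM m.host₂ fun s => ∑ x₂ : Fin n → X₂, (∏ j, κ j (s j) (x₂ j)) *
    ∏ j, m.channel (x₁ j) (u₁.2 j) (x₂ j) (s j) (y j)
  simp_rw [mul_assoc, ← Finset.mul_sum]
  refine Eq.trans ?_ this.symm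
  simp_rw [Model.out₂, Fintype.prod_sum, Finset.prod_mul_distrib, Finset.mul_sum, mul_assoc]

theorem Model.prod_out₁₂ (hM₁ : 0 < M₁) (hM₂ : 0 < M₂) (κ₁ : Fin n → S₁ → X₁ → ℝ)
    (κ₂ : Fin n → S₂ → X₂ → ℝ) (y : Fin n → Y) : ∏ j, m.out₁₂ (κ₁ j) (κ₂ j) (y j) =
      ∑ u₁ : Fin M₁ × (Fin n → S₁), ∑ x₁, ∑ u₂ : Fin M₂ × (Fin n → S₂), ∑ x₂,
        blockSource m.host₁ u₁ * blockKernel κ₁ u₁ x₁ *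
        (blockSource m.host₂ u₂ * blockKernel κ₂ u₂ x₂) * m.blockChannel u₁ x₁ u₂ x₂ y := by
  have h2 : ∀ (u₁ : Fin M₁ × (Fin n → S₁)) x₁, ∑ u₂ : Fin M₂ × (Fin n → S₂), ∑ x₂,
        blockSource m.host₂ u₂ * blockKernel κ₂ u₂ x₂ * m.blockChannel u₁ x₁ u₂ x₂ y =
      ∏ j, m.out₂ (κ₂ j) (u₁.2 j) (x₁ j) (y j) := fun u₁ x₁ => (m.prod_out₂ hM₂ κ₂ u₁ x₁ y).symm
  have h4 : ∀ (u₁ : Fin M₁ × (Fin n → S₁)) x₁, ∑ u₂ : Fin M₂ × (Fin n → S₂), ∑ x₂,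
        blockSource m.host₁ u₁ * blockKernel κ₁ u₁ x₁ *
        (blockSource m.host₂ u₂ * blockKernel κ₂ u₂ x₂) * m.blockChannel u₁ x₁ u₂ x₂ y =
      blockSource m.host₁ u₁ * (blockKernel κ₁ u₁ x₁ *
        ∏ j, m.out₂ (κ₂ j) (u₁.2 j) (x₁ j) (y j)) := by
    intro u₁ x₁
    rw [← h2, ← mul_assoc]
    simp_rw [Finset.mul_sum, mul_assoc]
  simp_rw [h4]
  have := sum_blockSource_mul hM₁ m.host₁ fun s => ∑ x₁ : Fin n → X₁, (∏ j, κ₁ j (s j) (x₁ j)) *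
    ∏ j, m.out₂ (κ₂ j) (s j) (x₁ j) (y j)
  simp_rw [← Finset.mul_sum]
  refine Eq.trans ?_ this.symm
  have h3 : ∀ κ₁ κ₂ y, m.out₁₂ κ₁ κ₂ y = ∑ s₁, ∑ x₁, m.host₁ s₁ * κ₁ s₁ x₁ * m.out₂ κ₂ s₁ x₁ y := by
    intro κ₁ κ₂ y
    simp_rw [Model.out₁₂, Model.out₂, Finset.mul_sum, mul_assoc]
  simp_rw [h3, Fintype.prod_sum, Finset.prod_mul_distrib, Finset.mul_sum, mul_assoc]

/-- The blocks of letters as a block of tuples. -/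
def lettersEquiv (Q S₁ S₂ X₁ X₂ Y : Type*) (n : ℕ) : ((Fin n → Q) × (Fin n → S₁) × (Fin n → X₁) ×
    (Fin n → S₂) × (Fin n → X₂) × (Fin n → Y)) ≃ (Fin n → Letters Q S₁ S₂ X₁ X₂ Y) where
  toFun z j := (z.1 j, z.2.1 j, z.2.2.2.1 j, z.2.2.1 j, z.2.2.2.2.1 j, z.2.2.2.2.2 j)
  invFun t := (fun j => (t j).q, fun j => (t j).s₁, fun j => (t j).x₁, fun j => (t j).s₂,
    fun j => (t j).x₂, fun j => (t j).y)
  left_inv _ := rfl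
  right_inv _ := rfl

-- Averaged over an i.i.d. time-sharing sequence and the random codewords, the letters along the
-- block are i.i.d. with law `p`. The bracket after the weight of `q` has the form produced by
-- `exists_codebooks`.
variable {m} in
theorem Factors.sum_block {Q : Type*} [Fintype Q] {p : Letters Q S₁ S₂ X₁ X₂ Y → ℝ} {pQ : Q → ℝ}
    {κ₁ : S₁ → Q → X₁ → ℝ} {κ₂ : S₂ → Q → X₂ → ℝ} (h : Factors m pQ κ₁ κ₂ p)
    (hM₁ : 0 < M₁) (hM₂ : 0 < M₂) (g : (Fin n → Letters Q S₁ S₂ X₁ X₂ Y) → ℝ) :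
    ∑ q : Fin n → Q, (∏ j, pQ (q j)) * (∑ u₁ : Fin M₁ × (Fin n → S₁), ∑ x₁,
      blockKernel (fun j s => κ₁ s (q j)) u₁ x₁ * ∑ u₂ : Fin M₂ × (Fin n → S₂), ∑ x₂,
      blockKernel (fun j s => κ₂ s (q j)) u₂ x₂ * (blockSource m.host₁ u₁ * blockSource m.host₂ u₂ *
      ∑ y, m.blockChannel u₁ x₁ u₂ x₂ y *
        g fun j => (q j, u₁.2 j, u₂.2 j, x₁ j, x₂ j, y j))) =
      ∑ t, (∏ j, p (t j)) * g t := by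
  rw [← (lettersEquiv Q S₁ S₂ X₁ X₂ Y n).sum_comp]
  refine Eq.trans ?_ (Fintype.sum_prod_type _).symm
  refine Finset.sum_congr rfl fun q _ => ?_
  have e2 := fun (s₁ : Fin n → S₁) (x₁ : Fin n → X₁) => sum_blockSource_mul hM₂ m.host₂ fun s₂ =>
    ∑ x₂ : Fin n → X₂, (∏ j, κ₂ (s₂ j) (q j) (x₂ j)) *
      ∑ y : Fin n → Y, (∏ j, m.channel (x₁ j) (s₁ j) (x₂ j) (s₂ j) (y j)) *
        g fun j => (q j, s₁ j, s₂ j, x₁ j, x₂ j, y j)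
  have e1 := sum_blockSource_mul hM₁ m.host₁ fun s₁ =>
    ∑ x₁ : Fin n → X₁, (∏ j, κ₁ (s₁ j) (q j) (x₁ j)) *
      ∑ s₂ : Fin n → S₂, (∏ j, m.host₂ (s₂ j)) *
      ∑ x₂ : Fin n → X₂, (∏ j, κ₂ (s₂ j) (q j) (x₂ j)) *
      ∑ y : Fin n → Y, (∏ j, m.channel (x₁ j) (s₁ j) (x₂ j) (s₂ j) (y j)) *
        g fun j => (q j, s₁ j, s₂ j, x₁ j, x₂ j, y j)
  calc _ = (∏ j, pQ (q j)) * ∑ u₁ : Fin M₁ × (Fin n → S₁), blockSource m.host₁ u₁ *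
      ∑ x₁ : Fin n → X₁, (∏ j, κ₁ (u₁.2 j) (q j) (x₁ j)) *
      ∑ u₂ : Fin M₂ × (Fin n → S₂), blockSource m.host₂ u₂ *
      ∑ x₂ : Fin n → X₂, (∏ j, κ₂ (u₂.2 j) (q j) (x₂ j)) *
      ∑ y : Fin n → Y, (∏ j, m.channel (x₁ j) (u₁.2 j) (x₂ j) (u₂.2 j) (y j)) *
        g fun j => (q j, u₁.2 j, u₂.2 j, x₁ j, x₂ j, y j) := by
        congr 1
        refine Finset.sum_congr rfl fun u₁ _ => ?_
        rw [Finset.mul_sum]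
        refine Finset.sum_congr rfl fun x₁ _ => ?_
        rw [mul_left_comm, Finset.mul_sum (a := blockSource m.host₁ u₁)]
        congr 1
        refine Finset.sum_congr rfl fun u₂ _ => ?_
        rw [← mul_assoc, Finset.mul_sum]
        refine Finset.sum_congr rfl fun x₂ _ => ?_
        rw [mul_left_comm]
        rfl
    _ = _ := by
        simp_rw [e2]
        rw [e1]
        simp_rw [Finset.mul_sum, lettersEquiv, Equiv.coe_fn_mk, h.eq_mul, Finset.prod_mul_distrib]
        simp_rw [Fintype.sum_prod_type]
        refine Finset.sum_congr rfl fun s₁ _ => Finset.sum_congr rfl fun x₁ _ =>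
          Finset.sum_congr rfl fun s₂ _ => Finset.sum_congr rfl fun x₂ _ =>
          Finset.sum_congr rfl fun y _ => ?_
        ring

variable (c : Code S₁ S₂ X₁ X₂ Y M₁ M₂ n)

theorem Code.sum_law_mul (hS : m.IndepHosts) (g : Outcome S₁ S₂ Y M₁ M₂ n → ℝ) :
    ∑ ω, c.law m ω * g ω = ∑ u₁ : Fin M₁ × (Fin n → S₁), ∑ u₂ : Fin M₂ × (Fin n → S₂),
      blockSource m.host₁ u₁ * blockSource m.host₂ u₂ *
        ∑ y, m.blockChannel u₁ (c.enc₁ u₁.1 u₁.2) u₂ (c.enc₂ u₂.1 u₂.2) y *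
          g ⟨u₁.1, u₂.1, u₁.2, u₂.2, y⟩ := by
  rw [← (Outcome.equiv M₁ M₂ n).symm.sum_comp]
  simp_rw [Fintype.sum_prod_type, Finset.mul_sum]
  refine Finset.sum_congr rfl fun w₁ _ => ?_
  rw [Finset.sum_comm]
  refine Finset.sum_congr rfl fun s₁ _ => Finset.sum_congr rfl fun w₂ _ =>
    Finset.sum_congr rfl fun s₂ _ => Finset.sum_congr rfl fun y _ => ?_
  simp only [Outcome.equiv, Equiv.coe_fn_symm_mk, Code.law, m.host_eq_mul hS,
    Finset.prod_mul_distrib, blockSource, Model.blockChannel]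
  ring

theorem Code.law_nonneg (ω : Outcome S₁ S₂ Y M₁ M₂ n) : 0 ≤ c.law m ω :=
  mul_nonneg (mul_nonneg (by positivity) (Finset.prod_nonneg fun _ _ => m.host_mem.1 _))
    (Finset.prod_nonneg fun _ _ => (m.channel_mem _ _ _ _).1 _)

theorem Code.sum_law (hS : m.IndepHosts) (hM₁ : 0 < M₁) (hM₂ : 0 < M₂) :
    ∑ ω, c.law m ω = 1 := by
  have := c.sum_law_mul m hS fun _ => 1
  simp only [mul_one] at this
  rw [this]
  simp_rw [(m.blockChannel_mem _ _ _ _).2, mul_one, ← Finset.mul_sum,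
    (blockSource_mem hM₂ m.host₂_mem).2, mul_one, (blockSource_mem hM₁ m.host₁_mem).2]

end BlockChannel

/-! ### From failing tests to large deviations. -/

section Achievability

variable {S₁ S₂ X₁ X₂ Y : Type*} [Fintype S₁] [Fintype S₂] [Fintype X₁] [Fintype X₂] [Fintype Y]

theorem log_blockSource {S : Type*} [Fintype S] {M n : ℕ} (hM : 0 < M) {p : S → ℝ}
    {u : Fin M × (Fin n → S)} (h : ∀ j, p (u.2 j) ≠ 0) :
    Real.log (blockSource p u) = -Real.log M + ∑ j, Real.log (p (u.2 j)) := by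
  have : (M : ℝ) ≠ 0 := by positivity
  rw [blockSource, Real.log_mul (by positivity) (Finset.prod_ne_zero_iff.2 fun j _ => h j),
    Real.log_prod (fun j _ => h j), one_div, Real.log_inv]

/-- With a single message and a deterministic host there is only one message pair of positive
probability, so the tests concerning it are void. -/
theorem blockSource_eq_one {S : Type*} [Fintype S] {n : ℕ} {p : S → ℝ} (hp : p ∈ stdSimplex ℝ S)
    {s : S} (hs : p s = 1) {M : ℕ} (hM : M = 1) {u : Fin M × (Fin n → S)}
    (h : blockSource p u ≠ 0) : blockSource p u = 1 := by
  subst hM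
  have h1 : ∀ j, p (u.2 j) = 1 := by
    intro j
    by_contra hj
    have : p (u.2 j) = 0 := eq_zero_of_apply_eq_one hp hs fun h => hj (h ▸ hs)
    exact h (by rw [blockSource, Finset.prod_eq_zero (Finset.mem_univ j) this, mul_zero])
  simp [blockSource, h1]

/-- The pointwise form of Chebyshev's inequality. Of the slack `3 * γ` per letter, one part pays for
the decoding threshold, one absorbs `2 * Real.log 2` from rounding up the two message counts, and
one remains as the deviation. -/
theorem one_le_sq_div_of_sum_le {n : ℕ} (hn : 0 < n) {γ r μ l : ℝ} (hγ : 0 < γ)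
    (hl : l ≤ 2 * Real.log 2 + n * r) (hnγ : 2 * Real.log 2 ≤ n * γ) (hr : r + 3 * γ ≤ μ)
    {D : Fin n → ℝ} (hD : ∑ j, D j ≤ n * γ + l) :
    1 ≤ (∑ j, (D j - μ)) ^ 2 / (n * γ) ^ 2 := by
  have hn' : (0 : ℝ) < n := by positivity
  rw [one_le_div (by positivity), Finset.sum_sub_distrib]
  simp only [Finset.sum_const, Finset.card_univ, Fintype.card_fin, nsmul_eq_mul]
  have : n * (r + 3 * γ) ≤ n * μ := mul_le_mul_of_nonneg_left hr hn'.le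
  have h2 : ∑ j, D j - n * μ ≤ -(n * γ) := by nlinarith
  have h3 : 0 < n * γ := by positivity
  nlinarith

theorem ceil_two_rpow_pos (n : ℕ) (R : ℝ) : 0 < ⌈(2 : ℝ) ^ ((n : ℝ) * R)⌉₊ :=
  Nat.ceil_pos.2 (Real.rpow_pos_of_pos two_pos _)

/-- At a nonnegative rate the power is at least one, so rounding up at most doubles it. -/
theorem log_ceil_two_rpow_le {R : ℝ} (hR : 0 ≤ R) (n : ℕ) :
    Real.log (⌈(2 : ℝ) ^ ((n : ℝ) * R)⌉₊ : ℝ) ≤ Real.log 2 + n * (R * Real.log 2) := by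
  have h1 : (1 : ℝ) ≤ (2 : ℝ) ^ ((n : ℝ) * R) :=
    Real.one_le_rpow one_le_two (by positivity)
  have h2 := Nat.ceil_lt_add_one (zero_le_one.trans h1)
  have h3 : ((⌈(2 : ℝ) ^ ((n : ℝ) * R)⌉₊ : ℕ) : ℝ) ≤ 2 * (2 : ℝ) ^ ((n : ℝ) * R) := by linarith
  have h4 : (0 : ℝ) < (⌈(2 : ℝ) ^ ((n : ℝ) * R)⌉₊ : ℝ) := by exact_mod_cast ceil_two_rpow_pos n R
  refine (Real.log_le_log h4 h3).trans ?_
  rw [Real.log_mul two_ne_zero (by positivity), Real.log_rpow two_pos, mul_assoc]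

/-- Failure of a likelihood ratio test, in the logarithmic scale. -/
theorem log_le_of_not_lt {γ a b : ℝ} (ha : 0 < a) (hb : 0 < b) (h : ¬ Real.exp γ * b < a) :
    Real.log a ≤ γ + Real.log b := by
  have := Real.log_le_log ha (not_lt.1 h)
  rwa [Real.log_mul (Real.exp_pos _).ne' hb.ne', Real.log_exp] at this

open Classical in
/-- A failing test forces a large deviation of one of the information densities. -/
theorem ite_not_passesTests_le {m : Model S₁ S₂ X₁ X₂ Y} {n : ℕ} (hn : 0 < n) {R₁ R₂ γ : ℝ}
    (hR₁ : 0 ≤ R₁) (hR₂ : 0 ≤ R₂) (hγ : 0 < γ) (hnγ : 2 * Real.log 2 ≤ n * γ) {μ₁ μ₂ μ₁₂ : ℝ}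
    (h₁ : R₁ * Real.log 2 + 3 * γ ≤ μ₁ ∨ R₁ = 0 ∧ ∃ s, m.host₁ s = 1)
    (h₂ : R₂ * Real.log 2 + 3 * γ ≤ μ₂ ∨ R₂ = 0 ∧ ∃ s, m.host₂ s = 1)
    (h₁₂ : (R₁ + R₂) * Real.log 2 + 3 * γ ≤ μ₁₂ ∨ (R₁ = 0 ∧ ∃ s, m.host₁ s = 1) ∨
      R₂ = 0 ∧ ∃ s, m.host₂ s = 1)
    {κ₁ : Fin n → S₁ → X₁ → ℝ} {κ₂ : Fin n → S₂ → X₂ → ℝ}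
    (hκ₁ : ∀ j s, κ₁ j s ∈ stdSimplex ℝ X₁) (hκ₂ : ∀ j s, κ₂ j s ∈ stdSimplex ℝ X₂)
    (u₁ : Fin ⌈(2 : ℝ) ^ ((n : ℝ) * R₁)⌉₊ × (Fin n → S₁)) (x₁ : Fin n → X₁)
    (u₂ : Fin ⌈(2 : ℝ) ^ ((n : ℝ) * R₂)⌉₊ × (Fin n → S₂)) (x₂ : Fin n → X₂) (y : Fin n → Y)
    (hu₁ : blockSource m.host₁ u₁ ≠ 0) (hu₂ : blockSource m.host₂ u₂ ≠ 0)
    (hx₁ : blockKernel κ₁ u₁ x₁ ≠ 0) (hx₂ : blockKernel κ₂ u₂ x₂ ≠ 0)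
    (hy : m.blockChannel u₁ x₁ u₂ x₂ y ≠ 0) :
    (if ¬ PassesTests (blockSource m.host₁) (blockSource m.host₂) m.blockChannel
      (fun u₂ x₂ y => ∏ j, m.out₁ (κ₁ j) (u₂.2 j) (x₂ j) (y j))
      (fun u₁ x₁ y => ∏ j, m.out₂ (κ₂ j) (u₁.2 j) (x₁ j) (y j))
      (fun y => ∏ j, m.out₁₂ (κ₁ j) (κ₂ j) (y j)) (Real.exp (n * γ)) u₁ x₁ u₂ x₂ y
      then (1 : ℝ) else 0) ≤
    (∑ j, (m.density₁ (κ₁ j) (u₁.2 j) (x₁ j) (u₂.2 j) (x₂ j) (y j) - μ₁)) ^ 2 / (n * γ) ^ 2 +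
    (∑ j, (m.density₂ (κ₂ j) (u₁.2 j) (x₁ j) (u₂.2 j) (x₂ j) (y j) - μ₂)) ^ 2 / (n * γ) ^ 2 +
    (∑ j, (m.density₁₂ (κ₁ j) (κ₂ j) (u₁.2 j) (x₁ j) (u₂.2 j) (x₂ j) (y j) - μ₁₂)) ^ 2 /
      (n * γ) ^ 2 := by
  have hM₁ := ceil_two_rpow_pos n R₁
  have hM₂ := ceil_two_rpow_pos n R₂
  have hl₁ := log_ceil_two_rpow_le hR₁ n
  have hl₂ := log_ceil_two_rpow_le hR₂ n
  have hlog : 0 < Real.log 2 := Real.log_pos one_lt_two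
  have hp₁ : ∀ j, m.host₁ (u₁.2 j) ≠ 0 := fun j =>
    Finset.prod_ne_zero_iff.1 (right_ne_zero_of_mul hu₁) j (Finset.mem_univ j)
  have hp₂ : ∀ j, m.host₂ (u₂.2 j) ≠ 0 := fun j =>
    Finset.prod_ne_zero_iff.1 (right_ne_zero_of_mul hu₂) j (Finset.mem_univ j)
  have hk₁ : ∀ j, κ₁ j (u₁.2 j) (x₁ j) ≠ 0 := fun j =>
    Finset.prod_ne_zero_iff.1 hx₁ j (Finset.mem_univ j)
  have hk₂ : ∀ j, κ₂ j (u₂.2 j) (x₂ j) ≠ 0 := fun j =>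
    Finset.prod_ne_zero_iff.1 hx₂ j (Finset.mem_univ j)
  have hc : ∀ j, m.channel (x₁ j) (u₁.2 j) (x₂ j) (u₂.2 j) (y j) ≠ 0 := fun j =>
    Finset.prod_ne_zero_iff.1 hy j (Finset.mem_univ j)
  have hpos₁ := ((blockSource_mem hM₁ m.host₁_mem).1 u₁).lt_of_ne' hu₁
  have hpos₂ := ((blockSource_mem hM₂ m.host₂_mem).1 u₂).lt_of_ne' hu₂
  have hposW := ((m.blockChannel_mem u₁ x₁ u₂ x₂).1 y).lt_of_ne' hy
  have hlogW : Real.log (m.blockChannel u₁ x₁ u₂ x₂ y) =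
      ∑ j, Real.log (m.channel (x₁ j) (u₁.2 j) (x₂ j) (u₂.2 j) (y j)) :=
    Real.log_prod fun j _ => hc j
  have n1 : 0 ≤ (∑ j, (m.density₁ (κ₁ j) (u₁.2 j) (x₁ j) (u₂.2 j) (x₂ j) (y j) - μ₁)) ^ 2 /
    (n * γ) ^ 2 := by positivity
  have n2 : 0 ≤ (∑ j, (m.density₂ (κ₂ j) (u₁.2 j) (x₁ j) (u₂.2 j) (x₂ j) (y j) - μ₂)) ^ 2 /
    (n * γ) ^ 2 := by positivity
  have n3 : 0 ≤ (∑ j, (m.density₁₂ (κ₁ j) (κ₂ j) (u₁.2 j) (x₁ j) (u₂.2 j) (x₂ j) (y j) - μ₁₂)) ^ 2 /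
    (n * γ) ^ 2 := by positivity
  -- In the degenerate alternative the test is passed automatically; a failing test therefore forces
  -- the alternative with slack.
  have det₁ : (R₁ = 0 ∧ ∃ s, m.host₁ s = 1) → blockSource m.host₁ u₁ = 1 := by
    rintro ⟨hR, s, hs⟩
    exact blockSource_eq_one m.host₁_mem hs (by simp [hR]) hu₁
  have det₂ : (R₂ = 0 ∧ ∃ s, m.host₂ s = 1) → blockSource m.host₂ u₂ = 1 := by
    rintro ⟨hR, s, hs⟩
    exact blockSource_eq_one m.host₂_mem hs (by simp [hR]) hu₂
  split_ifs with hfail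
  · linarith
  rw [PassesTests, not_and_or, not_and_or] at hfail
  rcases hfail with hf | hf | hf
  · rw [not_or] at hf
    have hr := h₁.resolve_right fun h => hf.1 (det₁ h)
    have ho : ∀ j, 0 < m.out₁ (κ₁ j) (u₂.2 j) (x₂ j) (y j) := fun j =>
      Model.out₁_pos (hκ₁ j) (mul_ne_zero (mul_ne_zero (hp₁ j) (hk₁ j)) (hc j))
    have := log_le_of_not_lt (mul_pos hpos₁ hposW) (Finset.prod_pos fun j _ => ho j) hf.2
    rw [Real.log_mul hpos₁.ne' hposW.ne', log_blockSource hM₁ hp₁, hlogW,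
      Real.log_prod fun j _ => (ho j).ne'] at this
    have := one_le_sq_div_of_sum_le hn hγ (hl₁.trans (by linarith)) hnγ hr
      (D := fun j => m.density₁ (κ₁ j) (u₁.2 j) (x₁ j) (u₂.2 j) (x₂ j) (y j))
      (by simp only [Model.density₁, Finset.sum_sub_distrib, Finset.sum_add_distrib]; linarith)
    linarith
  · rw [not_or] at hf
    have hr := h₂.resolve_right fun h => hf.1 (det₂ h)
    have ho : ∀ j, 0 < m.out₂ (κ₂ j) (u₁.2 j) (x₁ j) (y j) := fun j =>
      Model.out₂_pos (hκ₂ j) (mul_ne_zero (mul_ne_zero (hp₂ j) (hk₂ j)) (hc j))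
    have := log_le_of_not_lt (mul_pos hpos₂ hposW) (Finset.prod_pos fun j _ => ho j) hf.2
    rw [Real.log_mul hpos₂.ne' hposW.ne', log_blockSource hM₂ hp₂, hlogW,
      Real.log_prod fun j _ => (ho j).ne'] at this
    have := one_le_sq_div_of_sum_le hn hγ (hl₂.trans (by linarith)) hnγ hr
      (D := fun j => m.density₂ (κ₂ j) (u₁.2 j) (x₁ j) (u₂.2 j) (x₂ j) (y j))
      (by simp only [Model.density₂, Finset.sum_sub_distrib, Finset.sum_add_distrib]; linarith)
    linarith
  · rw [not_or, not_or] at hf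
    have hr := h₁₂.resolve_right fun h => h.elim (fun h => hf.1 (det₁ h)) fun h => hf.2.1 (det₂ h)
    have ho : ∀ j, 0 < m.out₁₂ (κ₁ j) (κ₂ j) (y j) := fun j =>
      Model.out₁₂_pos (hκ₁ j) (hκ₂ j) (mul_ne_zero (mul_ne_zero (mul_ne_zero (hp₁ j) (hk₁ j))
        (mul_ne_zero (hp₂ j) (hk₂ j))) (hc j))
    have := log_le_of_not_lt (mul_pos (mul_pos hpos₁ hpos₂) hposW)
      (Finset.prod_pos fun j _ => ho j) hf.2.2
    rw [Real.log_mul (mul_pos hpos₁ hpos₂).ne' hposW.ne', Real.log_mul hpos₁.ne' hpos₂.ne',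
      log_blockSource hM₁ hp₁, log_blockSource hM₂ hp₂, hlogW,
      Real.log_prod fun j _ => (ho j).ne'] at this
    have := one_le_sq_div_of_sum_le hn hγ (l := Real.log (⌈(2 : ℝ) ^ ((n : ℝ) * R₁)⌉₊ : ℝ) +
        Real.log (⌈(2 : ℝ) ^ ((n : ℝ) * R₂)⌉₊ : ℝ)) (by linarith) hnγ hr
      (D := fun j => m.density₁₂ (κ₁ j) (κ₂ j) (u₁.2 j) (x₁ j) (u₂.2 j) (x₂ j) (y j))
      (by simp only [Model.density₁₂, Finset.sum_sub_distrib, Finset.sum_add_distrib]; linarith)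
    linarith

end Achievability

/-! ### Existence of good codes and the direct part. -/

section RandomCode

variable {S₁ S₂ X₁ X₂ Y : Type*} [Fintype S₁] [Fintype S₂] [Fintype X₁] [Fintype X₂] [Fintype Y]
  {m : Model S₁ S₂ X₁ X₂ Y}

theorem Model.letterExpect_one {κ₁ : S₁ → X₁ → ℝ} {κ₂ : S₂ → X₂ → ℝ}
    (hκ₁ : ∀ s, κ₁ s ∈ stdSimplex ℝ X₁) (hκ₂ : ∀ s, κ₂ s ∈ stdSimplex ℝ X₂) :
    m.letterExpect κ₁ κ₂ (fun _ _ _ _ _ => 1) = 1 := by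
  simp_rw [Model.letterExpect, mul_one, ← Finset.mul_sum, (m.channel_mem _ _ _ _).2, mul_one,
    ← Finset.mul_sum, (hκ₂ _).2, mul_one, m.host₂_mem.2, mul_one, ← Finset.mul_sum, (hκ₁ _).2,
    mul_one, m.host₁_mem.2]

theorem Factors.sum_eq_one {Q : Type*} [Fintype Q] {p : Letters Q S₁ S₂ X₁ X₂ Y → ℝ} {pQ : Q → ℝ}
    {κ₁ : S₁ → Q → X₁ → ℝ} {κ₂ : S₂ → Q → X₂ → ℝ} (h : Factors m pQ κ₁ κ₂ p) :
    ∑ ω, p ω = 1 := by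
  have := h.sum_mul fun _ => 1
  simp_rw [mul_one] at this
  rw [this]
  simp_rw [Model.letterExpect_one (fun s => h.κ₁_mem s _) (fun s => h.κ₂_mem s _), mul_one,
    h.pQ_mem.2]

/-- The centred sum of a single-letter function along a block. -/
theorem sum_prod_mul_sq_sub {L : Type*} [Fintype L] {p : L → ℝ} (hp : ∑ l, p l = 1) {ψ : L → ℝ}
    {μ : ℝ} (hψ : ∑ l, p l * ψ l = μ) (n : ℕ) :
    ∑ t : Fin n → L, (∏ j, p (t j)) * (∑ j, (ψ (t j) - μ)) ^ 2 =
      n * ∑ l, p l * (ψ l - μ) ^ 2 :=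
  sum_prod_mul_sq (ψ := fun l => ψ l - μ) hp
    (by simp_rw [mul_sub, Finset.sum_sub_distrib, hψ, ← Finset.sum_mul, hp]; ring) n

/-- This fills in the block lengths too short for the random coding estimate. The alphabets are
nonempty because a law on their product has mass one. -/
theorem Code.nonempty_of_factors {Q : Type*} [Fintype Q] {p : Letters Q S₁ S₂ X₁ X₂ Y → ℝ}
    {pQ : Q → ℝ} {κ₁ : S₁ → Q → X₁ → ℝ} {κ₂ : S₂ → Q → X₂ → ℝ} (h : Factors m pQ κ₁ κ₂ p)
    {M₁ M₂ : ℕ} (hM₁ : 0 < M₁) (hM₂ : 0 < M₂) (n : ℕ) :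
    Nonempty (Code S₁ S₂ X₁ X₂ Y M₁ M₂ n) := by
  have hL : Nonempty (Letters Q S₁ S₂ X₁ X₂ Y) := by
    by_contra hL
    rw [not_nonempty_iff] at hL
    simpa using h.sum_eq_one
  obtain ⟨ω⟩ := hL
  exact ⟨⟨fun _ _ _ => ω.x₁, fun _ _ _ => ω.x₂,
    fun _ => (⟨0, hM₁⟩, fun _ => ω.s₁, ⟨0, hM₂⟩, fun _ => ω.s₂)⟩⟩

/-- Error probability plus squared deviations of the distortions. -/
def Code.cost {M₁ M₂ n : ℕ} (m : Model S₁ S₂ X₁ X₂ Y) (c : Code S₁ S₂ X₁ X₂ Y M₁ M₂ n)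
    (D₁ D₂ : ℝ) : ℝ :=
  c.errorProb m + (c.distortion₁ m - D₁) ^ 2 + (c.distortion₂ m - D₂) ^ 2

theorem Code.errorProb_nonneg {M₁ M₂ n : ℕ} (m : Model S₁ S₂ X₁ X₂ Y)
    (c : Code S₁ S₂ X₁ X₂ Y M₁ M₂ n) : 0 ≤ c.errorProb m :=
  Finset.sum_nonneg fun _ _ => c.law_nonneg m _

-- Jensen's inequality moves the squares inside the expectation over the code, leaving an average
-- cost of the shape handled by `exists_codebooks`.
open Classical in
theorem Code.cost_le {M₁ M₂ n : ℕ} (hM₁ : 0 < M₁) (hM₂ : 0 < M₂) (hn : 0 < n)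
    (hS : m.IndepHosts) (c : Code S₁ S₂ X₁ X₂ Y M₁ M₂ n) (D₁ D₂ : ℝ) :
    c.cost m D₁ D₂ ≤ ∑ u₁ : Fin M₁ × (Fin n → S₁), ∑ u₂ : Fin M₂ × (Fin n → S₂),
      blockSource m.host₁ u₁ * blockSource m.host₂ u₂ *
        ∑ y, m.blockChannel u₁ (c.enc₁ u₁.1 u₁.2) u₂ (c.enc₂ u₂.1 u₂.2) y *
        ((if c.dec y ≠ (u₁.1, u₁.2, u₂.1, u₂.2) then 1 else 0) +
          ((∑ j, (m.d₁ (u₁.2 j) (c.enc₁ u₁.1 u₁.2 j) - D₁)) ^ 2 / n ^ 2 +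
          (∑ j, (m.d₂ (u₂.2 j) (c.enc₂ u₂.1 u₂.2 j) - D₂)) ^ 2 / n ^ 2)) := by
  have hn' : (n : ℝ) ≠ 0 := by positivity
  have e := c.sum_law_mul m hS fun ω => (if c.dec ω.y ≠ (ω.w₁, ω.s₁, ω.w₂, ω.s₂) then 1 else 0) +
          ((∑ j, (m.d₁ (ω.s₁ j) (c.enc₁ ω.w₁ ω.s₁ j) - D₁)) ^ 2 / n ^ 2 +
          (∑ j, (m.d₂ (ω.s₂ j) (c.enc₂ ω.w₂ ω.s₂ j) - D₂)) ^ 2 / n ^ 2)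
  rw [← e, Code.cost]
  have e1 : c.errorProb m =
      ∑ ω, c.law m ω * (if c.dec ω.y ≠ (ω.w₁, ω.s₁, ω.w₂, ω.s₂) then 1 else 0) := by
    simp_rw [mul_ite, mul_one, mul_zero, ← Finset.sum_filter]
    rfl
  have hc : ∀ (f : Fin n → ℝ) (D : ℝ), (1 / (n : ℝ) * ∑ j, f j - D) ^ 2 =
      (∑ j, (f j - D)) ^ 2 / n ^ 2 := by
    intro f D
    rw [Finset.sum_sub_distrib, ← div_pow]
    simp only [Finset.sum_const, Finset.card_univ, Fintype.card_fin, nsmul_eq_mul]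
    field_simp
  have e2 := sq_sum_mul_sub_le (c.law_nonneg m) (c.sum_law m hS hM₁ hM₂)
    (fun ω => (1 / (n : ℝ)) * ∑ j, m.d₁ (ω.s₁ j) (c.enc₁ ω.w₁ ω.s₁ j)) D₁
  have e3 := sq_sum_mul_sub_le (c.law_nonneg m) (c.sum_law m hS hM₁ hM₂)
    (fun ω => (1 / (n : ℝ)) * ∑ j, m.d₂ (ω.s₂ j) (c.enc₂ ω.w₂ ω.s₂ j)) D₂
  simp_rw [hc] at e2 e3
  simp_rw [mul_add, Finset.sum_add_distrib]
  rw [e1, ← add_assoc]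
  exact add_le_add (add_le_add le_rfl e2) e3

/-- Randomness is removed in two stages: a time-sharing sequence no worse than average is fixed,
then codebooks are fixed for it. The constant `C` comes from single-letter variances, and the
exponential term from false candidates at `θ = exp (n * γ)`. -/
theorem Factors.exists_code {Q : Type*} [Fintype Q] {p : Letters Q S₁ S₂ X₁ X₂ Y → ℝ}
    {pQ : Q → ℝ} {κ₁ : S₁ → Q → X₁ → ℝ} {κ₂ : S₂ → Q → X₂ → ℝ} (h : Factors m pQ κ₁ κ₂ p)
    (hS : m.IndepHosts) {R₁ R₂ γ : ℝ} (hR₁ : 0 ≤ R₁) (hR₂ : 0 ≤ R₂) (hγ : 0 < γ)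
    (h₁ : R₁ * Real.log 2 + 3 * γ ≤ bound₁ p * Real.log 2 ∨ R₁ = 0 ∧ ∃ s, m.host₁ s = 1)
    (h₂ : R₂ * Real.log 2 + 3 * γ ≤ bound₂ p * Real.log 2 ∨ R₂ = 0 ∧ ∃ s, m.host₂ s = 1)
    (h₁₂ : (R₁ + R₂) * Real.log 2 + 3 * γ ≤ bound₁₂ p * Real.log 2 ∨
      (R₁ = 0 ∧ ∃ s, m.host₁ s = 1) ∨ R₂ = 0 ∧ ∃ s, m.host₂ s = 1) :
    ∃ C : ℝ, ∀ n : ℕ, 0 < n → 2 * Real.log 2 ≤ n * γ →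
      ∃ c : Code S₁ S₂ X₁ X₂ Y ⌈(2 : ℝ) ^ ((n : ℝ) * R₁)⌉₊ ⌈(2 : ℝ) ^ ((n : ℝ) * R₂)⌉₊ n,
        c.cost m (m.tupleVec p 3) (m.tupleVec p 4) ≤ C / n + 3 / Real.exp (n * γ) := by
  classical
  have hlog : Real.log 2 ≠ 0 := (Real.log_pos one_lt_two).ne'
  set ψ₁ : Letters Q S₁ S₂ X₁ X₂ Y → ℝ := fun ω =>
    m.density₁ (fun s => κ₁ s ω.q) ω.s₁ ω.x₁ ω.s₂ ω.x₂ ω.y with hψ₁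
  set ψ₂ : Letters Q S₁ S₂ X₁ X₂ Y → ℝ := fun ω =>
    m.density₂ (fun s => κ₂ s ω.q) ω.s₁ ω.x₁ ω.s₂ ω.x₂ ω.y with hψ₂
  set ψ₁₂ : Letters Q S₁ S₂ X₁ X₂ Y → ℝ := fun ω =>
    m.density₁₂ (fun s => κ₁ s ω.q) (fun s => κ₂ s ω.q) ω.s₁ ω.x₁ ω.s₂ ω.x₂ ω.y with hψ₁₂
  set δ₁ : Letters Q S₁ S₂ X₁ X₂ Y → ℝ := fun ω => m.d₁ ω.s₁ ω.x₁ with hδ₁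
  set δ₂ : Letters Q S₁ S₂ X₁ X₂ Y → ℝ := fun ω => m.d₂ ω.s₂ ω.x₂ with hδ₂
  set μ₁ := bound₁ p * Real.log 2
  set μ₂ := bound₂ p * Real.log 2
  set μ₁₂ := bound₁₂ p * Real.log 2
  set D₁ := m.tupleVec p 3
  set D₂ := m.tupleVec p 4
  have m₁ : ∑ ω, p ω * ψ₁ ω = μ₁ := by
    rw [h.sum_mul]
    simp_rw [μ₁, h.bound₁_eq, Finset.sum_mul, mul_assoc, div_mul_cancel₀ _ hlog]
    rfl
  have m₂ : ∑ ω, p ω * ψ₂ ω = μ₂ := by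
    rw [h.sum_mul]
    simp_rw [μ₂, h.bound₂_eq, Finset.sum_mul, mul_assoc, div_mul_cancel₀ _ hlog]
    rfl
  have m₁₂ : ∑ ω, p ω * ψ₁₂ ω = μ₁₂ := by
    rw [h.sum_mul]
    simp_rw [μ₁₂, h.bound₁₂_eq, Finset.sum_mul, mul_assoc, div_mul_cancel₀ _ hlog]
    rfl
  have hp1 := h.sum_eq_one
  set v₁ := ∑ l, p l * (ψ₁ l - μ₁) ^ 2
  set v₂ := ∑ l, p l * (ψ₂ l - μ₂) ^ 2
  set v₁₂ := ∑ l, p l * (ψ₁₂ l - μ₁₂) ^ 2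
  set v₃ := ∑ l, p l * (δ₁ l - D₁) ^ 2
  set v₄ := ∑ l, p l * (δ₂ l - D₂) ^ 2
  refine ⟨(v₁ + v₂ + v₁₂) / γ ^ 2 + (v₃ + v₄), fun n hn hnγ => ?_⟩
  have hn' : (n : ℝ) ≠ 0 := by positivity
  -- `H` majorizes the indicator of a failing test plus the distortion cost. Being a sum of squares
  -- of centred i.i.d. sums, suitably normalized, it has mean of order `1 / n`.
  set H : (Fin n → Letters Q S₁ S₂ X₁ X₂ Y) → ℝ := fun t =>
    ((∑ j, (ψ₁ (t j) - μ₁)) ^ 2 / (n * γ) ^ 2 + (∑ j, (ψ₂ (t j) - μ₂)) ^ 2 / (n * γ) ^ 2 +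
      (∑ j, (ψ₁₂ (t j) - μ₁₂)) ^ 2 / (n * γ) ^ 2) +
      ((∑ j, (δ₁ (t j) - D₁)) ^ 2 / n ^ 2 + (∑ j, (δ₂ (t j) - D₂)) ^ 2 / n ^ 2) with hH
  have hHsum : ∑ t, (∏ j, p (t j)) * H t = ((v₁ + v₂ + v₁₂) / γ ^ 2 + (v₃ + v₄)) / n := by
    simp_rw [hH, mul_add, Finset.sum_add_distrib, ← mul_div_assoc, ← Finset.sum_div]
    rw [sum_prod_mul_sq_sub hp1 m₁, sum_prod_mul_sq_sub hp1 m₂, sum_prod_mul_sq_sub hp1 m₁₂,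
      sum_prod_mul_sq_sub (ψ := δ₁) (μ := D₁) hp1 rfl,
      sum_prod_mul_sq_sub (ψ := δ₂) (μ := D₂) hp1 rfl]
    field_simp
    rfl
  have hM₁ := ceil_two_rpow_pos n R₁
  have hM₂ := ceil_two_rpow_pos n R₂
  rw [← h.sum_block hM₁ hM₂] at hHsum
  obtain ⟨q, hq⟩ := exists_le_of_sum_mul_le
    (fun _ => Finset.prod_nonneg fun j _ => h.pQ_mem.1 _)
    (sum_prod_eq_one fun _ => h.pQ_mem.2) hHsum.le
  have hκ₁ : ∀ j s, κ₁ s (q j) ∈ stdSimplex ℝ X₁ := fun j s => h.κ₁_mem s (q j)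
  have hκ₂ : ∀ j s, κ₂ s (q j) ∈ stdSimplex ℝ X₂ := fun j s => h.κ₂_mem s (q j)
  have hP₁ := blockSource_mem (n := n) hM₁ m.host₁_mem
  have hP₂ := blockSource_mem (n := n) hM₂ m.host₂_mem
  obtain ⟨f₁, f₂, dec, hf⟩ := exists_codebooks hP₁ hP₂
    (k₁ := blockKernel fun j s => κ₁ s (q j)) (k₂ := blockKernel fun j s => κ₂ s (q j))
    (blockKernel_mem hκ₁) (blockKernel_mem hκ₂) (W := m.blockChannel) (m.blockChannel_mem)
    (m.prod_out₁ hM₁ fun j s => κ₁ s (q j)) (m.prod_out₂ hM₂ fun j s => κ₂ s (q j))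
    (m.prod_out₁₂ hM₁ hM₂ (fun j s => κ₁ s (q j)) fun j s => κ₂ s (q j))
    (Real.exp_pos (n * γ)) (fun u₁ x₁ u₂ x₂ => (∑ j, (m.d₁ (u₁.2 j) (x₁ j) - D₁)) ^ 2 / n ^ 2 +
      (∑ j, (m.d₂ (u₂.2 j) (x₂ j) - D₂)) ^ 2 / n ^ 2)
  refine ⟨⟨fun w s => f₁ (w, s), fun w s => f₂ (w, s),
    fun y => ((dec y).1.1, (dec y).1.2, (dec y).2.1, (dec y).2.2)⟩, ?_⟩
  refine (Code.cost_le hM₁ hM₂ hn hS _ _ _).trans ?_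
  have hdec : ∀ (y : Fin n → Y) (u₁ : Fin ⌈(2 : ℝ) ^ ((n : ℝ) * R₁)⌉₊ × (Fin n → S₁))
      (u₂ : Fin ⌈(2 : ℝ) ^ ((n : ℝ) * R₂)⌉₊ × (Fin n → S₂)),
      ((dec y).1.1, (dec y).1.2, (dec y).2.1, (dec y).2.2) ≠ (u₁.1, u₁.2, u₂.1, u₂.2) ↔
      dec y ≠ (u₁, u₂) := by
    intro y u₁ u₂
    simp only [ne_eq, Prod.ext_iff, and_assoc]
  refine le_trans (le_of_eq ?_) (hf.trans (add_le_add (le_trans ?_ hq) le_rfl))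
  · refine Finset.sum_congr rfl fun u₁ _ => Finset.sum_congr rfl fun u₂ _ => ?_
    congr 1
    refine Finset.sum_congr rfl fun y _ => ?_
    congr 2
    by_cases hd : dec y ≠ (u₁, u₂)
    · rw [if_pos hd, if_pos ((hdec y u₁ u₂).2 hd)]
    · rw [if_neg hd, if_neg (mt (hdec y u₁ u₂).1 hd)]
  refine Finset.sum_le_sum fun u₁ _ => Finset.sum_le_sum fun x₁ _ => ?_
  -- Terms of weight zero are discarded first, because the comparison of a failing test with the
  -- densities is valid only on the support.
  by_cases hx₁ : blockKernel (fun j s => κ₁ s (q j)) u₁ x₁ = 0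
  · simp [hx₁]
  refine mul_le_mul_of_nonneg_left (Finset.sum_le_sum fun u₂ _ => Finset.sum_le_sum fun x₂ _ => ?_)
    ((blockKernel_mem hκ₁ u₁).1 x₁)
  by_cases hx₂ : blockKernel (fun j s => κ₂ s (q j)) u₂ x₂ = 0
  · simp [hx₂]
  refine mul_le_mul_of_nonneg_left ?_ ((blockKernel_mem hκ₂ u₂).1 x₂)
  by_cases hu : blockSource m.host₁ u₁ * blockSource m.host₂ u₂ = 0
  · simp [hu]
  refine mul_le_mul_of_nonneg_left (Finset.sum_le_sum fun y _ => ?_)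
    (mul_nonneg (hP₁.1 u₁) (hP₂.1 u₂))
  by_cases hy : m.blockChannel u₁ x₁ u₂ x₂ y = 0
  · simp [hy]
  refine mul_le_mul_of_nonneg_left (add_le_add ?_ le_rfl) ((m.blockChannel_mem u₁ x₁ u₂ x₂).1 y)
  exact ite_not_passesTests_le hn hR₁ hR₂ hγ hnγ h₁ h₂ h₁₂ hκ₁ hκ₂ u₁ x₁ u₂ x₂ y
    (left_ne_zero_of_mul hu) (right_ne_zero_of_mul hu) hx₁ hx₂ hy

/-- Direct part of the coding theorem. -/
theorem Factors.achievable {Q : Type*} [Fintype Q] {p : Letters Q S₁ S₂ X₁ X₂ Y → ℝ}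
    {pQ : Q → ℝ} {κ₁ : S₁ → Q → X₁ → ℝ} {κ₂ : S₂ → Q → X₂ → ℝ} (h : Factors m pQ κ₁ κ₂ p)
    (hS : m.IndepHosts) {Δ₁ Δ₂ : ℝ} (hΔ₁ : m.tupleVec p 3 ≤ Δ₁) (hΔ₂ : m.tupleVec p 4 ≤ Δ₂)
    {R : ℝ × ℝ} (hR₁ : 0 ≤ R.1) (hR₂ : 0 ≤ R.2)
    (h₁ : R.1 < bound₁ p ∨ R.1 = 0 ∧ ∃ s, m.host₁ s = 1)
    (h₂ : R.2 < bound₂ p ∨ R.2 = 0 ∧ ∃ s, m.host₂ s = 1)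
    (h₁₂ : R.1 + R.2 < bound₁₂ p ∨ (R.1 = 0 ∧ ∃ s, m.host₁ s = 1) ∨
      R.2 = 0 ∧ ∃ s, m.host₂ s = 1) : Achievable m Δ₁ Δ₂ R := by
  have hlog : 0 < Real.log 2 := Real.log_pos one_lt_two
  -- Each condition tolerates every smaller `γ`, so the minimum of the three slacks serves all
  -- conditions at once.
  have slack : ∀ {r b : ℝ} {P : Prop}, (r < b ∨ P) →
      ∃ γ > 0, ∀ γ' ≤ γ, r * Real.log 2 + 3 * γ' ≤ b * Real.log 2 ∨ P := by
    intro r b P hP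
    rcases hP with hlt | hP
    · refine ⟨(b - r) * Real.log 2 / 3, by have := sub_pos.2 hlt; positivity, fun γ' hγ' => ?_⟩
      left; linarith
    · exact ⟨1, one_pos, fun _ _ => Or.inr hP⟩
  obtain ⟨γ₁, hγ₁, s₁⟩ := slack h₁
  obtain ⟨γ₂, hγ₂, s₂⟩ := slack h₂
  obtain ⟨γ₃, hγ₃, s₃⟩ := slack h₁₂
  set γ := min γ₁ (min γ₂ γ₃)
  have hγ : 0 < γ := lt_min hγ₁ (lt_min hγ₂ hγ₃)
  obtain ⟨C, hC⟩ := h.exists_code hS hR₁ hR₂ hγ (s₁ γ (min_le_left _ _))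
    (s₂ γ ((min_le_right _ _).trans (min_le_left _ _)))
    (s₃ γ ((min_le_right _ _).trans (min_le_right _ _)))
  have hex : ∀ n : ℕ, ∃ c : Code S₁ S₂ X₁ X₂ Y ⌈(2 : ℝ) ^ ((n : ℝ) * R.1)⌉₊
      ⌈(2 : ℝ) ^ ((n : ℝ) * R.2)⌉₊ n, 0 < n → 2 * Real.log 2 ≤ n * γ →
        c.cost m (m.tupleVec p 3) (m.tupleVec p 4) ≤ C / n + 3 / Real.exp (n * γ) := by
    intro n
    by_cases hn : 0 < n ∧ 2 * Real.log 2 ≤ n * γ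
    · obtain ⟨c, hc⟩ := hC n hn.1 hn.2
      exact ⟨c, fun _ _ => hc⟩
    · obtain ⟨c⟩ := Code.nonempty_of_factors h (ceil_two_rpow_pos n R.1)
        (ceil_two_rpow_pos n R.2) n
      exact ⟨c, fun a b => absurd ⟨a, b⟩ hn⟩
  choose c hc using hex
  have hnγ : Tendsto (fun n : ℕ => (n : ℝ) * γ) atTop atTop :=
    tendsto_natCast_atTop_atTop.atTop_mul_const hγ
  have hbound : Tendsto (fun n : ℕ => C / n + 3 / Real.exp (n * γ)) atTop (𝓝 0) := by
    rw [← add_zero (0 : ℝ)]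
    exact (tendsto_const_div_atTop_nhds_zero_nat C).add
      ((Real.tendsto_exp_atTop.comp hnγ).const_div_atTop 3)
  have hev : ∀ᶠ n : ℕ in atTop, (c n).cost m (m.tupleVec p 3) (m.tupleVec p 4) ≤
      C / n + 3 / Real.exp (n * γ) := by
    filter_upwards [eventually_gt_atTop 0, hnγ.eventually_ge_atTop (2 * Real.log 2)] with n h1 h2
    exact hc n h1 h2
  have hsq : ∀ {f : ℕ → ℝ} {D : ℝ}, Tendsto (fun n => (f n - D) ^ 2) atTop (𝓝 0) →
      Tendsto f atTop (𝓝 D) := by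
    intro f D hf
    have h1 := hf.sqrt
    simp_rw [Real.sqrt_sq_eq_abs, Real.sqrt_zero] at h1
    have h2 := ((tendsto_zero_iff_abs_tendsto_zero _).2 h1).add_const D
    simpa using h2
  -- The distortions converge to those of the tuple, so their limits exist as the definition
  -- demands.
  refine ⟨hR₁, hR₂, c, ⟨_, hΔ₁, hsq ?_⟩, ⟨_, hΔ₂, hsq ?_⟩, ?_⟩
  all_goals
    refine squeeze_zero' (Eventually.of_forall fun n => ?_) (hev.mono fun n hn => le_trans ?_ hn)
      hbound
  · positivity
  · have := (c n).errorProb_nonneg m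
    rw [Code.cost]
    nlinarith [sq_nonneg ((c n).distortion₂ m - m.tupleVec p 4)]
  · positivity
  · have := (c n).errorProb_nonneg m
    rw [Code.cost]
    nlinarith [sq_nonneg ((c n).distortion₁ m - m.tupleVec p 3)]
  · exact (c n).errorProb_nonneg m
  · rw [Code.cost]
    nlinarith [sq_nonneg ((c n).distortion₁ m - m.tupleVec p 3),
      sq_nonneg ((c n).distortion₂ m - m.tupleVec p 4)]

end RandomCode

/-! ### Guesses, letter kernels and single-letter laws of a code. -/

section Converse

open Classical in
/-- A guess `d` of a random variable, turned into a probability mass function. -/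
def guess {U : Type*} [Fintype U] (d u : U) : ℝ :=
  (if u = d then 1 / 2 else 0) + 1 / (2 * Fintype.card U)

theorem guess_pos {U : Type*} [Fintype U] (d u : U) : 0 < guess d u := by
  have : 0 < Fintype.card U := Fintype.card_pos_iff.2 ⟨d⟩
  rw [guess]
  split_ifs <;> positivity

theorem sum_guess {U : Type*} [Fintype U] (d : U) : ∑ u, guess d u = 1 := by
  classical
  have : 0 < Fintype.card U := Fintype.card_pos_iff.2 ⟨d⟩
  simp only [guess, Finset.sum_add_distrib, Finset.sum_ite_eq', Finset.mem_univ, if_true,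
    Finset.sum_const, Finset.card_univ, nsmul_eq_mul]
  field_simp
  norm_num

-- A pointwise Fano inequality: the point mass of one half at `d` makes a correct guess cost one
-- bit, and the uniform half limits the cost of a wrong one to the logarithm of twice the
-- cardinality.
open Classical in
theorem neg_log_guess_le {U : Type*} [Fintype U] (d u : U) :
    -Real.log (guess d u) ≤
      Real.log 2 + (if d ≠ u then 1 else 0) * Real.log (Fintype.card U) := by
  have hc : (0 : ℝ) < Fintype.card U := by exact_mod_cast Fintype.card_pos_iff.2 ⟨d⟩
  by_cases h : u = d
  · have : (1 : ℝ) / 2 ≤ guess d u := by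
      rw [guess, if_pos h]
      have : (0 : ℝ) < 1 / (2 * Fintype.card U) := by positivity
      linarith
    have := Real.log_le_log (by norm_num) this
    rw [one_div, Real.log_inv] at this
    rw [if_neg (not_not.2 h.symm), zero_mul]
    linarith
  · rw [guess, if_neg h, if_pos (Ne.symm h), zero_add, one_div, Real.log_inv,
      Real.log_mul two_ne_zero hc.ne']
    linarith

/-- The conditional law of a coordinate of the encoded block given the same coordinate of the
host. -/
theorem exists_kernel {S X : Type*} [Fintype S] [Fintype X] {M n : ℕ} (hM : 0 < M) {p : S → ℝ}
    (hp : p ∈ stdSimplex ℝ S) (e : Fin M × (Fin n → S) → X) (j : Fin n) :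
    ∃ κ : S → X → ℝ, (∀ s, κ s ∈ stdSimplex ℝ X) ∧
      (∀ g : S → X → ℝ, ∑ u, blockSource p u * g (u.2 j) (e u) = ∑ s, ∑ x, p s * κ s x * g s x) ∧
      ∀ u, blockSource p u ≠ 0 → κ (u.2 j) (e u) ≠ 0 := by
  classical
  -- The joint law of the host letter and the encoded letter; its first marginal is `p`.
  set r : S → X → ℝ := fun s x => ∑ u : Fin M × (Fin n → S),
    if u.2 j = s ∧ e u = x then blockSource p u else 0 with hr
  have hB := blockSource_mem (n := n) hM hp
  have hr0 : ∀ s x, 0 ≤ r s x := fun s x =>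
    Finset.sum_nonneg fun u _ => by split_ifs; exacts [hB.1 u, le_rfl]
  have hrsum : ∀ s, ∑ x, r s x = p s := by
    intro s
    have h1 := sum_blockSource_mul (n := n) hM p fun t => if t j = s then (1 : ℝ) else 0
    rw [sum_prod_mul_apply (w := fun _ => p) (fun _ => hp.2) j
      (fun a => if a = s then (1 : ℝ) else 0)] at h1
    simp only [mul_ite, mul_one, mul_zero, Finset.sum_ite_eq', Finset.mem_univ, if_true] at h1
    rw [← h1, hr, Finset.sum_comm]
    refine Finset.sum_congr rfl fun u _ => ?_
    simp [ite_and]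
  have hx₀ : Nonempty X := by
    by_contra hX
    rw [not_nonempty_iff] at hX
    have : ∀ s, p s = 0 := fun s => by rw [← hrsum s]; simp
    simpa [this] using hp.2
  obtain ⟨x₀⟩ := hx₀
  -- At host letters of probability zero the kernel is an arbitrary point mass.
  set κ : S → X → ℝ := fun s x => if p s = 0 then (if x = x₀ then 1 else 0) else r s x / p s with hκ
  have hpr : ∀ s x, p s * κ s x = r s x := by
    intro s x
    by_cases h : p s = 0
    · have h2 := (Finset.sum_eq_zero_iff_of_nonneg fun x _ => hr0 s x).1 ((hrsum s).trans h)
      rw [h, zero_mul, h2 x (Finset.mem_univ x)]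
    · simp only [hκ, if_neg h]
      field_simp
  refine ⟨κ, fun s => ⟨fun x => ?_, ?_⟩, fun g => ?_, fun u hu => ?_⟩
  · simp only [hκ]
    split_ifs
    exacts [zero_le_one, le_rfl, div_nonneg (hr0 _ _) (hp.1 _)]
  · by_cases h : p s = 0
    · simp [hκ, h]
    · simp only [hκ, if_neg h]
      rw [← Finset.sum_div, hrsum, div_self h]
  · simp_rw [hpr, hr, Finset.sum_mul]
    symm
    calc _ = ∑ u, ∑ s, ∑ x, (if u.2 j = s ∧ e u = x then blockSource p u else 0) * g s x := by
          rw [Finset.sum_comm (s := (Finset.univ : Finset (Fin M × (Fin n → S))))]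
          exact Finset.sum_congr rfl fun s _ => Finset.sum_comm
      _ = _ := by
          refine Finset.sum_congr rfl fun u _ => ?_
          simp [ite_and]
  · intro h0
    have h1 := hpr (u.2 j) (e u)
    rw [h0, mul_zero, hr] at h1
    have h2 := (Finset.sum_eq_zero_iff_of_nonneg fun v _ => by
      split_ifs; exacts [hB.1 v, le_rfl]).1 h1.symm u (Finset.mem_univ u)
    simp at h2
    exact hu h2

variable {S₁ S₂ X₁ X₂ Y : Type*} [Fintype S₁] [Fintype S₂] [Fintype X₁] [Fintype X₂] [Fintype Y]
  {m : Model S₁ S₂ X₁ X₂ Y} {M₁ M₂ n : ℕ}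

theorem Model.out₁_mem {κ₁ : S₁ → X₁ → ℝ} (hκ₁ : ∀ s, κ₁ s ∈ stdSimplex ℝ X₁) (s₂ : S₂) (x₂ : X₂) :
    m.out₁ κ₁ s₂ x₂ ∈ stdSimplex ℝ Y := by
  refine ⟨fun y => Model.out₁_nonneg hκ₁ s₂ x₂ y, ?_⟩
  simp_rw [Model.out₁]
  rw [Finset.sum_comm]
  calc _ = ∑ s₁, ∑ x₁, ∑ y, m.host₁ s₁ * κ₁ s₁ x₁ * m.channel x₁ s₁ x₂ s₂ y :=
        Finset.sum_congr rfl fun _ _ => Finset.sum_comm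
    _ = 1 := by
        simp_rw [← Finset.mul_sum, (m.channel_mem _ _ _ _).2, mul_one, ← Finset.mul_sum, (hκ₁ _).2,
          mul_one, m.host₁_mem.2]

theorem Model.out₂_mem {κ₂ : S₂ → X₂ → ℝ} (hκ₂ : ∀ s, κ₂ s ∈ stdSimplex ℝ X₂) (s₁ : S₁) (x₁ : X₁) :
    m.out₂ κ₂ s₁ x₁ ∈ stdSimplex ℝ Y := by
  refine ⟨fun y => Model.out₂_nonneg hκ₂ s₁ x₁ y, ?_⟩
  simp_rw [Model.out₂]
  rw [Finset.sum_comm]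
  calc _ = ∑ s₂, ∑ x₂, ∑ y, m.host₂ s₂ * κ₂ s₂ x₂ * m.channel x₁ s₁ x₂ s₂ y :=
        Finset.sum_congr rfl fun _ _ => Finset.sum_comm
    _ = 1 := by
        simp_rw [← Finset.mul_sum, (m.channel_mem _ _ _ _).2, mul_one, ← Finset.mul_sum, (hκ₂ _).2,
          mul_one, m.host₂_mem.2]

theorem Model.out₁₂_mem {κ₁ : S₁ → X₁ → ℝ} {κ₂ : S₂ → X₂ → ℝ}
    (hκ₁ : ∀ s, κ₁ s ∈ stdSimplex ℝ X₁) (hκ₂ : ∀ s, κ₂ s ∈ stdSimplex ℝ X₂) :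
    m.out₁₂ κ₁ κ₂ ∈ stdSimplex ℝ Y := by
  refine ⟨fun y => Model.out₁₂_nonneg hκ₁ hκ₂ y, ?_⟩
  have h : ∀ y, m.out₁₂ κ₁ κ₂ y = ∑ s₁, ∑ x₁, m.host₁ s₁ * κ₁ s₁ x₁ * m.out₂ κ₂ s₁ x₁ y := by
    intro y
    simp_rw [Model.out₁₂, Model.out₂, Finset.mul_sum, mul_assoc]
  simp_rw [h]
  rw [Finset.sum_comm]
  calc _ = ∑ s₁, ∑ x₁, ∑ y, m.host₁ s₁ * κ₁ s₁ x₁ * m.out₂ κ₂ s₁ x₁ y :=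
        Finset.sum_congr rfl fun _ _ => Finset.sum_comm
    _ = 1 := by
        simp_rw [← Finset.mul_sum, (Model.out₂_mem hκ₂ _ _).2, mul_one, ← Finset.mul_sum, (hκ₁ _).2,
          mul_one, m.host₁_mem.2]

/-- The joint law of both (message, host block) pairs and the output block. -/
def Code.joint (m : Model S₁ S₂ X₁ X₂ Y) (c : Code S₁ S₂ X₁ X₂ Y M₁ M₂ n)
    (ω : (Fin M₁ × (Fin n → S₁)) × (Fin M₂ × (Fin n → S₂)) × (Fin n → Y)) : ℝ :=
  blockSource m.host₁ ω.1 * blockSource m.host₂ ω.2.1 *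
    m.blockChannel ω.1 (c.enc₁ ω.1.1 ω.1.2) ω.2.1 (c.enc₂ ω.2.1.1 ω.2.1.2) ω.2.2

theorem Code.sum_joint_mul (hS : m.IndepHosts) (c : Code S₁ S₂ X₁ X₂ Y M₁ M₂ n)
    (g : Outcome S₁ S₂ Y M₁ M₂ n → ℝ) : ∑ ω, c.law m ω * g ω =
      ∑ ω, c.joint m ω * g ⟨ω.1.1, ω.2.1.1, ω.1.2, ω.2.1.2, ω.2.2⟩ := by
  rw [c.sum_law_mul m hS]
  refine Eq.trans ?_ (Fintype.sum_prod_type _).symm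
  refine Finset.sum_congr rfl fun u₁ _ => ?_
  refine Eq.trans ?_ (Fintype.sum_prod_type _).symm
  refine Finset.sum_congr rfl fun u₂ _ => ?_
  rw [Finset.mul_sum]
  exact Finset.sum_congr rfl fun y _ => (mul_assoc _ _ _).symm

theorem Code.joint_nonneg (hM₁ : 0 < M₁) (hM₂ : 0 < M₂) (c : Code S₁ S₂ X₁ X₂ Y M₁ M₂ n)
    (ω : (Fin M₁ × (Fin n → S₁)) × (Fin M₂ × (Fin n → S₂)) × (Fin n → Y)) : 0 ≤ c.joint m ω :=
  mul_nonneg (mul_nonneg ((blockSource_mem hM₁ m.host₁_mem).1 _)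
    ((blockSource_mem hM₂ m.host₂_mem).1 _)) ((m.blockChannel_mem _ _ _ _).1 _)

theorem Code.sum_joint (hS : m.IndepHosts) (hM₁ : 0 < M₁) (hM₂ : 0 < M₂)
    (c : Code S₁ S₂ X₁ X₂ Y M₁ M₂ n) : ∑ ω, c.joint m ω = 1 := by
  have h := c.sum_joint_mul hS fun _ => 1
  simp only [mul_one] at h
  rw [← h, c.sum_law m hS hM₁ hM₂]

/-- Since the two sources are independent and each encoder sees only its own, the `j`-th letters of
the two users are independent. The memoryless channel then integrates out all other outputs, which
leaves a single-letter law of product form. -/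
theorem Code.sum_joint_letter (c : Code S₁ S₂ X₁ X₂ Y M₁ M₂ n) (j : Fin n)
    {κ₁ : S₁ → X₁ → ℝ} {κ₂ : S₂ → X₂ → ℝ}
    (h₁ : ∀ g : S₁ → X₁ → ℝ, ∑ u : Fin M₁ × (Fin n → S₁),
      blockSource m.host₁ u * g (u.2 j) (c.enc₁ u.1 u.2 j) = ∑ s, ∑ x, m.host₁ s * κ₁ s x * g s x)
    (h₂ : ∀ g : S₂ → X₂ → ℝ, ∑ u : Fin M₂ × (Fin n → S₂),
      blockSource m.host₂ u * g (u.2 j) (c.enc₂ u.1 u.2 j) = ∑ s, ∑ x, m.host₂ s * κ₂ s x * g s x)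
    (g : S₁ → X₁ → S₂ → X₂ → Y → ℝ) :
    ∑ ω, c.joint m ω * g (ω.1.2 j) (c.enc₁ ω.1.1 ω.1.2 j) (ω.2.1.2 j) (c.enc₂ ω.2.1.1 ω.2.1.2 j)
      (ω.2.2 j) = m.letterExpect κ₁ κ₂ g := by
  have hy : ∀ (u₁ : Fin M₁ × (Fin n → S₁)) (u₂ : Fin M₂ × (Fin n → S₂)),
      ∑ y, m.blockChannel u₁ (c.enc₁ u₁.1 u₁.2) u₂ (c.enc₂ u₂.1 u₂.2) y *
        g (u₁.2 j) (c.enc₁ u₁.1 u₁.2 j) (u₂.2 j) (c.enc₂ u₂.1 u₂.2 j) (y j) =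
      ∑ y, m.channel (c.enc₁ u₁.1 u₁.2 j) (u₁.2 j) (c.enc₂ u₂.1 u₂.2 j) (u₂.2 j) y *
        g (u₁.2 j) (c.enc₁ u₁.1 u₁.2 j) (u₂.2 j) (c.enc₂ u₂.1 u₂.2 j) y := fun u₁ u₂ =>
    sum_prod_mul_apply (w := fun i => m.channel (c.enc₁ u₁.1 u₁.2 i) (u₁.2 i)
      (c.enc₂ u₂.1 u₂.2 i) (u₂.2 i)) (fun _ => (m.channel_mem _ _ _ _).2) j _
  calc _ = ∑ u₁ : Fin M₁ × (Fin n → S₁), blockSource m.host₁ u₁ *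
        ∑ u₂ : Fin M₂ × (Fin n → S₂), blockSource m.host₂ u₂ *
          ∑ y, m.channel (c.enc₁ u₁.1 u₁.2 j) (u₁.2 j) (c.enc₂ u₂.1 u₂.2 j) (u₂.2 j) y *
          g (u₁.2 j) (c.enc₁ u₁.1 u₁.2 j) (u₂.2 j) (c.enc₂ u₂.1 u₂.2 j) y := by
        simp_rw [← hy]
        rw [Fintype.sum_prod_type]
        refine Finset.sum_congr rfl fun u₁ _ => ?_
        rw [Fintype.sum_prod_type, Finset.mul_sum]
        refine Finset.sum_congr rfl fun u₂ _ => ?_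
        rw [← mul_assoc, Finset.mul_sum]
        exact Finset.sum_congr rfl fun y _ => mul_assoc _ _ _
    _ = _ := by
        simp_rw [fun s₁ x₁ => h₂ fun s₂ x₂ => ∑ y, m.channel x₁ s₁ x₂ s₂ y * g s₁ x₁ s₂ x₂ y]
        rw [h₁ fun s₁ x₁ => ∑ s₂, ∑ x₂, m.host₂ s₂ * κ₂ s₂ x₂ *
          ∑ y, m.channel x₁ s₁ x₂ s₂ y * g s₁ x₁ s₂ x₂ y]
        simp_rw [Model.letterExpect, Finset.mul_sum, mul_assoc]

end Converse

/-! ### The converse for a single code. -/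

section ConverseBounds

/-- Nonnegativity of the divergence of `P` from `q`, with a pointwise bound on the log-likelihood
ratio inserted. Here `a` will be the logarithm of the number of messages, `F j` a letter density and
`ε` the error indicator. -/
theorem le_of_log_sub_log_le {Ω : Type*} [Fintype Ω] {n : ℕ} {P q ε : Ω → ℝ} (hP : ∀ ω, 0 ≤ P ω)
    (hP1 : ∑ ω, P ω = 1) (hq : ∀ ω, 0 ≤ q ω) (hq1 : ∑ ω, q ω = 1)
    (hPq : ∀ ω, P ω ≠ 0 → q ω ≠ 0) {F : Fin n → Ω → ℝ} {a N : ℝ}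
    (h : ∀ ω, P ω ≠ 0 → Real.log (P ω) - Real.log (q ω) ≤
      -a + ∑ j, F j ω + (Real.log 2 + ε ω * N)) :
    a ≤ ∑ j, ∑ ω, P ω * F j ω + (Real.log 2 + (∑ ω, P ω * ε ω) * N) := by
  have h0 := sum_mul_log_sub_log_nonneg hP hP1 hq hq1.le
    fun ω hω => (hq ω).lt_of_ne' (hPq ω hω.ne')
  have h1 : ∑ ω, P ω * (Real.log (P ω) - Real.log (q ω)) ≤
      ∑ ω, P ω * (-a + ∑ j, F j ω + (Real.log 2 + ε ω * N)) := by
    refine Finset.sum_le_sum fun ω _ => ?_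
    by_cases hω : P ω = 0
    · simp [hω]
    · exact mul_le_mul_of_nonneg_left (h ω hω) (hP ω)
  have h2 : ∑ ω, P ω * (-a + ∑ j, F j ω + (Real.log 2 + ε ω * N)) =
      -a + ∑ j, ∑ ω, P ω * F j ω + (Real.log 2 + (∑ ω, P ω * ε ω) * N) := by
    simp_rw [mul_add, Finset.sum_add_distrib, ← Finset.sum_mul, hP1, Finset.mul_sum, ← mul_assoc,
      ← Finset.sum_mul, one_mul]
    rw [Finset.sum_comm]
  linarith

variable {S₁ S₂ X₁ X₂ Y : Type*} [Fintype S₁] [Fintype S₂] [Fintype X₁] [Fintype X₂] [Fintype Y]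
  {m : Model S₁ S₂ X₁ X₂ Y} {M₁ M₂ n : ℕ}

/-- A uniformly chosen position in the block acts as the time-sharing variable. -/
theorem Model.sum_rateVec_mem {κ₁ : Fin n → S₁ → X₁ → ℝ} {κ₂ : Fin n → S₂ → X₂ → ℝ}
    (hn : 0 < n) (hκ₁ : ∀ j s, κ₁ j s ∈ stdSimplex ℝ X₁) (hκ₂ : ∀ j s, κ₂ j s ∈ stdSimplex ℝ X₂) :
    ∑ j, (1 / (n : ℝ)) • m.rateVec (κ₁ j, κ₂ j) ∈ m.rateRegion := by
  refine mem_convexHull_of_exists_fintype (fun _ => 1 / (n : ℝ)) (fun j => m.rateVec (κ₁ j, κ₂ j))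
    (fun _ => by positivity) ?_ (fun j => Set.mem_image_of_mem _
      ⟨fun s _ => hκ₁ j s, fun s _ => hκ₂ j s⟩) rfl
  have : (n : ℝ) ≠ 0 := by positivity
  simp [this]

theorem card_pos_of_mem_stdSimplex {U : Type*} [Fintype U] {p : U → ℝ} (hp : p ∈ stdSimplex ℝ U) :
    0 < Fintype.card U := by
  rw [Fintype.card_pos_iff]
  by_contra hne
  rw [not_nonempty_iff] at hne
  simpa using hp.2

/-- The error of one component is replaced by that of the whole decoder, so that one error term
serves all three bounds. -/
theorem neg_log_guess_le_of {U : Type*} [Fintype U] {d u : U} {ε N : ℝ} (hε0 : 0 ≤ ε)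
    (hε : d ≠ u → 1 ≤ ε) (hN : Real.log (Fintype.card U) ≤ N) :
    -Real.log (guess d u) ≤ Real.log 2 + ε * N := by
  have hc : 1 ≤ Fintype.card U := Fintype.card_pos_iff.2 ⟨d⟩
  have h0 : 0 ≤ Real.log (Fintype.card U) := Real.log_nonneg (by exact_mod_cast hc)
  refine (neg_log_guess_le d u).trans (add_le_add le_rfl ?_)
  split_ifs with h
  · exact mul_le_mul (hε h) hN h0 hε0
  · rw [zero_mul]
    exact mul_nonneg hε0 (h0.trans hN)

open Classical in
/-- The indicator of a decoding error. -/
def Code.errorInd (c : Code S₁ S₂ X₁ X₂ Y M₁ M₂ n)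
    (ω : (Fin M₁ × (Fin n → S₁)) × (Fin M₂ × (Fin n → S₂)) × (Fin n → Y)) : ℝ :=
  if c.dec ω.2.2 ≠ (ω.1.1, ω.1.2, ω.2.1.1, ω.2.1.2) then 1 else 0

theorem Code.errorInd_nonneg (c : Code S₁ S₂ X₁ X₂ Y M₁ M₂ n)
    (ω : (Fin M₁ × (Fin n → S₁)) × (Fin M₂ × (Fin n → S₂)) × (Fin n → Y)) : 0 ≤ c.errorInd ω := by
  rw [Code.errorInd]; split_ifs <;> norm_num

theorem Code.one_le_errorInd (c : Code S₁ S₂ X₁ X₂ Y M₁ M₂ n)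
    {ω : (Fin M₁ × (Fin n → S₁)) × (Fin M₂ × (Fin n → S₂)) × (Fin n → Y)}
    (h : c.dec ω.2.2 ≠ (ω.1.1, ω.1.2, ω.2.1.1, ω.2.1.2)) : 1 ≤ c.errorInd ω := by
  rw [Code.errorInd, if_pos h]

theorem Code.sum_joint_mul_errorInd (hS : m.IndepHosts) (c : Code S₁ S₂ X₁ X₂ Y M₁ M₂ n) :
    ∑ ω, c.joint m ω * c.errorInd ω = c.errorProb m := by
  classical
  have h := c.sum_joint_mul hS fun ω =>
    if c.dec ω.y ≠ (ω.w₁, ω.s₁, ω.w₂, ω.s₂) then (1 : ℝ) else 0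
  simp_rw [Code.errorProb, Finset.sum_filter]
  refine Eq.trans ?_ (h.symm.trans ?_)
  · exact Finset.sum_congr rfl fun ω _ => by rw [Code.errorInd]
  · exact Finset.sum_congr rfl fun ω _ => by rw [mul_ite, mul_one, mul_zero]

/-- `κ₁ j`, `κ₂ j` are the conditional laws of the `j`-th embedded letters given the hosts. -/
structure Code.LetterKernels (m : Model S₁ S₂ X₁ X₂ Y) (c : Code S₁ S₂ X₁ X₂ Y M₁ M₂ n)
    (κ₁ : Fin n → S₁ → X₁ → ℝ) (κ₂ : Fin n → S₂ → X₂ → ℝ) : Prop where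
  mem₁ : ∀ j s, κ₁ j s ∈ stdSimplex ℝ X₁
  mem₂ : ∀ j s, κ₂ j s ∈ stdSimplex ℝ X₂
  sum₁ : ∀ j (g : S₁ → X₁ → ℝ), ∑ u : Fin M₁ × (Fin n → S₁), blockSource m.host₁ u *
    g (u.2 j) (c.enc₁ u.1 u.2 j) = ∑ s, ∑ x, m.host₁ s * κ₁ j s x * g s x
  sum₂ : ∀ j (g : S₂ → X₂ → ℝ), ∑ u : Fin M₂ × (Fin n → S₂), blockSource m.host₂ u *
    g (u.2 j) (c.enc₂ u.1 u.2 j) = ∑ s, ∑ x, m.host₂ s * κ₂ j s x * g s x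
  ne_zero₁ : ∀ j (u : Fin M₁ × (Fin n → S₁)), blockSource m.host₁ u ≠ 0 →
    κ₁ j (u.2 j) (c.enc₁ u.1 u.2 j) ≠ 0
  ne_zero₂ : ∀ j (u : Fin M₂ × (Fin n → S₂)), blockSource m.host₂ u ≠ 0 →
    κ₂ j (u.2 j) (c.enc₂ u.1 u.2 j) ≠ 0

theorem Code.exists_letterKernels (hM₁ : 0 < M₁) (hM₂ : 0 < M₂)
    (c : Code S₁ S₂ X₁ X₂ Y M₁ M₂ n) : ∃ κ₁ κ₂, c.LetterKernels m κ₁ κ₂ := by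
  choose κ₁ hκ₁ g₁ pos₁ using fun j : Fin n =>
    exists_kernel hM₁ m.host₁_mem (fun u : Fin M₁ × (Fin n → S₁) => c.enc₁ u.1 u.2 j) j
  choose κ₂ hκ₂ g₂ pos₂ using fun j : Fin n =>
    exists_kernel hM₂ m.host₂_mem (fun u : Fin M₂ × (Fin n → S₂) => c.enc₂ u.1 u.2 j) j
  exact ⟨κ₁, κ₂, hκ₁, hκ₂, g₁, g₂, pos₁, pos₂⟩

section Support

variable {c : Code S₁ S₂ X₁ X₂ Y M₁ M₂ n}
  {ω : (Fin M₁ × (Fin n → S₁)) × (Fin M₂ × (Fin n → S₂)) × (Fin n → Y)}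

theorem Code.source₁_ne_zero (hω : c.joint m ω ≠ 0) : blockSource m.host₁ ω.1 ≠ 0 :=
  left_ne_zero_of_mul (left_ne_zero_of_mul hω)

theorem Code.source₂_ne_zero (hω : c.joint m ω ≠ 0) : blockSource m.host₂ ω.2.1 ≠ 0 :=
  right_ne_zero_of_mul (left_ne_zero_of_mul hω)

theorem Code.host₁_ne_zero (hω : c.joint m ω ≠ 0) (j : Fin n) : m.host₁ (ω.1.2 j) ≠ 0 :=
  Finset.prod_ne_zero_iff.1 (right_ne_zero_of_mul (Code.source₁_ne_zero hω)) j (Finset.mem_univ j)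

theorem Code.host₂_ne_zero (hω : c.joint m ω ≠ 0) (j : Fin n) : m.host₂ (ω.2.1.2 j) ≠ 0 :=
  Finset.prod_ne_zero_iff.1 (right_ne_zero_of_mul (Code.source₂_ne_zero hω)) j (Finset.mem_univ j)

theorem Code.channel_ne_zero (hω : c.joint m ω ≠ 0) (j : Fin n) :
    m.channel (c.enc₁ ω.1.1 ω.1.2 j) (ω.1.2 j) (c.enc₂ ω.2.1.1 ω.2.1.2 j) (ω.2.1.2 j)
      (ω.2.2 j) ≠ 0 :=
  Finset.prod_ne_zero_iff.1 (right_ne_zero_of_mul hω) j (Finset.mem_univ j)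

theorem Code.log_joint (hω : c.joint m ω ≠ 0) : Real.log (c.joint m ω) =
    Real.log (blockSource m.host₁ ω.1) + Real.log (blockSource m.host₂ ω.2.1) +
      ∑ j, Real.log (m.channel (c.enc₁ ω.1.1 ω.1.2 j) (ω.1.2 j)
        (c.enc₂ ω.2.1.1 ω.2.1.2 j) (ω.2.1.2 j) (ω.2.2 j)) := by
  rw [Code.joint, Real.log_mul (left_ne_zero_of_mul hω) (right_ne_zero_of_mul hω),
    Real.log_mul (Code.source₁_ne_zero hω) (Code.source₂_ne_zero hω), Model.blockChannel,
    Real.log_prod fun j _ => Code.channel_ne_zero hω j]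

variable {κ₁ : Fin n → S₁ → X₁ → ℝ} {κ₂ : Fin n → S₂ → X₂ → ℝ}

theorem Code.LetterKernels.out₁_ne_zero (h : c.LetterKernels m κ₁ κ₂) (hω : c.joint m ω ≠ 0)
    (j : Fin n) : m.out₁ (κ₁ j) (ω.2.1.2 j) (c.enc₂ ω.2.1.1 ω.2.1.2 j) (ω.2.2 j) ≠ 0 :=
  (Model.out₁_pos (h.mem₁ j) (mul_ne_zero (mul_ne_zero (Code.host₁_ne_zero hω j)
    (h.ne_zero₁ j _ (Code.source₁_ne_zero hω))) (Code.channel_ne_zero hω j))).ne'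

theorem Code.LetterKernels.out₂_ne_zero (h : c.LetterKernels m κ₁ κ₂) (hω : c.joint m ω ≠ 0)
    (j : Fin n) : m.out₂ (κ₂ j) (ω.1.2 j) (c.enc₁ ω.1.1 ω.1.2 j) (ω.2.2 j) ≠ 0 :=
  (Model.out₂_pos (h.mem₂ j) (mul_ne_zero (mul_ne_zero (Code.host₂_ne_zero hω j)
    (h.ne_zero₂ j _ (Code.source₂_ne_zero hω))) (Code.channel_ne_zero hω j))).ne'

theorem Code.LetterKernels.out₁₂_ne_zero (h : c.LetterKernels m κ₁ κ₂) (hω : c.joint m ω ≠ 0)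
    (j : Fin n) : m.out₁₂ (κ₁ j) (κ₂ j) (ω.2.2 j) ≠ 0 :=
  (Model.out₁₂_pos (h.mem₁ j) (h.mem₂ j) (mul_ne_zero (mul_ne_zero
    (mul_ne_zero (Code.host₁_ne_zero hω j) (h.ne_zero₁ j _ (Code.source₁_ne_zero hω)))
    (mul_ne_zero (Code.host₂_ne_zero hω j) (h.ne_zero₂ j _ (Code.source₂_ne_zero hω))))
    (Code.channel_ne_zero hω j))).ne'

theorem Code.LetterKernels.sum_joint (h : c.LetterKernels m κ₁ κ₂) (j : Fin n)
    (g : S₁ → X₁ → S₂ → X₂ → Y → ℝ) :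
    ∑ ω, c.joint m ω * g (ω.1.2 j) (c.enc₁ ω.1.1 ω.1.2 j) (ω.2.1.2 j) (c.enc₂ ω.2.1.1 ω.2.1.2 j)
      (ω.2.2 j) = m.letterExpect (κ₁ j) (κ₂ j) g :=
  c.sum_joint_letter j (h.sum₁ j) (h.sum₂ j) g

theorem Code.LetterKernels.distortion₁_eq (hS : m.IndepHosts) (h : c.LetterKernels m κ₁ κ₂) :
    c.distortion₁ m = 1 / (n : ℝ) * ∑ j, m.letterExpect (κ₁ j) (κ₂ j)
      fun s₁ x₁ _ _ _ => m.d₁ s₁ x₁ := by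
  rw [Code.distortion₁, expect, c.sum_joint_mul hS]
  simp_rw [← h.sum_joint, mul_left_comm _ (1 / (n : ℝ))]
  rw [← Finset.mul_sum, Finset.sum_comm]
  simp_rw [Finset.mul_sum]

theorem Code.LetterKernels.distortion₂_eq (hS : m.IndepHosts) (h : c.LetterKernels m κ₁ κ₂) :
    c.distortion₂ m = 1 / (n : ℝ) * ∑ j, m.letterExpect (κ₁ j) (κ₂ j)
      fun _ _ s₂ x₂ _ => m.d₂ s₂ x₂ := by
  rw [Code.distortion₂, expect, c.sum_joint_mul hS]
  simp_rw [← h.sum_joint, mul_left_comm _ (1 / (n : ℝ))]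
  rw [← Finset.mul_sum, Finset.sum_comm]
  simp_rw [Finset.mul_sum]

/-- The reference law keeps the source of the second user, generates the output letters
independently from `out₁`, and guesses the first message from the output. In the log-likelihood
ratio the second source cancels, leaving `-Real.log M₁`, the sum of the densities and the cost of
the guess. The product form of the reference output plays the part of subadditivity of the output
entropy. -/
theorem Code.LetterKernels.log_card₁_le (hS : m.IndepHosts) (hM₁ : 0 < M₁) (hM₂ : 0 < M₂)
    (h : c.LetterKernels m κ₁ κ₂) {N : ℝ}
    (hN : Real.log (Fintype.card (Fin M₁ × (Fin n → S₁))) ≤ N) :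
    Real.log M₁ ≤ ∑ j, m.letterExpect (κ₁ j) (κ₂ j) (m.density₁ (κ₁ j)) +
      (Real.log 2 + c.errorProb m * N) := by
  classical
  have hB₂ := blockSource_mem (n := n) hM₂ m.host₂_mem
  simp_rw [← c.sum_joint_mul_errorInd hS, ← h.sum_joint]
  refine le_of_log_sub_log_le (c.joint_nonneg hM₁ hM₂) (c.sum_joint hS hM₁ hM₂)
    (q := fun ω => guess ((c.dec ω.2.2).1, (c.dec ω.2.2).2.1) ω.1 * (blockSource m.host₂ ω.2.1 *
      ∏ j, m.out₁ (κ₁ j) (ω.2.1.2 j) (c.enc₂ ω.2.1.1 ω.2.1.2 j) (ω.2.2 j))) ?_ ?_ ?_ ?_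
  · exact fun ω => mul_nonneg (guess_pos _ _).le (mul_nonneg (hB₂.1 _)
      (Finset.prod_nonneg fun j _ => Model.out₁_nonneg (h.mem₁ j) _ _ _))
  -- The first message is summed first: its guess depends on the output alone and has mass one.
  · rw [Fintype.sum_prod_type_right]
    simp_rw [← Finset.sum_mul, sum_guess, one_mul]
    rw [Fintype.sum_prod_type]
    simp_rw [← Finset.mul_sum, sum_prod_eq_one fun j => (Model.out₁_mem (h.mem₁ j) _ _).2, mul_one,
      hB₂.2]
  · exact fun ω hω => mul_ne_zero (guess_pos _ _).ne' (mul_ne_zero (Code.source₂_ne_zero hω)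
      (Finset.prod_ne_zero_iff.2 fun j _ => h.out₁_ne_zero hω j))
  · intro ω hω
    have h1 : -Real.log (guess ((c.dec ω.2.2).1, (c.dec ω.2.2).2.1) ω.1) ≤
        Real.log 2 + c.errorInd ω * N :=
      neg_log_guess_le_of (c.errorInd_nonneg ω)
        (fun hne => c.one_le_errorInd fun h' => hne (by simp [h'])) hN
    have h2 := Code.source₂_ne_zero hω
    have h3 := Finset.prod_ne_zero_iff.2 fun j (_ : j ∈ Finset.univ) => h.out₁_ne_zero hω j
    rw [Code.log_joint hω, Real.log_mul (guess_pos _ _).ne' (mul_ne_zero h2 h3),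
      Real.log_mul h2 h3, log_blockSource hM₁ (Code.host₁_ne_zero hω),
      Real.log_prod fun j _ => h.out₁_ne_zero hω j]
    simp only [Model.density₁, Finset.sum_sub_distrib, Finset.sum_add_distrib]
    linarith

theorem Code.LetterKernels.log_card₂_le (hS : m.IndepHosts) (hM₁ : 0 < M₁) (hM₂ : 0 < M₂)
    (h : c.LetterKernels m κ₁ κ₂) {N : ℝ}
    (hN : Real.log (Fintype.card (Fin M₂ × (Fin n → S₂))) ≤ N) :
    Real.log M₂ ≤ ∑ j, m.letterExpect (κ₁ j) (κ₂ j) (m.density₂ (κ₂ j)) +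
      (Real.log 2 + c.errorProb m * N) := by
  classical
  have hB₁ := blockSource_mem (n := n) hM₁ m.host₁_mem
  simp_rw [← c.sum_joint_mul_errorInd hS, ← h.sum_joint]
  refine le_of_log_sub_log_le (c.joint_nonneg hM₁ hM₂) (c.sum_joint hS hM₁ hM₂)
    (q := fun ω => guess ((c.dec ω.2.2).2.2.1, (c.dec ω.2.2).2.2.2) ω.2.1 *
      (blockSource m.host₁ ω.1 *
      ∏ j, m.out₂ (κ₂ j) (ω.1.2 j) (c.enc₁ ω.1.1 ω.1.2 j) (ω.2.2 j))) ?_ ?_ ?_ ?_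
  · exact fun ω => mul_nonneg (guess_pos _ _).le (mul_nonneg (hB₁.1 _)
      (Finset.prod_nonneg fun j _ => Model.out₂_nonneg (h.mem₂ j) _ _ _))
  · rw [Fintype.sum_prod_type]
    simp_rw [Fintype.sum_prod_type_right (α₂ := Fin n → Y)]
    simp_rw [← Finset.sum_mul, sum_guess, one_mul, ← Finset.mul_sum,
      sum_prod_eq_one fun j => (Model.out₂_mem (h.mem₂ j) _ _).2, mul_one, hB₁.2]
  · exact fun ω hω => mul_ne_zero (guess_pos _ _).ne' (mul_ne_zero (Code.source₁_ne_zero hω)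
      (Finset.prod_ne_zero_iff.2 fun j _ => h.out₂_ne_zero hω j))
  · intro ω hω
    have h1 : -Real.log (guess ((c.dec ω.2.2).2.2.1, (c.dec ω.2.2).2.2.2) ω.2.1) ≤
        Real.log 2 + c.errorInd ω * N :=
      neg_log_guess_le_of (c.errorInd_nonneg ω)
        (fun hne => c.one_le_errorInd fun h' => hne (by simp [h'])) hN
    have h2 := Code.source₁_ne_zero hω
    have h3 := Finset.prod_ne_zero_iff.2 fun j (_ : j ∈ Finset.univ) => h.out₂_ne_zero hω j
    rw [Code.log_joint hω, Real.log_mul (guess_pos _ _).ne' (mul_ne_zero h2 h3),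
      Real.log_mul h2 h3, log_blockSource hM₂ (Code.host₂_ne_zero hω),
      Real.log_prod fun j _ => h.out₂_ne_zero hω j]
    simp only [Model.density₂, Finset.sum_sub_distrib, Finset.sum_add_distrib]
    linarith

theorem Code.LetterKernels.log_card₁₂_le (hS : m.IndepHosts) (hM₁ : 0 < M₁) (hM₂ : 0 < M₂)
    (h : c.LetterKernels m κ₁ κ₂) {N : ℝ}
    (hN : Real.log (Fintype.card ((Fin M₁ × (Fin n → S₁)) × (Fin M₂ × (Fin n → S₂)))) ≤ N) :
    Real.log M₁ + Real.log M₂ ≤ ∑ j, m.letterExpect (κ₁ j) (κ₂ j) (m.density₁₂ (κ₁ j) (κ₂ j)) +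
      (Real.log 2 + c.errorProb m * N) := by
  classical
  simp_rw [← c.sum_joint_mul_errorInd hS, ← h.sum_joint]
  refine le_of_log_sub_log_le (c.joint_nonneg hM₁ hM₂) (c.sum_joint hS hM₁ hM₂)
    (q := fun ω => guess (((c.dec ω.2.2).1, (c.dec ω.2.2).2.1),
      ((c.dec ω.2.2).2.2.1, (c.dec ω.2.2).2.2.2)) (ω.1, ω.2.1) *
      ∏ j, m.out₁₂ (κ₁ j) (κ₂ j) (ω.2.2 j)) ?_ ?_ ?_ ?_
  · exact fun ω => mul_nonneg (guess_pos _ _).le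
      (Finset.prod_nonneg fun j _ => Model.out₁₂_nonneg (h.mem₁ j) (h.mem₂ j) _)
  · rw [← (Equiv.prodAssoc (Fin M₁ × (Fin n → S₁)) (Fin M₂ × (Fin n → S₂))
      (Fin n → Y)).sum_comp, Fintype.sum_prod_type_right]
    simp_rw [Equiv.prodAssoc_apply, Prod.mk.eta, ← Finset.sum_mul, sum_guess, one_mul]
    exact sum_prod_eq_one fun j => (Model.out₁₂_mem (h.mem₁ j) (h.mem₂ j)).2
  · exact fun ω hω => mul_ne_zero (guess_pos _ _).ne'
      (Finset.prod_ne_zero_iff.2 fun j _ => h.out₁₂_ne_zero hω j)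
  · intro ω hω
    have h1 : -Real.log (guess (((c.dec ω.2.2).1, (c.dec ω.2.2).2.1),
        ((c.dec ω.2.2).2.2.1, (c.dec ω.2.2).2.2.2)) (ω.1, ω.2.1)) ≤
        Real.log 2 + c.errorInd ω * N :=
      neg_log_guess_le_of (c.errorInd_nonneg ω)
        (fun hne => c.one_le_errorInd fun h' => hne (by simp [h'])) hN
    have h3 := Finset.prod_ne_zero_iff.2 fun j (_ : j ∈ Finset.univ) => h.out₁₂_ne_zero hω j
    rw [Code.log_joint hω, Real.log_mul (guess_pos _ _).ne' h3,
      log_blockSource hM₁ (Code.host₁_ne_zero hω), log_blockSource hM₂ (Code.host₂_ne_zero hω),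
      Real.log_prod fun j _ => h.out₁₂_ne_zero hω j]
    simp only [Model.density₁₂, Finset.sum_sub_distrib, Finset.sum_add_distrib]
    linarith

end Support

/-- Converse part of the coding theorem for one code. -/
theorem Code.exists_mem_rateRegion (hS : m.IndepHosts) (hM₁ : 0 < M₁) (hM₂ : 0 < M₂) (hn : 0 < n)
    (c : Code S₁ S₂ X₁ X₂ Y M₁ M₂ n) {N : ℝ}
    (hN : Real.log (Fintype.card (Fin M₁ × (Fin n → S₁))) +
      Real.log (Fintype.card (Fin M₂ × (Fin n → S₂))) ≤ N) :
    ∃ v ∈ m.rateRegion, v 3 = c.distortion₁ m ∧ v 4 = c.distortion₂ m ∧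
      Real.log M₁ ≤ n * (v 0 * Real.log 2) + (Real.log 2 + c.errorProb m * N) ∧
      Real.log M₂ ≤ n * (v 1 * Real.log 2) + (Real.log 2 + c.errorProb m * N) ∧
      Real.log M₁ + Real.log M₂ ≤ n * (v 2 * Real.log 2) +
        (Real.log 2 + c.errorProb m * N) := by
  have hn' : (n : ℝ) ≠ 0 := by positivity
  have hlog : Real.log 2 ≠ 0 := (Real.log_pos one_lt_two).ne'
  obtain ⟨κ₁, κ₂, h⟩ := c.exists_letterKernels (m := m) hM₁ hM₂
  have c₁ := card_pos_of_mem_stdSimplex (blockSource_mem (n := n) hM₁ m.host₁_mem)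
  have c₂ := card_pos_of_mem_stdSimplex (blockSource_mem (n := n) hM₂ m.host₂_mem)
  have l₁ : 0 ≤ Real.log (Fintype.card (Fin M₁ × (Fin n → S₁))) :=
    Real.log_nonneg (by exact_mod_cast c₁)
  have l₂ : 0 ≤ Real.log (Fintype.card (Fin M₂ × (Fin n → S₂))) :=
    Real.log_nonneg (by exact_mod_cast c₂)
  have hN₁₂ : Real.log (Fintype.card ((Fin M₁ × (Fin n → S₁)) × (Fin M₂ × (Fin n → S₂)))) ≤ N := by
    rw [Fintype.card_prod (Fin M₁ × (Fin n → S₁)), Nat.cast_mul,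
      Real.log_mul (by exact_mod_cast c₁.ne') (by exact_mod_cast c₂.ne')]
    exact hN
  have hv : ∀ i, (∑ j, (1 / (n : ℝ)) • m.rateVec (κ₁ j, κ₂ j)) i =
      1 / (n : ℝ) * ∑ j, m.rateVec (κ₁ j, κ₂ j) i := by
    intro i
    simp only [Finset.sum_apply, Pi.smul_apply, smul_eq_mul, Finset.mul_sum]
  have hmul : ∀ f : Fin n → ℝ, (n : ℝ) * (1 / (n : ℝ) * ∑ j, f j / Real.log 2 * Real.log 2) =
      ∑ j, f j := by
    intro f
    simp_rw [div_mul_cancel₀ _ hlog]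
    field_simp
  refine ⟨_, Model.sum_rateVec_mem (m := m) hn h.mem₁ h.mem₂, ?_, ?_, ?_, ?_, ?_⟩
  · rw [hv, h.distortion₁_eq hS]
    rfl
  · rw [hv, h.distortion₂_eq hS]
    rfl
  · rw [hv, mul_assoc, Finset.sum_mul]
    exact (h.log_card₁_le hS hM₁ hM₂ (by linarith)).trans
      (add_le_add (hmul _).ge le_rfl)
  · rw [hv, mul_assoc, Finset.sum_mul]
    exact (h.log_card₂_le hS hM₁ hM₂ (by linarith)).trans
      (add_le_add (hmul _).ge le_rfl)
  · rw [hv, mul_assoc, Finset.sum_mul]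
    exact (h.log_card₁₂_le hS hM₁ hM₂ hN₁₂).trans (add_le_add (hmul _).ge le_rfl)

end ConverseBounds

/-! ### Zero entropy means a deterministic host. -/

section Deterministic

/-- A vanishing sum of nonnegative terms forces every probability to be zero or one, and they cannot
all be zero. -/
theorem exists_prob_eq_one_of_entropy_eq_zero {Ω A : Type*} [Fintype Ω] [Fintype A] {p : Ω → ℝ}
    (hp : p ∈ stdSimplex ℝ Ω) {f : Ω → A} (h : entropy p f = 0) : ∃ a, prob p f a = 1 := by
  classical
  have h0 : ∀ a, 0 ≤ prob p f a := fun a => Finset.sum_nonneg fun _ _ => hp.1 _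
  have h1 : ∑ a, prob p f a = 1 := by
    rw [← hp.2, ← Finset.sum_fiberwise Finset.univ f]
    exact Finset.sum_congr rfl fun a _ => by rw [prob]
  have hle : ∀ a, prob p f a ≤ 1 := fun a =>
    h1 ▸ Finset.single_le_sum (fun b _ => h0 b) (Finset.mem_univ a)
  have hlog : Real.log 2 ≠ 0 := (Real.log_pos one_lt_two).ne'
  rw [entropy, ← Finset.sum_div, div_eq_zero_iff, or_iff_left hlog,
    Finset.sum_eq_zero_iff_of_nonneg fun a _ => Real.negMulLog_nonneg (h0 a) (hle a)] at h
  by_contra! hne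
  have hz : ∀ a, prob p f a = 0 := by
    intro a
    have ha := h a (Finset.mem_univ a)
    rw [Real.negMulLog, mul_eq_zero, neg_eq_zero, Real.log_eq_zero] at ha
    rcases ha with ha | ha | ha | ha
    · exact ha
    · exact ha
    · exact absurd ha (hne a)
    · linarith [h0 a]
  simp [hz] at h1

variable {S₁ S₂ X₁ X₂ Y : Type*} [Fintype S₁] [Fintype S₂] [Fintype X₁] [Fintype X₂] [Fintype Y]
  {m : Model S₁ S₂ X₁ X₂ Y}

theorem Model.prob_fst (s : S₁) : prob m.host Prod.fst s = m.host₁ s :=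
  prob_eq_sum m.host (fun t => (s, t)) Prod.snd (by simp) (by simp) (by rintro ⟨a, b⟩ rfl; rfl)

theorem Model.prob_snd (s : S₂) : prob m.host Prod.snd s = m.host₂ s :=
  prob_eq_sum m.host (fun t => (t, s)) Prod.fst (by simp) (by simp) (by rintro ⟨a, b⟩ rfl; rfl)

theorem Model.exists_host₁_eq_one (h : entropy m.host Prod.fst = 0) : ∃ s, m.host₁ s = 1 := by
  obtain ⟨s, hs⟩ := exists_prob_eq_one_of_entropy_eq_zero m.host_mem h
  exact ⟨s, by rw [← Model.prob_fst, hs]⟩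

theorem Model.exists_host₂_eq_one (h : entropy m.host Prod.snd = 0) : ∃ s, m.host₂ s = 1 := by
  obtain ⟨s, hs⟩ := exists_prob_eq_one_of_entropy_eq_zero m.host_mem h
  exact ⟨s, by rw [← Model.prob_snd, hs]⟩

theorem Model.exists_host_eq_one (h : entropy m.host id = 0) :
    (∃ s, m.host₁ s = 1) ∧ ∃ s, m.host₂ s = 1 := by
  obtain ⟨s, hs⟩ := exists_prob_eq_one_of_entropy_eq_zero m.host_mem h
  rw [prob_eq_sum m.host (T := Unit) (fun _ => s) (fun _ => ()) (by simp) (by simp)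
    (by simp [eq_comm])] at hs
  simp only [Finset.univ_unique, Finset.sum_const, Finset.card_singleton, one_smul] at hs
  have l₁ : ∀ t, m.host₁ t ≤ 1 := fun t => (m.host₁_mem.2 ▸
    Finset.single_le_sum (fun b _ => m.host₁_mem.1 b) (Finset.mem_univ t) : _)
  have l₂ : ∀ t, m.host₂ t ≤ 1 := fun t => (m.host₂_mem.2 ▸
    Finset.single_le_sum (fun b _ => m.host₂_mem.1 b) (Finset.mem_univ t) : _)
  refine ⟨⟨s.1, le_antisymm (l₁ _) ?_⟩, ⟨s.2, le_antisymm (l₂ _) ?_⟩⟩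
  · rw [← hs]
    exact Finset.single_le_sum (f := fun t => m.host (s.1, t)) (fun _ _ => m.host_mem.1 _)
      (Finset.mem_univ s.2)
  · rw [← hs]
    exact Finset.single_le_sum (f := fun t => m.host (t, s.2)) (fun _ _ => m.host_mem.1 _)
      (Finset.mem_univ s.1)

end Deterministic

/-! ### Passage to the limit, and removal of the borderline. -/

section Final

variable {S₁ S₂ X₁ X₂ Y : Type*} [Fintype S₁] [Fintype S₂] [Fintype X₁] [Fintype X₂] [Fintype Y]
  {m : Model S₁ S₂ X₁ X₂ Y} {Δ₁ Δ₂ : ℝ}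

/-- The rate pair satisfies the three bounds, weakly, for some admissible tuple. -/
def Model.Dominated (m : Model S₁ S₂ X₁ X₂ Y) (Δ₁ Δ₂ : ℝ) (R : ℝ × ℝ) : Prop :=
  ∃ v ∈ m.rateRegion, R.1 ≤ v 0 ∧ R.2 ≤ v 1 ∧ R.1 + R.2 ≤ v 2 ∧ v 3 ≤ Δ₁ ∧ v 4 ≤ Δ₂

/-- By compactness a subsequence of the vectors converges within the region, and weak inequalities
survive. It is used both for sequences of codes and for sequences in `innerSet`. -/
theorem Model.dominated_of_tendsto {R : ℝ × ℝ} {v : ℕ → Fin 5 → ℝ} (hv : ∀ n, v n ∈ m.rateRegion)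
    {a₁ a₂ a₁₂ D₁ D₂ : ℕ → ℝ} {E₁ E₂ : ℝ} (ha₁ : Tendsto a₁ atTop (𝓝 R.1))
    (ha₂ : Tendsto a₂ atTop (𝓝 R.2)) (ha₁₂ : Tendsto a₁₂ atTop (𝓝 (R.1 + R.2)))
    (hD₁ : Tendsto D₁ atTop (𝓝 E₁)) (hD₂ : Tendsto D₂ atTop (𝓝 E₂)) (hE₁ : E₁ ≤ Δ₁) (hE₂ : E₂ ≤ Δ₂)
    (h₁ : ∀ n, a₁ n ≤ v n 0) (h₂ : ∀ n, a₂ n ≤ v n 1) (h₁₂ : ∀ n, a₁₂ n ≤ v n 2)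
    (h₃ : ∀ n, v n 3 ≤ D₁ n) (h₄ : ∀ n, v n 4 ≤ D₂ n) : m.Dominated Δ₁ Δ₂ R := by
  obtain ⟨w, hw, φ, hφ, hlim⟩ := m.isCompact_rateRegion.tendsto_subseq hv
  have hl := tendsto_pi_nhds.1 hlim
  have hφ' := hφ.tendsto_atTop
  exact ⟨w, hw, le_of_tendsto_of_tendsto' (ha₁.comp hφ') (hl 0) fun n => h₁ _,
    le_of_tendsto_of_tendsto' (ha₂.comp hφ') (hl 1) fun n => h₂ _,
    le_of_tendsto_of_tendsto' (ha₁₂.comp hφ') (hl 2) fun n => h₁₂ _,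
    (le_of_tendsto_of_tendsto' (hl 3) (hD₁.comp hφ') fun n => h₃ _).trans hE₁,
    (le_of_tendsto_of_tendsto' (hl 4) (hD₂.comp hφ') fun n => h₄ _).trans hE₂⟩

theorem Model.exists_admissible (hS : m.IndepHosts) {v : Fin 5 → ℝ} (hv : v ∈ m.rateRegion)
    (h₃ : v 3 ≤ Δ₁) (h₄ : v 4 ≤ Δ₂) :
    ∃ (Q : Type) (_ : Fintype Q) (p : Letters Q S₁ S₂ X₁ X₂ Y → ℝ),
      IsAdmissible m Δ₁ Δ₂ p ∧ bound₁ p = v 0 ∧ bound₂ p = v 1 ∧ bound₁₂ p = v 2 := by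
  obtain ⟨Q, _, p, pQ, κ₁, κ₂, h, rfl⟩ := Model.exists_tuple hv
  exact ⟨Q, inferInstance, p, h.isAdmissible hS h₃ h₄, rfl, rfl, rfl⟩

/-- Lowering both rates by `ε` makes all inequalities strict. The lowered rates may be negative,
which `innerSet` allows and achievability does not; this is the source of the borderline case. -/
theorem Model.Dominated.mem_closure_innerSet (hS : m.IndepHosts) {R : ℝ × ℝ}
    (hR : m.Dominated Δ₁ Δ₂ R) : R ∈ closure (innerSet m Δ₁ Δ₂) := by
  obtain ⟨v, hv, h₁, h₂, h₁₂, h₃, h₄⟩ := hR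
  obtain ⟨Q, iQ, p, hp, e₁, e₂, e₁₂⟩ := Model.exists_admissible hS hv h₃ h₄
  have hlim : Tendsto (fun ε : ℝ => (R.1 - ε, R.2 - ε)) (𝓝[>] 0) (𝓝 R) := by
    have : Continuous fun ε : ℝ => (R.1 - ε, R.2 - ε) := by fun_prop
    simpa using this.continuousWithinAt (s := Set.Ioi 0) (x := 0) |>.tendsto
  refine mem_closure_of_tendsto hlim ?_
  filter_upwards [self_mem_nhdsWithin] with ε hε
  have hε' : 0 < ε := hε
  refine ⟨Q, iQ, p, hp, ?_, ?_, ?_⟩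
  · rw [e₁]; dsimp only; linarith
  · rw [e₂]; dsimp only; linarith
  · rw [e₁₂]; dsimp only; linarith

theorem Model.dominated_of_mem_closure_innerSet (hS : m.IndepHosts) {R : ℝ × ℝ}
    (hR : R ∈ closure (innerSet m Δ₁ Δ₂)) : m.Dominated Δ₁ Δ₂ R := by
  obtain ⟨r, hr, hlim⟩ := mem_closure_iff_seq_limit.1 hR
  choose Q iQ p hp h₁ h₂ h₁₂ using hr
  have hl₁ : Tendsto (fun n => (r n).1) atTop (𝓝 R.1) := (continuous_fst.tendsto R).comp hlim
  have hl₂ : Tendsto (fun n => (r n).2) atTop (𝓝 R.2) := (continuous_snd.tendsto R).comp hlim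
  refine Model.dominated_of_tendsto (v := fun n => m.tupleVec (p n)) (fun n => ?_) hl₁ hl₂
    (hl₁.add hl₂) (tendsto_const_nhds (x := Δ₁)) (tendsto_const_nhds (x := Δ₂)) le_rfl le_rfl
    (fun n => (h₁ n).le) (fun n => (h₂ n).le) (fun n => (h₁₂ n).le) (fun n => (hp n).2.1)
    (fun n => (hp n).2.2)
  obtain ⟨pQ, κ₁, κ₂, h⟩ := (hp n).exists_factors hS
  exact h.tupleVec_mem

theorem log_card_block_le {S : Type*} [Fintype S] {p : S → ℝ} (hp : p ∈ stdSimplex ℝ S) {R : ℝ}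
    (hR : 0 ≤ R) (n : ℕ) : Real.log (Fintype.card (Fin ⌈(2 : ℝ) ^ ((n : ℝ) * R)⌉₊ × (Fin n → S))) ≤
      Real.log 2 + n * (R * Real.log 2 + Real.log (Fintype.card S)) := by
  classical
  have hc := card_pos_of_mem_stdSimplex hp
  have hM := ceil_two_rpow_pos n R
  rw [Fintype.card_prod, Fintype.card_fin, Fintype.card_fun, Fintype.card_fin, Nat.cast_mul,
    Nat.cast_pow, Real.log_mul (by positivity) (by positivity), Real.log_pow]
  linarith [log_ceil_two_rpow_le hR n]

theorem le_log_ceil_two_rpow (n : ℕ) (R : ℝ) :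
    n * (R * Real.log 2) ≤ Real.log (⌈(2 : ℝ) ^ ((n : ℝ) * R)⌉₊ : ℝ) := by
  have h := Real.log_le_log (Real.rpow_pos_of_pos two_pos _) (Nat.le_ceil ((2 : ℝ) ^ ((n : ℝ) * R)))
  rwa [Real.log_rpow two_pos, mul_assoc] at h

theorem Achievable.dominated (hS : m.IndepHosts) {R : ℝ × ℝ} (hR : Achievable m Δ₁ Δ₂ R) :
    m.Dominated Δ₁ Δ₂ R := by
  obtain ⟨hR₁, hR₂, c, ⟨E₁, hE₁, hD₁⟩, ⟨E₂, hE₂, hD₂⟩, hP⟩ := hR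
  have hlog : 0 < Real.log 2 := Real.log_pos one_lt_two
  set K := (R.1 * Real.log 2 + Real.log (Fintype.card S₁)) +
    (R.2 * Real.log 2 + Real.log (Fintype.card S₂)) with hK
  -- The shift to `n + 1` avoids block length zero.
  have key := fun n : ℕ => (c (n + 1)).exists_mem_rateRegion hS (ceil_two_rpow_pos (n + 1) R.1)
    (ceil_two_rpow_pos (n + 1) R.2) n.succ_pos (N := 2 * Real.log 2 + (n + 1 : ℕ) * K) (by
      have h1 := log_card_block_le m.host₁_mem hR₁ (n + 1)
      have h2 := log_card_block_le m.host₂_mem hR₂ (n + 1)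
      rw [hK]
      linarith)
  choose v hv h₃ h₄ h₁ h₂ h₁₂ using key
  -- The Fano term per letter, in bits: the log-cardinality grows linearly in the block length, so
  -- the vanishing error probability makes it tend to zero.
  set δ : ℕ → ℝ := fun n => (Real.log 2 / n +
    (c n).errorProb m * (2 * Real.log 2 / n + K)) / Real.log 2 with hδ
  have hδlim : Tendsto δ atTop (𝓝 0) := by
    have t1 := tendsto_const_div_atTop_nhds_zero_nat (Real.log 2)
    have t2 := tendsto_const_div_atTop_nhds_zero_nat (2 * Real.log 2)
    have := (t1.add (hP.mul (t2.add_const K))).div_const (Real.log 2)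
    simpa using this
  have hδ' := hδlim.comp (tendsto_add_atTop_nat 1)
  have lim : ∀ r : ℝ, Tendsto (fun n => r - δ (n + 1)) atTop (𝓝 r) := fun r => by
    simpa using hδ'.const_sub r
  have main : ∀ (n : ℕ) (r w : ℝ), (n + 1 : ℕ) * (r * Real.log 2) ≤
      (n + 1 : ℕ) * (w * Real.log 2) + (Real.log 2 + (c (n + 1)).errorProb m *
        (2 * Real.log 2 + (n + 1 : ℕ) * K)) → r - δ (n + 1) ≤ w := by
    intro n r w h
    have hn : (0 : ℝ) < (n + 1 : ℕ) := by positivity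
    have e : (n + 1 : ℕ) * (δ (n + 1) * Real.log 2) = Real.log 2 + (c (n + 1)).errorProb m *
        (2 * Real.log 2 + (n + 1 : ℕ) * K) := by
      simp only [hδ]
      field_simp
    rw [← e, ← mul_add, ← add_mul] at h
    have := le_of_mul_le_mul_right (le_of_mul_le_mul_left h hn) hlog
    linarith
  refine Model.dominated_of_tendsto hv (lim R.1) (lim R.2) (lim (R.1 + R.2))
    (hD₁.comp (tendsto_add_atTop_nat 1)) (hD₂.comp (tendsto_add_atTop_nat 1)) hE₁ hE₂
    (fun n => main n _ _ ((le_log_ceil_two_rpow _ _).trans (h₁ n)))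
    (fun n => main n _ _ ((le_log_ceil_two_rpow _ _).trans (h₂ n)))
    (fun n => main n _ _ (le_trans ?_ (h₁₂ n))) (fun n => (h₃ n).le) (fun n => (h₄ n).le)
  have a := le_log_ceil_two_rpow (n + 1) R.1
  have b := le_log_ceil_two_rpow (n + 1) R.2
  linarith

/-- Mixing in weight `t` of the tuple from `hm` keeps the distortion constraints and makes the
bounds strict wherever its own bounds are positive. Those not known to be positive involve only
deterministic hosts; there the rates are lowered slightly, and at zero no strict inequality is
needed. -/
theorem Model.Dominated.mem_capacityRegion (hS : m.IndepHosts) (hm : NotBorderline m Δ₁ Δ₂)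
    {R : ℝ × ℝ} (hR : m.Dominated Δ₁ Δ₂ R) (hR₁ : 0 ≤ R.1) (hR₂ : 0 ≤ R.2) :
    R ∈ capacityRegion m Δ₁ Δ₂ := by
  classical
  obtain ⟨v, hv, h₁, h₂, h₁₂, h₃, h₄⟩ := hR
  obtain ⟨Q, iQ, p, hp, e₁, e₂, e₁₂⟩ := Model.exists_admissible hS hv h₃ h₄
  obtain ⟨Q', iQ', p', hp', b₁, b₂, b₁₂⟩ := hm ⟨Q, iQ, p, hp, by linarith, by linarith, by linarith⟩
  obtain ⟨pQ', κ₁', κ₂', hf'⟩ := hp'.exists_factors hS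
  set w := m.tupleVec p' with hw
  have hwmem : w ∈ m.rateRegion := hf'.tupleVec_mem
  have w₃ : w 3 ≤ Δ₁ := hp'.2.1
  have w₄ : w 4 ≤ Δ₂ := hp'.2.2
  replace b₁ : (∃ s, m.host₁ s = 1) ∨ 0 < w 0 := b₁.imp_left Model.exists_host₁_eq_one
  replace b₂ : (∃ s, m.host₂ s = 1) ∨ 0 < w 1 := b₂.imp_left Model.exists_host₂_eq_one
  replace b₁₂ : ((∃ s, m.host₁ s = 1) ∧ ∃ s, m.host₂ s = 1) ∨ 0 < w 2 :=
    b₁₂.imp_left Model.exists_host_eq_one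
  -- Large enough that adding it to any of the three bounds of the second tuple, even a negative
  -- one, gives a positive number.
  set C := |w 0| + |w 1| + |w 2| + 1 with hC
  have C0 : 0 < C := by positivity
  have Cw₀ : 0 < C + w 0 := by linarith [neg_abs_le (w 0), abs_nonneg (w 1), abs_nonneg (w 2)]
  have Cw₁ : 0 < C + w 1 := by linarith [neg_abs_le (w 1), abs_nonneg (w 0), abs_nonneg (w 2)]
  have Cw₂ : 0 < C + w 2 := by linarith [neg_abs_le (w 2), abs_nonneg (w 1), abs_nonneg (w 0)]
  set C₁ := if ∃ s, m.host₁ s = 1 then C else 0 with hC₁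
  set C₂ := if ∃ s, m.host₂ s = 1 then C else 0 with hC₂
  -- The approximating rates: the rate of a nondeterministic host is only scaled by `1 - t`, while
  -- that of a deterministic one is also lowered by `t * C` and cut off at zero.
  set f : ℝ → ℝ × ℝ := fun t =>
    (max 0 ((1 - t) * R.1 - t * C₁), max 0 ((1 - t) * R.2 - t * C₂)) with hf
  have hlim : Tendsto f (𝓝[>] 0) (𝓝 R) := by
    have hcont : Continuous f := by fun_prop
    have h0 : f 0 = R := by simp [hf, hR₁, hR₂]
    have := (hcont.continuousWithinAt (s := Set.Ioi 0) (x := 0)).tendsto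
    rwa [h0] at this
  refine mem_closure_of_tendsto hlim ?_
  filter_upwards [Ioo_mem_nhdsGT (zero_lt_one' ℝ)] with t ht
  obtain ⟨t0, t1⟩ := ht
  have hu : (1 - t) • v + t • w ∈ m.rateRegion :=
    convex_convexHull ℝ _ hv hwmem (sub_pos.2 t1).le t0.le (by ring)
  obtain ⟨Q'', iQ'', p'', pQ, κ₁, κ₂, hfac, hvec⟩ := Model.exists_tuple hu
  have hcoord : ∀ i, m.tupleVec p'' i = (1 - t) * v i + t * w i := fun i => by rw [hvec]; rfl
  have s0 : 0 < 1 - t := sub_pos.2 t1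
  have g₁ : (1 - t) * R.1 ≤ (1 - t) * v 0 := mul_le_mul_of_nonneg_left h₁ s0.le
  have g₂ : (1 - t) * R.2 ≤ (1 - t) * v 1 := mul_le_mul_of_nonneg_left h₂ s0.le
  have g₁₂ : (1 - t) * (R.1 + R.2) ≤ (1 - t) * v 2 := mul_le_mul_of_nonneg_left h₁₂ s0.le
  have pos₁ : 0 ≤ (1 - t) * R.1 := mul_nonneg s0.le hR₁
  have pos₂ : 0 ≤ (1 - t) * R.2 := mul_nonneg s0.le hR₂
  have alt₁ : (f t).1 = (1 - t) * R.1 - t * C₁ ∨ (f t).1 = 0 ∧ ∃ s, m.host₁ s = 1 := by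
    by_cases hd : ∃ s, m.host₁ s = 1
    · rcases max_choice 0 ((1 - t) * R.1 - t * C₁) with h | h
      · exact Or.inr ⟨h, hd⟩
      · exact Or.inl h
    · left
      simp only [hf, hC₁, if_neg hd, mul_zero, sub_zero, max_eq_right pos₁]
  have alt₂ : (f t).2 = (1 - t) * R.2 - t * C₂ ∨ (f t).2 = 0 ∧ ∃ s, m.host₂ s = 1 := by
    by_cases hd : ∃ s, m.host₂ s = 1
    · rcases max_choice 0 ((1 - t) * R.2 - t * C₂) with h | h
      · exact Or.inr ⟨h, hd⟩
      · exact Or.inl h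
    · left
      simp only [hf, hC₂, if_neg hd, mul_zero, sub_zero, max_eq_right pos₂]
  have q₁ : 0 < C₁ + w 0 := by
    by_cases hd : ∃ s, m.host₁ s = 1
    · rwa [hC₁, if_pos hd]
    · rw [hC₁, if_neg hd, zero_add]
      exact b₁.resolve_left hd
  have q₂ : 0 < C₂ + w 1 := by
    by_cases hd : ∃ s, m.host₂ s = 1
    · rwa [hC₂, if_pos hd]
    · rw [hC₂, if_neg hd, zero_add]
      exact b₂.resolve_left hd
  have n₁ : 0 ≤ C₁ := by rw [hC₁]; split_ifs; exacts [C0.le, le_rfl]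
  have n₂ : 0 ≤ C₂ := by rw [hC₂]; split_ifs; exacts [C0.le, le_rfl]
  -- If the joint bound is not positive, both hosts are deterministic and the lowered rates make up
  -- for it.
  have q₁₂ : 0 < C₁ + C₂ + w 2 := by
    rcases b₁₂ with ⟨hd₁, -⟩ | hpos
    · have : C₁ = C := by rw [hC₁, if_pos hd₁]
      linarith
    · linarith
  have k₁ := mul_pos t0 q₁
  have k₂ := mul_pos t0 q₂
  have k₁₂ := mul_pos t0 q₁₂
  refine hfac.achievable hS ?_ ?_ (le_max_left _ _) (le_max_left _ _) ?_ ?_ ?_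
  · rw [hcoord]
    nlinarith
  · rw [hcoord]
    nlinarith
  · refine alt₁.imp_left fun h => ?_
    have hb : bound₁ p'' = (1 - t) * v 0 + t * w 0 := hcoord 0
    rw [h, hb]
    linarith
  · refine alt₂.imp_left fun h => ?_
    have hb : bound₂ p'' = (1 - t) * v 1 + t * w 1 := hcoord 1
    rw [h, hb]
    linarith
  · rcases alt₁ with h | h
    · rcases alt₂ with h' | h'
      · left
        have hb : bound₁₂ p'' = (1 - t) * v 2 + t * w 2 := hcoord 2
        rw [h, h', hb]
        linarith
      · exact Or.inr (Or.inr h')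
    · exact Or.inr (Or.inl h)

end Final

end InfoEmbedding

end

theorem mainTheorem3 {S₁ S₂ X₁ X₂ Y : Type*}
    [Fintype S₁] [Fintype S₂] [Fintype X₁] [Fintype X₂] [Fintype Y]
    (m : InfoEmbedding.Model S₁ S₂ X₁ X₂ Y) (hS : m.IndepHosts) (Δ₁ Δ₂ : ℝ)
    (hm : InfoEmbedding.NotBorderline m Δ₁ Δ₂) :
    InfoEmbedding.capacityRegion m Δ₁ Δ₂ =
      closure (InfoEmbedding.innerSet m Δ₁ Δ₂) ∩ {R | 0 ≤ R.1 ∧ 0 ≤ R.2} := by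
  refine Set.Subset.antisymm (closure_minimal (fun R hR => ?_) ?_) fun R hR => ?_
  · exact ⟨(InfoEmbedding.Achievable.dominated hS hR).mem_closure_innerSet hS, hR.1, hR.2.1⟩
  · exact isClosed_closure.inter ((isClosed_le continuous_const continuous_fst).inter
      (isClosed_le continuous_const continuous_snd))
  · exact (InfoEmbedding.Model.dominated_of_mem_closure_innerSet hS hR.1).mem_capacityRegion hS hm
      hR.2.1 hR.2.2
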